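/- Let $\mathcal G$ be a connected compact metric graph: finitely many vertices and edges, each edge $e$ being identified with an interval $[0,l_e]$ of finite length $l_e>0$; loops and multiple edges are allowed, and the degree of a vertex is the number of edge ends at it. Suppose that $\mathcal G$ has $m\ge1$ vertices of degree $1$, let $p>1$, and let $v_1,\dots,v_k$ be distinct vertices of degree $1$, $1\le k\le m$. Let $I_i$ be the terminal edge ending at $v_i$ and $l_i$ its length; the coordinate on $I_i\cong[0,l_i]$ used below for the index $i$ is the distance from $v_i$ along $I_i$. Let $$U(x)=\Big(\frac{p+1}{2}\Big)^{\frac1{p-1}}\Big[\cosh\Big(\frac{p-1}{2}x\Big)\Big]^{-\frac{2}{p-1}},$$ the even positive solution in $H^1(\mathbb R)$ of $-U''+U=U^p$. Fix $0<l<\min_i l_i$ and, for each $i$, a smooth cut-off function $\chi_i$ on $I_i$ with $\chi_i(x)=1$ for $0\le x\le l/2$ and $\chi_i(x)=0$ for $x\ge l$, and set $$U_{\lambda,i}(x)=\begin{cases}\lambda^{\frac1{p-1}}U(\sqrt\lambda\,x)&\text{on } I_i,\\ 0&\text{on }\mathcal G\setminus I_i,\end{cases}\qquad W_\lambda=\sum_{i=1}^k\chi_iU_{\lambda,i}.$$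 Let $H^1(\mathcal G)$ be the space of continuous functions on $\mathcal G$ whose restriction to each edge $e$ is in $H^1(0,l_e)$, and let $\|\phi\|_\lambda^2=\int_{\mathcal G}|\phi'|^2\,dx+\lambda\int_{\mathcal G}\phi^2\,dx$. Then there is $\lambda_0>0$ such that for every $\lambda>\lambda_0$ there is a $k$-peaked solution $u_\lambda$ with a single peak at each $v_i$, that is, a function $u_\lambda\in H^1(\mathcal G)$, of class $C^2$ on each closed edge, of the form $$u_\lambda=W_\lambda+\phi_\lambda,\qquad \phi_\lambda\in H^1(\mathcal G),$$ with $u_\lambda>0$ on $\mathcal G$, $-u_\lambda''+\lambda u_\lambda=|u_\lambda|^{p-1}u_\lambda$ on every edge, and the Kirchhoff condition at every vertex (the sum of the derivatives in the directions leaving the vertex is $0$). Moreover, as $\lambda\to\infty$, $$\|\phi_\lambda\|_\lambda=O(\lambda^{-\alpha})\quad\text{for every }\alpha>0,$$ and $$\rho_\lambda^2:=|u_\lambda|_{L^2(\mathcal G)}^2=C\lambda^{\frac{5-p}{2(p-1)}}+o\big(\lambda^{\frac{5-p}{2(p-1)}}\big),\qquad C=k\int_0^{\infty}U(x)^2\,dx>0.$$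 -/

import Mathlib

open Set Filter Asymptotics MeasureTheory
open scoped ContDiff

/-- A compact metric graph: finitely many vertices and edges (the finiteness is carried by
`Fintype` instances on `V` and `E`), loops and multiple edges allowed. The edge `e` is identified
with the interval `[0, len e]`, the vertex `src e` being at the coordinate `0` and `tgt e` at the
coordinate `len e`. -/
structure MetricGraph (V E : Type*) where
  src : E → V
  tgt : E → V
  len : E → ℝ
  len_pos : ∀ e, 0 < len e

noncomputable section

/-! ### The Sobolev space `H¹(0, l)` -/

/-- `g` is a weak derivative of `f` on `(0, l)`. -/
def IsWeakDeriv (l : ℝ) (f g : ℝ → ℝ) : Prop :=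
  ∀ η : ℝ → ℝ, ContDiff ℝ ∞ η → HasCompactSupport η → tsupport η ⊆ Ioo 0 l →
    ∫ x in (0 : ℝ)..l, f x * deriv η x = -∫ x in (0 : ℝ)..l, g x * η x

/-- `f` has a weak derivative in `L²(0, l)`. -/
def HasL2WeakDeriv (l : ℝ) (f : ℝ → ℝ) : Prop :=
  ∃ g : ℝ → ℝ, MemLp g 2 (volume.restrict (Icc 0 l)) ∧ IsWeakDeriv l f g

/-- `f ∈ H¹(0, l)`. -/
def MemH1Interval (l : ℝ) (f : ℝ → ℝ) : Prop :=
  MemLp f 2 (volume.restrict (Icc 0 l)) ∧ HasL2WeakDeriv l f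

open Classical in
/-- The weak derivative in `L²(0, l)` (unique almost everywhere) of a function of `H¹(0, l)`. -/
def weakDeriv (l : ℝ) (f : ℝ → ℝ) : ℝ → ℝ :=
  if h : HasL2WeakDeriv l f then h.choose else 0

/-! ### The model profile and the cut-off functions -/

/-- The positive even solution `U ∈ H¹(ℝ)` of `-U'' + U = U ^ p`. -/
def soliton (p x : ℝ) : ℝ :=
  ((p + 1) / 2) ^ (1 / (p - 1)) * Real.cosh ((p - 1) / 2 * x) ^ (-(2 / (p - 1)))

/-- The rescaled profile `λ ^ (1 / (p - 1)) U(√λ x)`, which solves `-w'' + λ w = w ^ p`. -/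
def scaledSoliton (p lam x : ℝ) : ℝ :=
  lam ^ (1 / (p - 1)) * soliton p (Real.sqrt lam * x)

/-- A smooth cut-off function of the variable `x ≥ 0`, supported in `[0, δ]` and equal to `1` on
`[0, δ / 2]`. -/
def IsCutoff (δ : ℝ) (χ : ℝ → ℝ) : Prop :=
  ContDiff ℝ ∞ χ ∧ (∀ x, 0 ≤ x → x ≤ δ / 2 → χ x = 1) ∧ ∀ x, δ ≤ x → χ x = 0

namespace MetricGraph

variable {V E : Type*}

/-- The degree of a vertex: the number of edge ends at `v` (a loop counts twice). -/
def degree (G : MetricGraph V E) (v : V) : ℕ :=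
  Nat.card {e : E // G.src e = v} + Nat.card {e : E // G.tgt e = v}

/-- The graph is connected. -/
def Connected (G : MetricGraph V E) : Prop :=
  (SimpleGraph.fromRel fun v w : V => ∃ e, G.src e = v ∧ G.tgt e = w).Connected

/-! A function on the graph is a family `u = (u_e)` with `u e : ℝ → ℝ`, of which only the values
on `[0, len e]` matter. -/

/-- `u ∈ C⁰(G)`: continuous on every edge, with a well defined value at every vertex. -/
def IsContinuous (G : MetricGraph V E) (u : E → ℝ → ℝ) : Prop :=
  (∀ e, ContinuousOn (u e) (Icc 0 (G.len e))) ∧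
    ∃ c : V → ℝ, ∀ e, u e 0 = c (G.src e) ∧ u e (G.len e) = c (G.tgt e)

/-- `u ∈ H¹(G)`. -/
def MemH1 (G : MetricGraph V E) (u : E → ℝ → ℝ) : Prop :=
  G.IsContinuous u ∧ ∀ e, MemH1Interval (G.len e) (u e)

/-- The norm of `L²(G)`. -/
def l2Norm [Fintype E] (G : MetricGraph V E) (u : E → ℝ → ℝ) : ℝ :=
  Real.sqrt (∑ e, ∫ x in (0 : ℝ)..G.len e, u e x ^ 2)

/-- The scalar product `⟨u, v⟩_λ = ∫ u' v' + λ ∫ u v` of `H¹(G)`. -/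
def innerLam [Fintype E] (G : MetricGraph V E) (lam : ℝ) (u v : E → ℝ → ℝ) : ℝ :=
  (∑ e, ∫ x in (0 : ℝ)..G.len e, weakDeriv (G.len e) (u e) x * weakDeriv (G.len e) (v e) x) +
    lam * ∑ e, ∫ x in (0 : ℝ)..G.len e, u e x * v e x

/-- The norm `‖u‖_λ` of `H¹(G)`. -/
def normLam [Fintype E] (G : MetricGraph V E) (lam : ℝ) (u : E → ℝ → ℝ) : ℝ :=
  Real.sqrt (G.innerLam lam u u)

/-- The Kirchhoff condition at `v`: the derivatives in the directions leaving `v` add up to `0`. -/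
def Kirchhoff [Fintype E] [DecidableEq V] (G : MetricGraph V E) (u : E → ℝ → ℝ) (v : V) : Prop :=
  ∑ e, ((if G.src e = v then derivWithin (u e) (Icc 0 (G.len e)) 0 else 0) +
    (if G.tgt e = v then -derivWithin (u e) (Icc 0 (G.len e)) (G.len e) else 0)) = 0

/-- `u` is a positive (classical, `C²` up to the ends of every edge) solution in `H¹(G)` of
`-u'' + λ u = |u| ^ (p - 1) u` with Kirchhoff conditions and with `|u|_{L²(G)} = ρ`. -/
structure IsPositiveSolution [Fintype E] [DecidableEq V] (G : MetricGraph V E) (p lam ρ : ℝ)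
    (u : E → ℝ → ℝ) : Prop where
  memH1 : G.MemH1 u
  contDiffOn : ∀ e, ContDiffOn ℝ 2 (u e) (Icc 0 (G.len e))
  equation : ∀ e, ∀ x ∈ Ioo 0 (G.len e),
    -deriv (deriv (u e)) x + lam * u e x = |u e x| ^ (p - 1) * u e x
  kirchhoff : ∀ v, G.Kirchhoff u v
  mass : G.l2Norm u = ρ
  pos : ∀ e, ∀ x ∈ Icc 0 (G.len e), 0 < u e x

/-- For a vertex `v` of degree one, the function `χ U_λ` on the graph: it is
`χ(t) λ ^ (1 / (p - 1)) U(√λ t)` on the terminal edge ending at `v`, where `t` is the distance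
from `v` along this edge, and `0` on every other edge. -/
def peak [DecidableEq V] (G : MetricGraph V E) (p lam : ℝ) (χ : ℝ → ℝ) (v : V) : E → ℝ → ℝ :=
  fun e x =>
    (if G.src e = v then χ x * scaledSoliton p lam x else 0) +
    (if G.tgt e = v then χ (G.len e - x) * scaledSoliton p lam (G.len e - x) else 0)

end MetricGraph

end

/-!
Cut every edge at its midpoint and describe a function on the graph by its values on half-edges,
each starting at a vertex. On a half-edge, after the scaling `w (x) = Λ W (μ x)` with `μ = √λ`, one
looks for `W` near a decaying profile: the soliton at a vertex of degree one carrying a peak, zero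
elsewhere. The linearization at either profile has a decaying and a growing solution; they give a
Green function that is bounded uniformly in the length of the half-edge. Imposing continuity and the
Kirchhoff condition at the vertices and matching at the midpoints turns the problem into a fixed
point equation. The profiles miss the matching conditions only by `O (exp (-d μ))`, so the
contraction principle yields a solution within `O (exp (-d μ))` of the profiles. This error beats
every power of `λ`, and a mass `∫ U²` is left at each peak. Since a negative minimum of
`u` would have to lie below `-λ ^ (1 / (p - 1))`, closeness to the nonnegative profiles makes the
solution positive.
-/

noncomputable section

/-! ### Two tools for the contraction argument -/

lemma exists_isFixedPt_of_lipschitzOnWith_closedBall {X : Type*} [MetricSpace X] [CompleteSpace X]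
    {f : X → X} {x : X} {r : ℝ} {K : NNReal} (hr : 0 ≤ r) (hK : K < 1)
    (hf : LipschitzOnWith K f (Metric.closedBall x r)) (hx : dist x (f x) ≤ (1 - K) * r) :
    ∃ y ∈ Metric.closedBall x r, f y = y ∧ (1 - K) * dist x y ≤ dist x (f x) := by
  have hx_mem : x ∈ Metric.closedBall x r := Metric.mem_closedBall_self hr
  have hmaps : MapsTo f (Metric.closedBall x r) (Metric.closedBall x r) := fun y hy => by
    have hlip := hf.dist_le_mul y hy x hx_mem
    rw [Metric.mem_closedBall] at hy ⊢
    have hKy : (K : ℝ) * dist y x ≤ K * r := by gcongr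
    linarith [dist_triangle (f y) (f x) x, dist_comm x (f x)]
  obtain ⟨y, hy, hfix, -, -⟩ := ContractingWith.exists_fixedPoint' (K := K)
    Metric.isClosed_closedBall.isComplete hmaps
    ⟨hK, fun y z => hf y.2 z.2⟩ hx_mem (edist_ne_top _ _)
  refine ⟨y, hy, hfix, ?_⟩
  have hlip := hf.dist_le_mul x hx_mem y hy
  rw [hfix] at hlip
  linarith [dist_triangle x (f x) y]

/-- The remainder of the first order Taylor expansion of `N` at `c`, as a function of the
increment. -/
def taylorRem (N : ℝ → ℝ) (c y : ℝ) : ℝ := N (c + y) - N c - deriv N c * y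

@[simp] lemma taylorRem_zero (N : ℝ → ℝ) (c : ℝ) : taylorRem N c 0 = 0 := by simp [taylorRem]

lemma hasDerivAt_taylorRem {N : ℝ → ℝ} (hN : Differentiable ℝ N) (c y : ℝ) :
    HasDerivAt (taylorRem N c) (deriv N (c + y) - deriv N c) y := by
  have hshift := ((hN (c + y)).hasDerivAt.comp_const_add c y).sub_const (N c)
  exact (hshift.sub ((hasDerivAt_id y).const_mul (deriv N c))).congr_deriv (by simp)

lemma exists_taylorRem_lipschitz {N : ℝ → ℝ} (hN : ContDiff ℝ 1 N) (R : ℝ) {η : ℝ} (hη : 0 < η) :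
    ∃ r > 0, ∀ c y z : ℝ, |c| ≤ R → |y| ≤ r → |z| ≤ r →
      |taylorRem N c y - taylorRem N c z| ≤ η * |y - z| := by
  have hunif := (isCompact_Icc (a := -(R + 1)) (b := R + 1)).uniformContinuousOn_of_continuous
    (hN.continuous_deriv le_rfl).continuousOn
  obtain ⟨d, hd, hclose⟩ := Metric.uniformContinuousOn_iff.1 hunif η hη
  refine ⟨min (d / 2) 1, by positivity, fun c y z hc hy hz => ?_⟩
  set r := min (d / 2) 1
  have hrd : r ≤ d / 2 := min_le_left _ _
  have hr1 : r ≤ 1 := min_le_right _ _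
  have hbound : ∀ x ∈ Icc (-r) r, ‖deriv N (c + x) - deriv N c‖ ≤ η := fun x hx => by
    have hx' : |x| ≤ r := abs_le.2 hx
    have hcx : c + x ∈ Icc (-(R + 1)) (R + 1) := abs_le.1 ((abs_add_le c x).trans (by linarith))
    have hdist : dist (c + x) c < d := by rw [dist_self_add_left, Real.norm_eq_abs]; linarith
    exact (hclose _ hcx c (abs_le.1 (hc.trans (by linarith))) hdist).le
  simpa only [Real.norm_eq_abs] using
    (convex_Icc (-r) r).norm_image_sub_le_of_norm_hasDerivWithin_le
      (fun x _ => (hasDerivAt_taylorRem (hN.differentiable one_ne_zero) c x).hasDerivWithinAt)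
      hbound (abs_le.1 hz) (abs_le.1 hy)

/-! ### Fundamental systems and variation of parameters -/

/-- A fundamental system `f`, `g`, with derivatives `df`, `dg`, of the equation `φ'' = q φ`,
normalised by its Wronskian. -/
structure FundamentalSystem (q : ℝ → ℝ) where
  f : ℝ → ℝ
  df : ℝ → ℝ
  g : ℝ → ℝ
  dg : ℝ → ℝ
  hasDerivAt_f : ∀ x, HasDerivAt f (df x) x
  hasDerivAt_df : ∀ x, HasDerivAt df (q x * f x) x
  hasDerivAt_g : ∀ x, HasDerivAt g (dg x) x
  hasDerivAt_dg : ∀ x, HasDerivAt dg (q x * g x) x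
  wronskian : ∀ x, f x * dg x - df x * g x = 1

namespace FundamentalSystem

/-- The exponential dichotomy of a fundamental system on the half-line: `f` decays at most like
`exp (-x)` and `g` grows exactly like `exp x`, together with their derivatives. One constant serves
for all the bounds, and also for the abscissa from which the lower bounds hold. -/
structure IsDichotomy {q : ℝ → ℝ} (F : FundamentalSystem q) (C : ℝ) : Prop where
  one_le : 1 ≤ C
  f_le : ∀ x, 0 ≤ x → |F.f x| ≤ C * Real.exp (-x)
  df_le : ∀ x, 0 ≤ x → |F.df x| ≤ C * Real.exp (-x)
  g_le : ∀ x, 0 ≤ x → |F.g x| ≤ C * Real.exp x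
  dg_le : ∀ x, 0 ≤ x → |F.dg x| ≤ C * Real.exp x
  le_g : ∀ x, C ≤ x → Real.exp x ≤ C * F.g x
  le_dg : ∀ x, C ≤ x → Real.exp x ≤ C * F.dg x

variable {q : ℝ → ℝ} (F : FundamentalSystem q)

lemma continuous_f : Continuous F.f :=
  continuous_iff_continuousAt.2 fun x => (F.hasDerivAt_f x).continuousAt

lemma continuous_g : Continuous F.g :=
  continuous_iff_continuousAt.2 fun x => (F.hasDerivAt_g x).continuousAt

/-- Variation of parameters: the solution of `φ'' = q φ - h` which at the origin equals
`a f + b g` to first order. -/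
def response (a b : ℝ) (h : ℝ → ℝ) (x : ℝ) : ℝ :=
  F.f x * (a + ∫ y in (0 : ℝ)..x, F.g y * h y) + F.g x * (b - ∫ y in (0 : ℝ)..x, F.f y * h y)

/-- The derivative of `FundamentalSystem.response`. -/
def dresponse (a b : ℝ) (h : ℝ → ℝ) (x : ℝ) : ℝ :=
  F.df x * (a + ∫ y in (0 : ℝ)..x, F.g y * h y) + F.dg x * (b - ∫ y in (0 : ℝ)..x, F.f y * h y)

lemma response_zero_right (a b : ℝ) (h : ℝ → ℝ) : F.response a b h 0 = F.f 0 * a + F.g 0 * b := by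
  simp [response]

lemma dresponse_zero_right (a b : ℝ) (h : ℝ → ℝ) :
    F.dresponse a b h 0 = F.df 0 * a + F.dg 0 * b := by
  simp [dresponse]

section Continuous

variable {h h' : ℝ → ℝ} (hh : Continuous h) (hh' : Continuous h')
include hh

lemma hasDerivAt_response (a b x : ℝ) :
    HasDerivAt (F.response a b h) (F.dresponse a b h x) x := by
  have hgh := ((F.continuous_g.mul hh).integral_hasStrictDerivAt 0 x).hasDerivAt
  have hfh := ((F.continuous_f.mul hh).integral_hasStrictDerivAt 0 x).hasDerivAt
  refine (((F.hasDerivAt_f x).mul (hgh.const_add a)).add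
    ((F.hasDerivAt_g x).mul (hfh.const_sub b))).congr_deriv ?_
  simp only [dresponse, Pi.mul_apply]
  ring

lemma hasDerivAt_dresponse (a b x : ℝ) :
    HasDerivAt (F.dresponse a b h) (q x * F.response a b h x - h x) x := by
  have hgh := ((F.continuous_g.mul hh).integral_hasStrictDerivAt 0 x).hasDerivAt
  have hfh := ((F.continuous_f.mul hh).integral_hasStrictDerivAt 0 x).hasDerivAt
  refine (((F.hasDerivAt_df x).mul (hgh.const_add a)).add
    ((F.hasDerivAt_dg x).mul (hfh.const_sub b))).congr_deriv ?_
  simp only [response, Pi.mul_apply]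
  linear_combination (-h x) * F.wronskian x

lemma continuous_response (a b : ℝ) : Continuous (F.response a b h) :=
  continuous_iff_continuousAt.2 fun x => (F.hasDerivAt_response hh a b x).continuousAt

include hh'

lemma integral_f_mul_sub (x : ℝ) : ∫ y in (0 : ℝ)..x, F.f y * (h - h') y =
    (∫ y in (0 : ℝ)..x, F.f y * h y) - ∫ y in (0 : ℝ)..x, F.f y * h' y := by
  simp only [Pi.sub_apply, mul_sub]
  exact intervalIntegral.integral_sub ((F.continuous_f.mul hh).intervalIntegrable 0 x)
    ((F.continuous_f.mul hh').intervalIntegrable 0 x)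

lemma integral_g_mul_sub (x : ℝ) : ∫ y in (0 : ℝ)..x, F.g y * (h - h') y =
    (∫ y in (0 : ℝ)..x, F.g y * h y) - ∫ y in (0 : ℝ)..x, F.g y * h' y := by
  simp only [Pi.sub_apply, mul_sub]
  exact intervalIntegral.integral_sub ((F.continuous_g.mul hh).intervalIntegrable 0 x)
    ((F.continuous_g.mul hh').intervalIntegrable 0 x)

lemma response_sub (a a' b b' x : ℝ) :
    F.response (a - a') (b - b') (h - h') x = F.response a b h x - F.response a' b' h' x := by
  simp only [response, F.integral_f_mul_sub hh hh', F.integral_g_mul_sub hh hh']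
  ring

end Continuous

/-- The coefficient at the origin of the growing solution, when it is to be `B exp (-M)` at `M`. -/
def growthCoeff (M B : ℝ) (h : ℝ → ℝ) : ℝ := B * Real.exp (-M) + ∫ y in (0 : ℝ)..M, F.f y * h y

/-- The coefficient at `M` of the decaying solution, when it is `a` at the origin. -/
def decayCoeff (M a : ℝ) (h : ℝ → ℝ) : ℝ := a + ∫ y in (0 : ℝ)..M, F.g y * h y

lemma response_growthCoeff (M a B : ℝ) (h : ℝ → ℝ) :
    F.response a (F.growthCoeff M B h) h M =
      F.f M * F.decayCoeff M a h + B * (Real.exp (-M) * F.g M) := by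
  simp only [response, growthCoeff, decayCoeff]
  ring

lemma dresponse_growthCoeff (M a B : ℝ) (h : ℝ → ℝ) :
    F.dresponse a (F.growthCoeff M B h) h M =
      F.df M * F.decayCoeff M a h + B * (Real.exp (-M) * F.dg M) := by
  simp only [dresponse, growthCoeff, decayCoeff]
  ring

lemma growthCoeff_sub {h h' : ℝ → ℝ} (hh : Continuous h) (hh' : Continuous h') (M B B' : ℝ) :
    F.growthCoeff M (B - B') (h - h') = F.growthCoeff M B h - F.growthCoeff M B' h' := by
  rw [growthCoeff, F.integral_f_mul_sub hh hh', growthCoeff, growthCoeff]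
  ring

lemma decayCoeff_sub {h h' : ℝ → ℝ} (hh : Continuous h) (hh' : Continuous h') (M a a' : ℝ) :
    F.decayCoeff M (a - a') (h - h') = F.decayCoeff M a h - F.decayCoeff M a' h' := by
  rw [decayCoeff, F.integral_g_mul_sub hh hh', decayCoeff, decayCoeff]
  ring

variable {F} {C : ℝ}

namespace IsDichotomy

lemma mono {D : ℝ} (hF : F.IsDichotomy C) (hCD : C ≤ D) : F.IsDichotomy D where
  one_le := hF.one_le.trans hCD
  f_le x hx := (hF.f_le x hx).trans (by gcongr)
  df_le x hx := (hF.df_le x hx).trans (by gcongr)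
  g_le x hx := (hF.g_le x hx).trans (by gcongr)
  dg_le x hx := (hF.dg_le x hx).trans (by gcongr)
  le_g x hx := by
    have hle := hF.le_g x (hCD.trans hx)
    have : 0 < F.g x := pos_of_mul_pos_right ((Real.exp_pos x).trans_le hle)
      (zero_le_one.trans hF.one_le)
    exact hle.trans (by gcongr)
  le_dg x hx := by
    have hle := hF.le_dg x (hCD.trans hx)
    have : 0 < F.dg x := pos_of_mul_pos_right ((Real.exp_pos x).trans_le hle)
      (zero_le_one.trans hF.one_le)
    exact hle.trans (by gcongr)

variable (hF : F.IsDichotomy C)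
include hF

lemma pos : 0 < C := one_pos.trans_le hF.one_le

variable {h : ℝ → ℝ} {x M ν : ℝ} (hx : 0 ≤ x) (hM : x ≤ M) (hν : ∀ y ∈ Icc 0 M, |h y| ≤ ν)

include hx in
lemma abs_integral_g_mul_le (hν : ∀ y ∈ Icc 0 x, |h y| ≤ ν) :
    |∫ y in (0 : ℝ)..x, F.g y * h y| ≤ C * Real.exp x * ν := by
  have hν0 : 0 ≤ ν := (abs_nonneg _).trans (hν 0 ⟨le_rfl, hx⟩)
  have hC := hF.pos
  have hle : ‖∫ y in (0 : ℝ)..x, F.g y * h y‖ ≤ ∫ y in (0 : ℝ)..x, C * ν * Real.exp y := by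
    refine intervalIntegral.norm_integral_le_of_norm_le hx (ae_of_all _ fun y hy => ?_)
      (Continuous.intervalIntegrable (by fun_prop) _ _)
    calc ‖F.g y * h y‖ = |F.g y| * |h y| := norm_mul _ _
      _ ≤ C * Real.exp y * ν := by gcongr; exacts [hF.g_le y hy.1.le, hν y ⟨hy.1.le, hy.2⟩]
      _ = C * ν * Real.exp y := by ring
  rw [intervalIntegral.integral_const_mul, integral_exp, Real.exp_zero] at hle
  have : 0 ≤ C * ν := by positivity
  exact hle.trans (by linarith)

include hx hM hν

lemma abs_integral_f_mul_le : |∫ y in x..M, F.f y * h y| ≤ C * Real.exp (-x) * ν := by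
  have hν0 : 0 ≤ ν := (abs_nonneg _).trans (hν x ⟨hx, hM⟩)
  have hC := hF.pos
  have hle : ‖∫ y in x..M, F.f y * h y‖ ≤ ∫ y in x..M, C * ν * Real.exp (-y) := by
    refine intervalIntegral.norm_integral_le_of_norm_le hM (ae_of_all _ fun y hy => ?_)
      (Continuous.intervalIntegrable (by fun_prop) _ _)
    have hy0 : 0 ≤ y := hx.trans hy.1.le
    calc ‖F.f y * h y‖ = |F.f y| * |h y| := norm_mul _ _
      _ ≤ C * Real.exp (-y) * ν := by gcongr; exacts [hF.f_le y hy0, hν y ⟨hy0, hy.2⟩]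
      _ = C * ν * Real.exp (-y) := by ring
  have hexp : ∫ y in x..M, Real.exp (-y) = Real.exp (-x) - Real.exp (-M) := by simp
  rw [intervalIntegral.integral_const_mul, hexp] at hle
  have : 0 ≤ C * ν * Real.exp (-M) := by positivity
  exact hle.trans (by linarith)

lemma abs_growth_tail_le (hh : Continuous h) {B β : ℝ} (hB : |B| ≤ β) :
    |F.growthCoeff M B h - ∫ y in (0 : ℝ)..x, F.f y * h y| ≤
      β * Real.exp (-M) + C * Real.exp (-x) * ν := by
  have hsplit := intervalIntegral.integral_interval_sub_left (μ := volume)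
    ((F.continuous_f.mul hh).intervalIntegrable 0 M)
    ((F.continuous_f.mul hh).intervalIntegrable 0 x)
  simp only [Pi.mul_apply] at hsplit
  rw [growthCoeff, add_sub_assoc, hsplit]
  refine (abs_add_le _ _).trans (add_le_add ?_ (hF.abs_integral_f_mul_le hx hM hν))
  rw [abs_mul, Real.abs_exp]
  gcongr

/-- With `(y, z) = (f x, g x)` and `(y, z) = (df x, dg x)` this bounds the solution and its
derivative on `[0, M]`, uniformly in `M`. -/
lemma abs_variation_le (hh : Continuous h) {a α B β y z : ℝ} (ha : |a| ≤ α) (hB : |B| ≤ β)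
    (hy : |y| ≤ C * Real.exp (-x)) (hz : |z| ≤ C * Real.exp x) :
    |y * (a + ∫ t in (0 : ℝ)..x, F.g t * h t) +
        z * (F.growthCoeff M B h - ∫ t in (0 : ℝ)..x, F.f t * h t)| ≤
      C * (α + β) + 2 * C ^ 2 * ν := by
  have hC := hF.pos
  have hα : 0 ≤ α := (abs_nonneg a).trans ha
  have hβ : 0 ≤ β := (abs_nonneg B).trans hB
  have hdecay : |a + ∫ t in (0 : ℝ)..x, F.g t * h t| ≤ α + C * Real.exp x * ν :=
    (abs_add_le _ _).trans (add_le_add ha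
      (hF.abs_integral_g_mul_le hx fun t ht => hν t ⟨ht.1, ht.2.trans hM⟩))
  have hgrowth := hF.abs_growth_tail_le hx hM hν hh hB
  have hcancel : Real.exp (-x) * Real.exp x = 1 := by rw [← Real.exp_add]; simp
  have hle_one : Real.exp (-x) ≤ 1 := Real.exp_le_one_iff.2 (by linarith)
  have hle_one' : Real.exp (-M) * Real.exp x ≤ 1 := by
    rw [← Real.exp_add]; exact Real.exp_le_one_iff.2 (by linarith)
  refine (abs_add_le _ _).trans ?_
  rw [abs_mul, abs_mul]
  calc |y| * |a + ∫ t in (0 : ℝ)..x, F.g t * h t| +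
        |z| * |F.growthCoeff M B h - ∫ t in (0 : ℝ)..x, F.f t * h t|
      ≤ C * Real.exp (-x) * (α + C * Real.exp x * ν) +
          C * Real.exp x * (β * Real.exp (-M) + C * Real.exp (-x) * ν) := by gcongr
    _ = C * (α * Real.exp (-x) + β * (Real.exp (-M) * Real.exp x)) + 2 * C ^ 2 * ν := by
        linear_combination 2 * C ^ 2 * ν * hcancel
    _ ≤ C * (α * 1 + β * 1) + 2 * C ^ 2 * ν := by gcongr
    _ = C * (α + β) + 2 * C ^ 2 * ν := by ring

omit hx hM in
lemma abs_growthCoeff_le (hM : 0 ≤ M) {B β : ℝ} (hB : |B| ≤ β) :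
    |F.growthCoeff M B h| ≤ β * Real.exp (-M) + C * ν := by
  refine (abs_add_le _ _).trans (add_le_add ?_ ?_)
  · rw [abs_mul, Real.abs_exp]
    gcongr
  · simpa using hF.abs_integral_f_mul_le le_rfl hM hν

omit hx hM in
lemma abs_mul_decayCoeff_le (hM : 0 ≤ M) {a α y : ℝ} (ha : |a| ≤ α)
    (hy : |y| ≤ C * Real.exp (-M)) :
    |y * F.decayCoeff M a h| ≤ C * Real.exp (-M) * α + C ^ 2 * ν := by
  have hC := hF.pos
  have hcoeff : |F.decayCoeff M a h| ≤ α + C * Real.exp M * ν :=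
    (abs_add_le _ _).trans (add_le_add ha (hF.abs_integral_g_mul_le hM hν))
  have hcancel : Real.exp (-M) * Real.exp M = 1 := by rw [← Real.exp_add]; simp
  rw [abs_mul]
  calc |y| * |F.decayCoeff M a h|
      ≤ C * Real.exp (-M) * (α + C * Real.exp M * ν) := by gcongr
    _ = C * Real.exp (-M) * α + C ^ 2 * ν := by linear_combination C ^ 2 * ν * hcancel

omit hx hM hν in
lemma exp_neg_mul_g_mem (hM : C ≤ M) : Real.exp (-M) * F.g M ∈ Icc C⁻¹ C := by
  have hC := hF.pos
  have hcancel : Real.exp (-M) * Real.exp M = 1 := by rw [← Real.exp_add]; simp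
  constructor
  · rw [inv_le_iff_one_le_mul₀ hC, ← hcancel, mul_assoc, mul_comm (F.g M)]
    gcongr
    exact hF.le_g M hM
  · calc Real.exp (-M) * F.g M ≤ Real.exp (-M) * (C * Real.exp M) := by
          gcongr; exact (le_abs_self _).trans (hF.g_le M (hC.le.trans hM))
      _ = C := by linear_combination C * hcancel

omit hx hM hν in
lemma exp_neg_mul_dg_mem (hM : C ≤ M) : Real.exp (-M) * F.dg M ∈ Icc C⁻¹ C := by
  have hC := hF.pos
  have hcancel : Real.exp (-M) * Real.exp M = 1 := by rw [← Real.exp_add]; simp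
  constructor
  · rw [inv_le_iff_one_le_mul₀ hC, ← hcancel, mul_assoc, mul_comm (F.dg M)]
    gcongr
    exact hF.le_dg M hM
  · calc Real.exp (-M) * F.dg M ≤ Real.exp (-M) * (C * Real.exp M) := by
          gcongr; exact (le_abs_self _).trans (hF.dg_le M (hC.le.trans hM))
      _ = C := by linear_combination C * hcancel

end IsDichotomy

end FundamentalSystem

/-! ### The linear problem on the half-edges of a graph -/

/-- The half-edges of a graph: `vert` sends a half-edge to its vertex and `bar` sends it to the
other half of its edge. A half-edge which carries a peak is alone at its vertex. -/
structure HalfEdges (H V : Type*) where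
  vert : H → V
  bar : H → H
  bar_bar : ∀ s, bar (bar s) = s
  peaks : Set H
  eq_of_mem_peaks : ∀ ⦃s s'⦄, s ∈ peaks → vert s' = vert s → s' = s

namespace HalfEdges

variable {H V : Type*} (S : HalfEdges H V)

section Matching

/-- The solution `B` of the matching problem at the midpoints: the values `y + B G` agree and the
derivatives `z + B dG` are opposite on the two halves of every edge. -/
def matchCoeff (G dG y z : H → ℝ) (s : H) : ℝ :=
  ((y (S.bar s) - y s) * dG (S.bar s) - (z s + z (S.bar s)) * G (S.bar s)) /
    (G s * dG (S.bar s) + G (S.bar s) * dG s)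

variable {G dG : H → ℝ}

lemma matchCoeff_sub (y y' z z' : H → ℝ) (s : H) :
    S.matchCoeff G dG (y - y') (z - z') s =
      S.matchCoeff G dG y z s - S.matchCoeff G dG y' z' s := by
  simp only [matchCoeff, Pi.sub_apply]
  ring

lemma value_matchCoeff (hG : ∀ s, 0 < G s) (hdG : ∀ s, 0 < dG s) (y z : H → ℝ) (s : H) :
    y s + S.matchCoeff G dG y z s * G s =
      y (S.bar s) + S.matchCoeff G dG y z (S.bar s) * G (S.bar s) := by
  have hdet : G s * dG (S.bar s) + G (S.bar s) * dG s ≠ 0 :=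
    (add_pos (mul_pos (hG _) (hdG _)) (mul_pos (hG _) (hdG _))).ne'
  rw [matchCoeff, matchCoeff, S.bar_bar, add_comm (G (S.bar s) * dG s)]
  generalize hD : G s * dG (S.bar s) + G (S.bar s) * dG s = D at hdet ⊢
  field_simp
  rw [← hD]
  ring

lemma deriv_matchCoeff (hG : ∀ s, 0 < G s) (hdG : ∀ s, 0 < dG s) (y z : H → ℝ) (s : H) :
    z s + S.matchCoeff G dG y z s * dG s =
      -(z (S.bar s) + S.matchCoeff G dG y z (S.bar s) * dG (S.bar s)) := by
  have hdet : G s * dG (S.bar s) + G (S.bar s) * dG s ≠ 0 :=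
    (add_pos (mul_pos (hG _) (hdG _)) (mul_pos (hG _) (hdG _))).ne'
  rw [matchCoeff, matchCoeff, S.bar_bar, add_comm (G (S.bar s) * dG s)]
  generalize hD : G s * dG (S.bar s) + G (S.bar s) * dG s = D at hdet ⊢
  field_simp
  rw [← hD]
  ring

lemma abs_matchCoeff_le {C Y : ℝ} (hC : 0 < C) (hG : ∀ s, G s ∈ Icc C⁻¹ C)
    (hdG : ∀ s, dG s ∈ Icc C⁻¹ C) {y z : H → ℝ} (hy : ∀ s, |y s| ≤ Y) (hz : ∀ s, |z s| ≤ Y)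
    (s : H) : |S.matchCoeff G dG y z s| ≤ 2 * C ^ 3 * Y := by
  have hY : 0 ≤ Y := (abs_nonneg _).trans (hy s)
  have hCi : 0 < C⁻¹ := inv_pos.2 hC
  have abs_le : ∀ {x}, x ∈ Icc C⁻¹ C → |x| ≤ C := fun hx =>
    (abs_of_pos (hCi.trans_le hx.1)).trans_le hx.2
  have hdet : 2 * (C⁻¹ * C⁻¹) ≤ G s * dG (S.bar s) + G (S.bar s) * dG s := by
    rw [two_mul]
    gcongr
    exacts [hCi.le.trans (hG s).1, (hG s).1, (hdG _).1, hCi.le.trans (hG _).1, (hG _).1, (hdG s).1]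
  have hdet_pos : 0 < G s * dG (S.bar s) + G (S.bar s) * dG s := lt_of_lt_of_le (by positivity) hdet
  have hnum : |(y (S.bar s) - y s) * dG (S.bar s) - (z s + z (S.bar s)) * G (S.bar s)| ≤
      (Y + Y) * C + (Y + Y) * C := by
    refine (abs_sub _ _).trans ?_
    rw [abs_mul, abs_mul]
    gcongr
    exacts [(abs_sub _ _).trans (add_le_add (hy _) (hy _)), abs_le (hdG _),
      (abs_add_le _ _).trans (add_le_add (hz _) (hz _)), abs_le (hG _)]
  rw [matchCoeff, abs_div, abs_of_pos hdet_pos, div_le_iff₀ hdet_pos]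
  calc _ ≤ (Y + Y) * C + (Y + Y) * C := hnum
    _ = 2 * C ^ 3 * Y * (2 * (C⁻¹ * C⁻¹)) := by field_simp; ring
    _ ≤ _ := by gcongr

end Matching

/-- Fundamental systems on the half-edges with the initial values which make the vertex conditions
explicit: `g` satisfies the Neumann condition at the peaks, and at any other vertex the system is
`f = exp (-x)`, `g = exp x / 2` to first order. -/
structure IsAdapted {q : H → ℝ → ℝ} (F : ∀ s, FundamentalSystem (q s)) : Prop where
  dg_of_mem : ∀ s ∈ S.peaks, (F s).dg 0 = 0
  f_of_notMem : ∀ s ∉ S.peaks, (F s).f 0 = 1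
  df_of_notMem : ∀ s ∉ S.peaks, (F s).df 0 = -1
  g_of_notMem : ∀ s ∉ S.peaks, (F s).g 0 = 1 / 2
  dg_of_notMem : ∀ s ∉ S.peaks, (F s).dg 0 = 1 / 2

variable [Fintype H] [DecidableEq V]

/-- The mean value at a vertex of a function of the half-edges. -/
def vertexMean (c : H → ℝ) (v : V) : ℝ :=
  (∑ s with S.vert s = v, c s) / (Finset.univ.filter fun s => S.vert s = v).card

open Classical in
/-- The coefficients of the decaying solutions for which the vertex conditions hold, in terms of
the coefficients `c` of the growing solutions. -/
def vertexCoeff (c : H → ℝ) (s : H) : ℝ :=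
  if s ∈ S.peaks then 0 else S.vertexMean c (S.vert s) - c s / 2

lemma vertexCoeff_of_mem {s : H} (hs : s ∈ S.peaks) (c : H → ℝ) : S.vertexCoeff c s = 0 :=
  if_pos hs

lemma vertexCoeff_of_notMem {s : H} (hs : s ∉ S.peaks) (c : H → ℝ) :
    S.vertexCoeff c s = S.vertexMean c (S.vert s) - c s / 2 :=
  if_neg hs

lemma sum_sub_vertexMean (c : H → ℝ) (v : V) :
    ∑ s with S.vert s = v, (c s - S.vertexMean c v) = 0 := by
  rw [Finset.sum_sub_distrib, Finset.sum_const, nsmul_eq_mul, vertexMean]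
  rcases (Finset.univ.filter fun s => S.vert s = v).eq_empty_or_nonempty with hv | hv
  · simp [hv]
  · have : ((Finset.univ.filter fun s => S.vert s = v).card : ℝ) ≠ 0 := by
      exact_mod_cast hv.card_pos.ne'
    field_simp
    ring

lemma vertexCoeff_sub (c c' : H → ℝ) (s : H) :
    S.vertexCoeff (c - c') s = S.vertexCoeff c s - S.vertexCoeff c' s := by
  by_cases hs : s ∈ S.peaks
  · simp [S.vertexCoeff_of_mem hs]
  · simp only [S.vertexCoeff_of_notMem hs, vertexMean, Pi.sub_apply, Finset.sum_sub_distrib]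
    ring

lemma abs_vertexCoeff_le {c : H → ℝ} {κ : ℝ} (hc : ∀ s, |c s| ≤ κ) (s : H) :
    |S.vertexCoeff c s| ≤ 3 / 2 * κ := by
  have hκ : 0 ≤ κ := (abs_nonneg _).trans (hc s)
  by_cases hs : s ∈ S.peaks
  · rw [S.vertexCoeff_of_mem hs, abs_zero]
    positivity
  · have hmean : |S.vertexMean c (S.vert s)| ≤ κ := by
      have hpos : 0 < (Finset.univ.filter fun s' => S.vert s' = S.vert s).card :=
        Finset.card_pos.2 ⟨s, by simp⟩
      rw [vertexMean, abs_div, Nat.abs_cast, div_le_iff₀ (by exact_mod_cast hpos), mul_comm,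
        ← nsmul_eq_mul]
      exact (Finset.abs_sum_le_sum_abs _ _).trans
        (Finset.sum_le_card_nsmul _ _ _ fun s' _ => hc s')
    rw [S.vertexCoeff_of_notMem hs]
    refine (abs_sub _ _).trans ?_
    rw [abs_div, abs_two]
    linarith [hc s]

section Correction

variable {q : H → ℝ → ℝ} (F : ∀ s, FundamentalSystem (q s)) (M : H → ℝ)

/-- The coefficients at the origin of the decaying solutions in `HalfEdges.correction`. -/
def originCoeff (B : H → ℝ) (h : H → ℝ → ℝ) : H → ℝ :=
  S.vertexCoeff fun s => (F s).growthCoeff (M s) (B s) (h s)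

/-- The solution of `φ'' = q φ - h` which satisfies the vertex conditions and whose growing part
is `B exp (-M)` at the midpoints. -/
def correction (B : H → ℝ) (h : H → ℝ → ℝ) (s : H) : ℝ → ℝ :=
  (F s).response (S.originCoeff F M B h s) ((F s).growthCoeff (M s) (B s) (h s)) (h s)

/-- The derivative of `HalfEdges.correction`. -/
def dcorrection (B : H → ℝ) (h : H → ℝ → ℝ) (s : H) : ℝ → ℝ :=
  (F s).dresponse (S.originCoeff F M B h s) ((F s).growthCoeff (M s) (B s) (h s)) (h s)

/-- The coefficients `B` for which the sum of the data `a`, `b` and of `HalfEdges.correction`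
matches at the midpoints, computed from the previous ones. -/
def nextB (a b B : H → ℝ) (h : H → ℝ → ℝ) : H → ℝ :=
  S.matchCoeff (fun s => Real.exp (-M s) * (F s).g (M s))
    (fun s => Real.exp (-M s) * (F s).dg (M s))
    (fun s => a s + (F s).f (M s) * (F s).decayCoeff (M s) (S.originCoeff F M B h s) (h s))
    (fun s => b s + (F s).df (M s) * (F s).decayCoeff (M s) (S.originCoeff F M B h s) (h s))

section Sub

variable {h h' : H → ℝ → ℝ} (hh : ∀ s, Continuous (h s)) (hh' : ∀ s, Continuous (h' s))
include hh hh'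

lemma originCoeff_sub (B B' : H → ℝ) (s : H) :
    S.originCoeff F M (B - B') (h - h') s =
      S.originCoeff F M B h s - S.originCoeff F M B' h' s := by
  rw [originCoeff, originCoeff, originCoeff, ← vertexCoeff_sub]
  exact congrArg (S.vertexCoeff · s)
    (funext fun s => (F s).growthCoeff_sub (hh s) (hh' s) (M s) (B s) (B' s))

lemma correction_sub (B B' : H → ℝ) (s : H) (x : ℝ) :
    S.correction F M (B - B') (h - h') s x =
      S.correction F M B h s x - S.correction F M B' h' s x := by
  simp only [correction, S.originCoeff_sub F M hh hh', Pi.sub_apply,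
    (F s).growthCoeff_sub (hh s) (hh' s), (F s).response_sub (hh s) (hh' s)]

lemma nextB_sub (a a' b b' B B' : H → ℝ) (s : H) :
    S.nextB F M (a - a') (b - b') (B - B') (h - h') s =
      S.nextB F M a b B h s - S.nextB F M a' b' B' h' s := by
  rw [nextB, nextB, nextB, ← matchCoeff_sub]
  congr 1 <;> funext s <;>
    simp only [S.originCoeff_sub F M hh hh', Pi.sub_apply,
      (F s).decayCoeff_sub (hh s) (hh' s)] <;> ring

end Sub

variable {S F M}

section VertexConditions

variable (hF : S.IsAdapted F)
include hF

lemma IsAdapted.correction_zero {s : H} (hs : s ∉ S.peaks) (B : H → ℝ) (h : H → ℝ → ℝ) :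
    S.correction F M B h s 0 =
      S.vertexMean (fun s => (F s).growthCoeff (M s) (B s) (h s)) (S.vert s) := by
  rw [correction, FundamentalSystem.response_zero_right, originCoeff, S.vertexCoeff_of_notMem hs,
    hF.f_of_notMem s hs, hF.g_of_notMem s hs]
  ring

lemma IsAdapted.sum_dcorrection_zero (B : H → ℝ) (h : H → ℝ → ℝ) (v : V) :
    ∑ s with S.vert s = v, S.dcorrection F M B h s 0 = 0 := by
  set c := fun s => (F s).growthCoeff (M s) (B s) (h s) with hc
  by_cases hv : ∃ s, S.vert s = v ∧ s ∈ S.peaks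
  · obtain ⟨s, rfl, hs⟩ := hv
    refine Finset.sum_eq_zero fun s' hs' => ?_
    rw [S.eq_of_mem_peaks hs (Finset.mem_filter.1 hs').2, dcorrection,
      FundamentalSystem.dresponse_zero_right, originCoeff, S.vertexCoeff_of_mem hs,
      hF.dg_of_mem s hs]
    ring
  · push Not at hv
    refine (Finset.sum_congr rfl fun s hs => ?_).trans (S.sum_sub_vertexMean c v)
    obtain rfl := (Finset.mem_filter.1 hs).2
    have hs' := hv s rfl
    rw [dcorrection, FundamentalSystem.dresponse_zero_right, originCoeff,
      S.vertexCoeff_of_notMem hs', hF.df_of_notMem s hs', hF.dg_of_notMem s hs', ← hc]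
    ring

end VertexConditions

variable {C m β ν : ℝ} {a b B : H → ℝ} {h : H → ℝ → ℝ} (hF : ∀ s, (F s).IsDichotomy C)
include hF

section Midpoint

variable (hM : ∀ s, C ≤ M s)
include hM

lemma correction_midpoint_eq (s : H) (hB : S.nextB F M a b B h = B) :
    a s + S.correction F M B h s (M s) =
      a (S.bar s) + S.correction F M B h (S.bar s) (M (S.bar s)) := by
  have hG := fun s => (inv_pos.2 (hF s).pos).trans_le ((hF s).exp_neg_mul_g_mem (hM s)).1
  have hdG := fun s => (inv_pos.2 (hF s).pos).trans_le ((hF s).exp_neg_mul_dg_mem (hM s)).1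
  have hmatch := S.value_matchCoeff hG hdG
    (fun s => a s + (F s).f (M s) * (F s).decayCoeff (M s) (S.originCoeff F M B h s) (h s))
    (fun s => b s + (F s).df (M s) * (F s).decayCoeff (M s) (S.originCoeff F M B h s) (h s)) s
  rw [← nextB, hB] at hmatch
  simpa only [correction, FundamentalSystem.response_growthCoeff, add_assoc] using hmatch

lemma dcorrection_midpoint_eq (s : H) (hB : S.nextB F M a b B h = B) :
    b s + S.dcorrection F M B h s (M s) =
      -(b (S.bar s) + S.dcorrection F M B h (S.bar s) (M (S.bar s))) := by
  have hG := fun s => (inv_pos.2 (hF s).pos).trans_le ((hF s).exp_neg_mul_g_mem (hM s)).1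
  have hdG := fun s => (inv_pos.2 (hF s).pos).trans_le ((hF s).exp_neg_mul_dg_mem (hM s)).1
  have hmatch := S.deriv_matchCoeff hG hdG
    (fun s => a s + (F s).f (M s) * (F s).decayCoeff (M s) (S.originCoeff F M B h s) (h s))
    (fun s => b s + (F s).df (M s) * (F s).decayCoeff (M s) (S.originCoeff F M B h s) (h s)) s
  rw [← nextB, hB] at hmatch
  simpa only [dcorrection, FundamentalSystem.dresponse_growthCoeff, add_assoc] using hmatch

end Midpoint

variable (hm : 0 ≤ m) (hM : ∀ s, m ≤ M s) (hB : ∀ s, |B s| ≤ β)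
  (hν : ∀ s, ∀ y ∈ Icc 0 (M s), |h s y| ≤ ν)
include hm hM hB hν

lemma abs_originCoeff_le (s : H) :
    |S.originCoeff F M B h s| ≤ 3 / 2 * (β * Real.exp (-m) + C * ν) := by
  refine S.abs_vertexCoeff_le (fun s => ?_) s
  have hβ : 0 ≤ β := (abs_nonneg _).trans (hB s)
  refine ((hF s).abs_growthCoeff_le (hν s) (hm.trans (hM s)) (hB s)).trans ?_
  gcongr
  exact hM s

lemma abs_originCoeff_add_le (s : H) :
    C * (|S.originCoeff F M B h s| + β) + 2 * C ^ 2 * ν ≤ 4 * C ^ 2 * (β + ν) := by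
  have hα := abs_originCoeff_le (S := S) hF hm hM hB hν s
  have hβ : 0 ≤ β := (abs_nonneg _).trans (hB s)
  have hν0 : 0 ≤ ν := (abs_nonneg _).trans (hν s 0 ⟨le_rfl, hm.trans (hM s)⟩)
  have hC := (hF s).one_le
  have hE : Real.exp (-m) ≤ 1 := Real.exp_le_one_iff.2 (by linarith)
  calc C * (|S.originCoeff F M B h s| + β) + 2 * C ^ 2 * ν
      ≤ C * (3 / 2 * (β * 1 + C * ν) + β) + 2 * C ^ 2 * ν := by
        gcongr
        exact hα.trans (by gcongr)
    _ = 5 / 2 * (C * 1) * β + 7 / 2 * C ^ 2 * ν := by ring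
    _ ≤ 4 * (C * C) * β + 4 * C ^ 2 * ν := by gcongr <;> norm_num
    _ = 4 * C ^ 2 * (β + ν) := by ring

lemma abs_correction_le (hh : ∀ s, Continuous (h s)) (s : H) {x : ℝ} (hx : x ∈ Icc 0 (M s)) :
    |S.correction F M B h s x| ≤ 4 * C ^ 2 * (β + ν) :=
  ((hF s).abs_variation_le hx.1 hx.2 (hν s) (hh s) le_rfl (hB s) ((hF s).f_le x hx.1)
    ((hF s).g_le x hx.1)).trans (abs_originCoeff_add_le hF hm hM hB hν s)

lemma abs_dcorrection_le (hh : ∀ s, Continuous (h s)) (s : H) {x : ℝ} (hx : x ∈ Icc 0 (M s)) :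
    |S.dcorrection F M B h s x| ≤ 4 * C ^ 2 * (β + ν) :=
  ((hF s).abs_variation_le hx.1 hx.2 (hν s) (hh s) le_rfl (hB s) ((hF s).df_le x hx.1)
    ((hF s).dg_le x hx.1)).trans (abs_originCoeff_add_le hF hm hM hB hν s)

omit hm in
lemma abs_nextB_le (hm : C ≤ m) {γ : ℝ} (ha : ∀ s, |a s| ≤ γ) (hb : ∀ s, |b s| ≤ γ) (s : H) :
    |S.nextB F M a b B h s| ≤ 5 * C ^ 5 * (γ + Real.exp (-m) * β + ν) := by
  have hC := (hF s).one_le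
  have hC0 := (hF s).pos
  have hm0 : 0 ≤ m := hC0.le.trans hm
  have hγ : 0 ≤ γ := (abs_nonneg _).trans (ha s)
  have hβ : 0 ≤ β := (abs_nonneg _).trans (hB s)
  have hν0 : 0 ≤ ν := (abs_nonneg _).trans (hν s 0 ⟨le_rfl, hm0.trans (hM s)⟩)
  have hα := abs_originCoeff_le (S := S) hF hm0 hM hB hν
  set α := 3 / 2 * (β * Real.exp (-m) + C * ν)
  have hdata : ∀ s {c y : ℝ}, |c| ≤ γ → |y| ≤ C * Real.exp (-M s) →
      |c + y * (F s).decayCoeff (M s) (S.originCoeff F M B h s) (h s)| ≤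
        γ + (C * 1 * α + C ^ 2 * ν) := fun s c y hc hy => by
    have hMs := hm0.trans (hM s)
    refine (abs_add_le _ _).trans (add_le_add hc
      (((hF s).abs_mul_decayCoeff_le (hν s) hMs (hα s) hy).trans ?_))
    gcongr
    exact Real.exp_le_one_iff.2 (by linarith)
  have hMC := fun s => hm.trans (hM s)
  calc |S.nextB F M a b B h s| ≤ 2 * C ^ 3 * (γ + (C * 1 * α + C ^ 2 * ν)) :=
        S.abs_matchCoeff_le hC0 (fun s => (hF s).exp_neg_mul_g_mem (hMC s))
          (fun s => (hF s).exp_neg_mul_dg_mem (hMC s))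
          (fun s => hdata s (ha s) ((hF s).f_le _ (hm0.trans (hM s))))
          (fun s => hdata s (hb s) ((hF s).df_le _ (hm0.trans (hM s)))) s
    _ = 2 * C ^ 3 * γ + 3 * C ^ 4 * (Real.exp (-m) * β) + 5 * C ^ 5 * ν := by ring
    _ ≤ 5 * C ^ 5 * γ + 5 * C ^ 5 * (Real.exp (-m) * β) + 5 * C ^ 5 * ν := by
        gcongr <;> first | assumption | norm_num
    _ = 5 * C ^ 5 * (γ + Real.exp (-m) * β + ν) := by ring

omit hm in
lemma abs_nextB_le_and_abs_correction_le (hm : C ≤ m) (hh : ∀ s, Continuous (h s)) {γ : ℝ}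
    (ha : ∀ s, |a s| ≤ γ) (hb : ∀ s, |b s| ≤ γ) (s : H) :
    |S.nextB F M a b B h s| ≤ 24 * C ^ 7 * (γ + Real.exp (-m) * β + ν) ∧
      ∀ x ∈ Icc 0 (M s), |S.correction F M (S.nextB F M a b B h) h s x| ≤
        24 * C ^ 7 * (γ + Real.exp (-m) * β + ν) := by
  have hm0 : 0 ≤ m := (hF s).pos.le.trans hm
  have hγ : 0 ≤ γ := (abs_nonneg _).trans (ha s)
  have hβ : 0 ≤ β := (abs_nonneg _).trans (hB s)
  have hν0 : 0 ≤ ν := (abs_nonneg _).trans (hν s 0 ⟨le_rfl, hm0.trans (hM s)⟩)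
  have hC := (hF s).one_le
  have hnext := abs_nextB_le (S := S) hF hM hB hν hm ha hb
  set Z := γ + Real.exp (-m) * β + ν
  have hZν : ν ≤ Z := le_add_of_nonneg_left (by positivity)
  have hZ : 0 ≤ Z := hν0.trans hZν
  refine ⟨(hnext s).trans (by gcongr <;> norm_num), fun x hx => ?_⟩
  calc _ ≤ 4 * C ^ 2 * (5 * C ^ 5 * Z + ν) := abs_correction_le hF hm0 hM hnext hν hh s hx
    _ ≤ 4 * C ^ 2 * (5 * C ^ 5 * Z + C ^ 5 * Z) := by
        gcongr
        exact hZν.trans (le_mul_of_one_le_left hZ (one_le_pow₀ hC))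
    _ = 24 * C ^ 7 * Z := by ring

end Correction

end HalfEdges

/-! ### The nonlinear problem on the half-edges of a graph -/

/-- A solution `U` of `-U'' + U = N U`, with its derivative and with a fundamental system of the
equation linearised at `U`. -/
structure Profile (N : ℝ → ℝ) where
  U : ℝ → ℝ
  dU : ℝ → ℝ
  hasDerivAt_U : ∀ x, HasDerivAt U (dU x) x
  hasDerivAt_dU : ∀ x, HasDerivAt dU (U x - N (U x)) x
  system : FundamentalSystem fun x => 1 - deriv N (U x)

namespace Profile

variable {N : ℝ → ℝ}

lemma continuous_U (P : Profile N) : Continuous P.U :=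
  continuous_iff_continuousAt.2 fun x => (P.hasDerivAt_U x).continuousAt

/-- The exponential decay of a profile on the half-line, with the exponential dichotomy of its
linearisation; one constant serves for all the bounds. -/
structure IsDecaying (P : Profile N) (C : ℝ) : Prop where
  dichotomy : P.system.IsDichotomy C
  U_le : ∀ x, 0 ≤ x → |P.U x| ≤ C * Real.exp (-x)
  dU_le : ∀ x, 0 ≤ x → |P.dU x| ≤ C * Real.exp (-x)

lemma IsDecaying.mono {P : Profile N} {C D : ℝ} (hP : P.IsDecaying C) (hCD : C ≤ D) :
    P.IsDecaying D where
  dichotomy := hP.dichotomy.mono hCD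
  U_le x hx := (hP.U_le x hx).trans (by gcongr)
  dU_le x hx := (hP.dU_le x hx).trans (by gcongr)

end Profile

namespace HalfEdges

variable {H V : Type*} (S : HalfEdges H V) {N : ℝ → ℝ}

/-- Profiles which satisfy the vertex conditions, with adapted fundamental systems. -/
structure IsCompatible (P : H → Profile N) : Prop where
  adapted : S.IsAdapted fun s => (P s).system
  dU_zero : ∀ s, (P s).dU 0 = 0
  U_zero : ∀ s ∉ S.peaks, (P s).U 0 = 0

/-- The half-edge `s` having length `M s`, the functions `w s`, with derivatives `dw s`, are a
solution of `-w'' + w = N w` on the graph: they satisfy the vertex conditions, and they match at the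
midpoints of the edges. -/
structure IsSolution [Fintype H] [DecidableEq V] (N : ℝ → ℝ) (M : H → ℝ) (w dw : H → ℝ → ℝ) :
    Prop where
  hasDerivAt : ∀ s x, HasDerivAt (w s) (dw s x) x
  hasDerivAt_deriv : ∀ s, ∀ x ∈ Icc 0 (M s), HasDerivAt (dw s) (w s x - N (w s x)) x
  vertex_eq : ∀ ⦃s s'⦄, S.vert s = S.vert s' → w s 0 = w s' 0
  sum_deriv_eq_zero : ∀ v, ∑ s with S.vert s = v, dw s 0 = 0
  midpoint_eq : ∀ s, w s (M s) = w (S.bar s) (M (S.bar s))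
  midpoint_deriv_eq : ∀ s, dw s (M s) = -dw (S.bar s) (M (S.bar s))

section Source

variable (P : H → Profile N) {M : H → ℝ} (hM : ∀ s, 0 ≤ M s)

/-- The part of the equation for the correction `φ` which is of higher order in `φ`. -/
def source (φ : ∀ s, C(Icc 0 (M s), ℝ)) (s : H) (x : ℝ) : ℝ :=
  taylorRem N ((P s).U x) (IccExtend (hM s) (φ s) x)

lemma continuous_source (hN : ContDiff ℝ 1 N) (φ : ∀ s, C(Icc 0 (M s), ℝ)) (s : H) :
    Continuous (source P hM φ s) := by
  have hU := (P s).continuous_U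
  have hφ := (φ s).continuous.Icc_extend' (h := hM s)
  exact ((hN.continuous.comp (hU.add hφ)).sub (hN.continuous.comp hU)).sub
    (((hN.continuous_deriv le_rfl).comp hU).mul hφ)

lemma source_zero : source P hM 0 = 0 := by
  ext s x
  simp [source, IccExtend]

end Source

section Step

variable [Fintype H]

/-- The unknowns of the nonlinear problem: the coefficients of the growing solutions, and the
correction to the profiles on the half-edges. -/
abbrev State (M : H → ℝ) := (H → ℝ) × (∀ s, C(Icc 0 (M s), ℝ))

variable {M : H → ℝ} (hM : ∀ s, 0 ≤ M s)

lemma State.abs_fst_sub_le (z w : State M) (s : H) : |z.1 s - w.1 s| ≤ dist z w :=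
  (dist_le_pi_dist z.1 w.1 s).trans (le_max_left _ _)

lemma State.abs_snd_sub_le (z w : State M) (s : H) (x : ℝ) :
    |IccExtend (hM s) (z.2 s) x - IccExtend (hM s) (w.2 s) x| ≤ dist z w :=
  (ContinuousMap.dist_apply_le_dist _).trans
    ((dist_le_pi_dist z.2 w.2 s).trans (le_max_right _ _))

lemma State.dist_le {z w : State M} {R : ℝ} (hR : 0 ≤ R) (hfst : ∀ s, |z.1 s - w.1 s| ≤ R)
    (hsnd : ∀ s (x : Icc 0 (M s)), |z.2 s x - w.2 s x| ≤ R) : dist z w ≤ R :=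
  max_le ((dist_pi_le_iff hR).2 hfst)
    ((dist_pi_le_iff hR).2 fun s => (ContinuousMap.dist_le hR).2 (hsnd s))

variable [DecidableEq V] (P : H → Profile N)

/-- The iteration on the coefficients of the growing solutions. -/
def coeffStep (z : State M) : H → ℝ :=
  S.nextB (fun s => (P s).system) M (fun s => (P s).U (M s)) (fun s => (P s).dU (M s)) z.1
    (source P hM z.2)

/-- The map whose fixed point gives the solution of the nonlinear problem. -/
def step (hN : ContDiff ℝ 1 N) (z : State M) : State M :=
  (S.coeffStep hM P z, fun s => ContinuousMap.restrict (Icc 0 (M s))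
    ⟨S.correction (fun s => (P s).system) M (S.coeffStep hM P z) (source P hM z.2) s,
      (P s).system.continuous_response (continuous_source P hM hN z.2 s) _ _⟩)

variable {P} {C m : ℝ} (hP : ∀ s, (P s).IsDecaying C) (hm : C ≤ m) (hMm : ∀ s, m ≤ M s)
include hP

lemma abs_source_sub_le {r η : ℝ} (hr : ∀ c y z : ℝ, |c| ≤ C → |y| ≤ r → |z| ≤ r →
    |taylorRem N c y - taylorRem N c z| ≤ η * |y - z|) (hη : 0 ≤ η) {z w : State M}
    (hz : z ∈ Metric.closedBall 0 r) (hw : w ∈ Metric.closedBall 0 r) (s : H) {x : ℝ}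
    (hx : 0 ≤ x) :
    |(source P hM z.2 - source P hM w.2) s x| ≤ η * dist z w := by
  have hU : |(P s).U x| ≤ C := ((hP s).U_le x hx).trans
    (mul_le_of_le_one_right (hP s).dichotomy.pos.le (Real.exp_le_one_iff.2 (by linarith)))
  have hball : ∀ {z : State M}, z ∈ Metric.closedBall 0 r → |IccExtend (hM s) (z.2 s) x| ≤ r :=
    fun {z} hz => by simpa [IccExtend] using (State.abs_snd_sub_le hM z 0 s x).trans hz
  exact (hr _ _ _ hU (hball hz) (hball hw)).trans
    (mul_le_mul_of_nonneg_left (State.abs_snd_sub_le hM z w s x) hη)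

include hm hMm

lemma dist_step_le (hC : 0 ≤ C) (hN : ContDiff ℝ 1 N) {r η : ℝ}
    (hr : ∀ c y z : ℝ, |c| ≤ C → |y| ≤ r → |z| ≤ r →
      |taylorRem N c y - taylorRem N c z| ≤ η * |y - z|)
    (hη : 0 ≤ η) {z w : State M} (hz : z ∈ Metric.closedBall 0 r)
    (hw : w ∈ Metric.closedBall 0 r) :
    dist (S.step hM P hN z) (S.step hM P hN w) ≤
      24 * C ^ 7 * (Real.exp (-m) + η) * dist z w := by
  set F := fun s => (P s).system
  set a := fun s => (P s).U (M s)
  set b := fun s => (P s).dU (M s)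
  have hsrc := continuous_source P hM hN z.2
  have hsrc' := continuous_source P hM hN w.2
  have hbound := abs_nextB_le_and_abs_correction_le (S := S) (F := F) (a := a - a) (b := b - b)
    (B := z.1 - w.1) (h := source P hM z.2 - source P hM w.2)
    (fun s => (hP s).dichotomy) hMm (State.abs_fst_sub_le z w)
    (fun s x hx => abs_source_sub_le hM hP hr hη hz hw s hx.1) hm
    (fun s => (hsrc s).sub (hsrc' s)) (γ := 0) (by simp) (by simp)
  have hcoeff : S.nextB F M (a - a) (b - b) (z.1 - w.1) (source P hM z.2 - source P hM w.2) =
      S.coeffStep hM P z - S.coeffStep hM P w :=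
    funext fun s => S.nextB_sub F M hsrc hsrc' a a b b z.1 w.1 s
  have hR : 24 * C ^ 7 * (0 + Real.exp (-m) * dist z w + η * dist z w) =
      24 * C ^ 7 * (Real.exp (-m) + η) * dist z w := by ring
  rw [hR, hcoeff] at hbound
  refine State.dist_le (by positivity) (fun s => (hbound s).1) fun s x => ?_
  have hφ := (hbound s).2 x x.2
  rwa [S.correction_sub F M hsrc hsrc'] at hφ

lemma dist_zero_step_zero_le (hC : 0 ≤ C) (hN : ContDiff ℝ 1 N) :
    dist 0 (S.step hM P hN 0) ≤ 24 * C ^ 7 * (C * Real.exp (-m)) := by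
  have hexp : ∀ s, C * Real.exp (-M s) ≤ C * Real.exp (-m) := fun s => by
    gcongr
    exact hMm s
  have hbound := abs_nextB_le_and_abs_correction_le (S := S) (B := 0) (β := 0) (h := 0) (ν := 0)
    (fun s => (hP s).dichotomy) hMm (by simp) (by simp) hm (fun _ => continuous_const)
    (fun s => ((hP s).U_le _ (hM s)).trans (hexp s))
    (fun s => ((hP s).dU_le _ (hM s)).trans (hexp s))
  have hR : 24 * C ^ 7 * (C * Real.exp (-m) + Real.exp (-m) * 0 + 0) =
    24 * C ^ 7 * (C * Real.exp (-m)) := by ring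
  have hcoeff : S.coeffStep hM P (0 : State M) = S.nextB (fun s => (P s).system) M
      (fun s => (P s).U (M s)) (fun s => (P s).dU (M s)) 0 0 := by
    rw [coeffStep, Prod.snd_zero, Prod.fst_zero, source_zero]
  rw [hR, ← hcoeff] at hbound
  rw [dist_comm]
  refine State.dist_le (by positivity) (fun s => ?_) fun s x => ?_
  · simpa [step] using (hbound s).1
  · simpa [step, source_zero] using (hbound s).2 x x.2

lemma exists_step_eq_self (hC : 0 < C) (hN : ContDiff ℝ 1 N) {r η : ℝ}
    (hr : ∀ c y z : ℝ, |c| ≤ C → |y| ≤ r → |z| ≤ r →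
      |taylorRem N c y - taylorRem N c z| ≤ η * |y - z|)
    (hη : η = 1 / (96 * C ^ 7)) (hmη : Real.exp (-m) ≤ η)
    (hmr : 48 * C ^ 8 * Real.exp (-m) ≤ r) :
    ∃ z ∈ Metric.closedBall 0 r, S.step hM P hN z = z ∧
      dist z 0 ≤ 48 * C ^ 8 * Real.exp (-m) := by
  have hη0 : 0 ≤ η := by
    rw [hη]
    positivity
  have hK : ((1 / 2 : NNReal) : ℝ) = 1 / 2 := by norm_num
  have hhalf : 24 * C ^ 7 * (Real.exp (-m) + η) ≤ (1 / 2 : NNReal) := by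
    calc 24 * C ^ 7 * (Real.exp (-m) + η) ≤ 24 * C ^ 7 * (η + η) := by gcongr
      _ = ((1 / 2 : NNReal) : ℝ) := by
        rw [hη, hK]
        field_simp
        norm_num
  have hlip : LipschitzOnWith (1 / 2) (S.step hM P hN) (Metric.closedBall 0 r) :=
    LipschitzOnWith.of_dist_le_mul fun z hz w hw =>
      (dist_step_le S hM hP hm hMm hC.le hN hr hη0 hz hw).trans
        (mul_le_mul_of_nonneg_right hhalf dist_nonneg)
  have hstart := dist_zero_step_zero_le S hM hP hm hMm hC.le hN
  obtain ⟨z, hz, hfix, hdist⟩ := exists_isFixedPt_of_lipschitzOnWith_closedBall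
    (le_trans (by positivity) hmr) (by rw [← NNReal.coe_lt_coe]; norm_num) hlip
    (hstart.trans (by rw [hK]; linarith))
  refine ⟨z, hz, hfix, ?_⟩
  rw [hK] at hdist
  rw [dist_comm]
  linarith

omit hm hMm in
lemma isSolution_of_step_eq_self (hPS : S.IsCompatible P) (hMC : ∀ s, C ≤ M s)
    (hN : ContDiff ℝ 1 N) {z : State M} (hz : S.step hM P hN z = z) :
    S.IsSolution N M
      (fun s x => (P s).U x +
        S.correction (fun s => (P s).system) M z.1 (source P hM z.2) s x)
      (fun s x => (P s).dU x +
        S.dcorrection (fun s => (P s).system) M z.1 (source P hM z.2) s x) := by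
  have hsrc := continuous_source P hM hN z.2
  have hB : S.coeffStep hM P z = z.1 := congrArg Prod.fst hz
  have hφ : ∀ s, ∀ x ∈ Icc 0 (M s), IccExtend (hM s) (z.2 s) x =
      S.correction (fun s => (P s).system) M z.1 (source P hM z.2) s x := fun s x hx => by
    rw [IccExtend_of_mem (hM s) _ hx]
    nth_rw 1 [← hz]
    simp [step, hB]
  exact
    { hasDerivAt := fun s x =>
        ((P s).hasDerivAt_U x).add ((P s).system.hasDerivAt_response (hsrc s) _ _ x)
      hasDerivAt_deriv := fun s x hx => by
        refine (((P s).hasDerivAt_dU x).add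
          ((P s).system.hasDerivAt_dresponse (hsrc s) _ _ x)).congr_deriv ?_
        rw [source, taylorRem, hφ s x hx, correction]
        ring
      vertex_eq := fun s s' hss' => by
        by_cases hs : s ∈ S.peaks
        · rw [S.eq_of_mem_peaks hs hss'.symm]
        by_cases hs' : s' ∈ S.peaks
        · rw [S.eq_of_mem_peaks hs' hss']
        rw [hPS.U_zero s hs, hPS.U_zero s' hs', hPS.adapted.correction_zero hs,
          hPS.adapted.correction_zero hs', hss']
      sum_deriv_eq_zero := fun v => by
        simp only [hPS.dU_zero, zero_add, hPS.adapted.sum_dcorrection_zero]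
      midpoint_eq := fun s =>
        correction_midpoint_eq (fun s => (hP s).dichotomy) hMC s hB
      midpoint_deriv_eq := fun s =>
        dcorrection_midpoint_eq (fun s => (hP s).dichotomy) hMC s hB }

end Step

theorem exists_isSolution [Fintype H] [DecidableEq V] {P : H → Profile N} (hN : ContDiff ℝ 1 N)
    {C : ℝ} (hC : 1 ≤ C) (hP : ∀ s, (P s).IsDecaying C) (hPS : S.IsCompatible P) :
    ∃ K m₀ : ℝ, ∀ M : H → ℝ, ∀ m, m₀ ≤ m → (∀ s, m ≤ M s) →
      ∃ w dw : H → ℝ → ℝ, S.IsSolution N M w dw ∧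
        ∀ s, ∀ x ∈ Icc 0 (M s), |w s x - (P s).U x| ≤ K * Real.exp (-m) ∧
          |dw s x - (P s).dU x| ≤ K * Real.exp (-m) := by
  have hC0 : 0 < C := one_pos.trans_le hC
  set η : ℝ := 1 / (96 * C ^ 7) with hη
  have hη0 : 0 < η := by positivity
  obtain ⟨r, hr0, hr⟩ := exists_taylorRem_lipschitz hN C hη0
  have hsmall : ∀ᶠ m : ℝ in atTop, Real.exp (-m) ≤ η ∧ 48 * C ^ 8 * Real.exp (-m) ≤ r := by
    have hexp : Tendsto (fun m : ℝ => Real.exp (-m)) atTop (nhds 0) :=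
      Real.tendsto_exp_neg_atTop_nhds_zero
    refine (hexp.eventually_le_const hη0).and (Tendsto.eventually_le_const hr0 ?_)
    simpa using hexp.const_mul (48 * C ^ 8)
  obtain ⟨m₀, hm₀⟩ := eventually_atTop.1 hsmall
  refine ⟨4 * C ^ 2 * (48 * C ^ 8 + η * (48 * C ^ 8)), max C m₀, fun M m hm hMm => ?_⟩
  obtain ⟨hmη, hmr⟩ := hm₀ m ((le_max_right _ _).trans hm)
  have hmC := (le_max_left _ _).trans hm
  have hM0 : ∀ s, 0 ≤ M s := fun s => (hC0.le.trans hmC).trans (hMm s)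
  obtain ⟨z, hz, hfix, hdist⟩ := exists_step_eq_self S hM0 hP hmC hMm hC0 hN hr hη hmη hmr
  refine ⟨_, _, isSolution_of_step_eq_self S hM0 hP hPS (fun s => hmC.trans (hMm s)) hN hfix,
    fun s x hx => ?_⟩
  have hB : ∀ s, |z.1 s| ≤ 48 * C ^ 8 * Real.exp (-m) := fun s => by
    simpa using (State.abs_fst_sub_le z 0 s).trans hdist
  have hν : ∀ s, ∀ x ∈ Icc 0 (M s),
      |source P hM0 z.2 s x| ≤ η * (48 * C ^ 8 * Real.exp (-m)) := fun s x hx => by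
    have hsub := abs_source_sub_le hM0 hP hr hη0.le hz
      (Metric.mem_closedBall_self hr0.le) s hx.1
    rw [Prod.snd_zero, source_zero, sub_zero] at hsub
    exact hsub.trans (mul_le_mul_of_nonneg_left hdist hη0.le)
  have hR : 4 * C ^ 2 * (48 * C ^ 8 * Real.exp (-m) + η * (48 * C ^ 8 * Real.exp (-m))) =
      4 * C ^ 2 * (48 * C ^ 8 + η * (48 * C ^ 8)) * Real.exp (-m) := by ring
  have hsrc := continuous_source P hM0 hN z.2
  simp only [add_sub_cancel_left, ← hR]
  exact ⟨abs_correction_le (fun s => (hP s).dichotomy) (hC0.le.trans hmC) hMm hB hν hsrc s hx,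
    abs_dcorrection_le (fun s => (hP s).dichotomy) (hC0.le.trans hmC) hMm hB hν hsrc s hx⟩

end HalfEdges

/-! ### The two profiles: zero and the soliton -/

/-- The nonlinearity `y ↦ |y| ^ (p - 1) y`, the odd extension of `y ↦ y ^ p`. -/
def oddPow (p y : ℝ) : ℝ := |y| ^ (p - 1) * y

@[simp] lemma oddPow_zero (p : ℝ) : oddPow p 0 = 0 := mul_zero _

lemma oddPow_mul (p : ℝ) {s : ℝ} (hs : 0 ≤ s) (y : ℝ) :
    oddPow p (s * y) = s ^ (p - 1) * s * oddPow p y := by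
  rw [oddPow, oddPow, abs_mul, abs_of_nonneg hs, Real.mul_rpow hs (abs_nonneg y)]
  ring

section OddPow

variable {p : ℝ} (hp : 1 < p)
include hp

lemma hasDerivAt_oddPow (y : ℝ) : HasDerivAt (oddPow p) (p * |y| ^ (p - 1)) y := by
  have hp' : p - 1 ≠ 0 := (sub_pos.2 hp).ne'
  rcases eq_or_ne y 0 with rfl | hy
  · rw [abs_zero, Real.zero_rpow hp', mul_zero, hasDerivAt_iff_tendsto_slope]
    have habs : Tendsto (fun z : ℝ => |z| ^ (p - 1)) (nhds 0) (nhds 0) := by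
      simpa [Real.zero_rpow hp'] using
        (continuous_abs.tendsto (0 : ℝ)).rpow_const (Or.inr (sub_pos.2 hp).le)
    refine (habs.mono_left nhdsWithin_le_nhds).congr' ?_
    filter_upwards [self_mem_nhdsWithin] with z (hz : z ≠ 0)
    simp [slope_def_field, oddPow, hz]
  · refine (((hasDerivAt_abs hy).rpow_const (p := p - 1) (Or.inl (abs_ne_zero.2 hy))).mul
      (hasDerivAt_id y)).congr_deriv ?_
    have hsign : (SignType.sign y : ℝ) * y = |y| := sign_mul_self y
    have habs : |y| ≠ 0 := abs_ne_zero.2 hy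
    rw [Real.rpow_sub_one habs, id]
    field_simp
    linear_combination (p - 1) * hsign

lemma deriv_oddPow : deriv (oddPow p) = fun y => p * |y| ^ (p - 1) :=
  funext fun y => (hasDerivAt_oddPow hp y).deriv

lemma deriv_oddPow_zero : deriv (oddPow p) 0 = 0 := by
  simp [deriv_oddPow hp, Real.zero_rpow (sub_pos.2 hp).ne']

lemma contDiff_oddPow : ContDiff ℝ 1 (oddPow p) := by
  rw [contDiff_one_iff_deriv, deriv_oddPow hp]
  exact ⟨fun y => (hasDerivAt_oddPow hp y).differentiableAt,
    continuous_const.mul (continuous_abs.rpow_const fun _ => Or.inr (sub_pos.2 hp).le)⟩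

end OddPow

lemma eventually_forall_abs_le_mul {h e : ℝ → ℝ} (hh : Continuous h) (he : Continuous e)
    (he0 : ∀ x, 0 < e x) (hO : h =O[atTop] e) :
    ∀ᶠ C in atTop, ∀ x, 0 ≤ x → |h x| ≤ C * e x := by
  obtain ⟨c, hc⟩ := hO.bound
  obtain ⟨a, ha⟩ := eventually_atTop.1 hc
  obtain ⟨D, hD⟩ := isCompact_Icc.exists_bound_of_continuousOn
    (s := Icc 0 a) (hh.div he fun x => (he0 x).ne').continuousOn
  filter_upwards [eventually_ge_atTop c, eventually_ge_atTop D] with C hcC hDC x hx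
  rcases le_total a x with hax | hxa
  · have hbound := ha x hax
    rw [Real.norm_eq_abs, Real.norm_of_nonneg (he0 x).le] at hbound
    exact hbound.trans (mul_le_mul_of_nonneg_right hcC (he0 x).le)
  · have hbound := hD x ⟨hx, hxa⟩
    rw [Pi.div_apply, Real.norm_eq_abs, abs_div, abs_of_pos (he0 x), div_le_iff₀ (he0 x)] at hbound
    exact hbound.trans (mul_le_mul_of_nonneg_right hDC (he0 x).le)

lemma eventually_forall_le_mul {h e : ℝ → ℝ} (hO : e =O[atTop] h) (hpos : ∀ᶠ x in atTop, 0 < h x) :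
    ∀ᶠ C in atTop, ∀ x, C ≤ x → e x ≤ C * h x := by
  obtain ⟨c, hc⟩ := hO.bound
  obtain ⟨a, ha⟩ := eventually_atTop.1 (hc.and hpos)
  filter_upwards [eventually_ge_atTop c, eventually_ge_atTop a] with C hcC haC x hx
  obtain ⟨hbound, hx0⟩ := ha x (haC.trans hx)
  rw [Real.norm_of_nonneg hx0.le] at hbound
  exact ((le_abs_self _).trans hbound).trans (mul_le_mul_of_nonneg_right hcC hx0.le)

lemma FundamentalSystem.eventually_isDichotomy {q : ℝ → ℝ} (F : FundamentalSystem q)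
    (hf : F.f =O[atTop] fun x => Real.exp (-x)) (hdf : F.df =O[atTop] fun x => Real.exp (-x))
    (hg : F.g =Θ[atTop] Real.exp) (hdg : F.dg =Θ[atTop] Real.exp)
    (hg0 : ∀ᶠ x in atTop, 0 < F.g x) (hdg0 : ∀ᶠ x in atTop, 0 < F.dg x) :
    ∀ᶠ C in atTop, F.IsDichotomy C := by
  have hcontdf : Continuous F.df :=
    continuous_iff_continuousAt.2 fun x => (F.hasDerivAt_df x).continuousAt
  have hcontdg : Continuous F.dg :=
    continuous_iff_continuousAt.2 fun x => (F.hasDerivAt_dg x).continuousAt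
  have hexp : Continuous fun x : ℝ => Real.exp (-x) := by fun_prop
  filter_upwards [eventually_ge_atTop 1,
    eventually_forall_abs_le_mul F.continuous_f hexp (fun x => Real.exp_pos _) hf,
    eventually_forall_abs_le_mul hcontdf hexp (fun x => Real.exp_pos _) hdf,
    eventually_forall_abs_le_mul F.continuous_g Real.continuous_exp Real.exp_pos hg.1,
    eventually_forall_abs_le_mul hcontdg Real.continuous_exp Real.exp_pos hdg.1,
    eventually_forall_le_mul hg.2 hg0, eventually_forall_le_mul hdg.2 hdg0]
    with C h1 hf hdf hg hdg hg' hdg'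
  exact ⟨h1, hf, hdf, hg, hdg, hg', hdg'⟩

lemma Profile.eventually_isDecaying {N : ℝ → ℝ} (P : Profile N)
    (hU : P.U =O[atTop] fun x => Real.exp (-x)) (hdU : P.dU =O[atTop] fun x => Real.exp (-x))
    (hP : ∀ᶠ C in atTop, P.system.IsDichotomy C) : ∀ᶠ C in atTop, P.IsDecaying C := by
  have hcontdU : Continuous P.dU :=
    continuous_iff_continuousAt.2 fun x => (P.hasDerivAt_dU x).continuousAt
  have hexp : Continuous fun x : ℝ => Real.exp (-x) := by fun_prop
  filter_upwards [hP,
    eventually_forall_abs_le_mul P.continuous_U hexp (fun x => Real.exp_pos _) hU,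
    eventually_forall_abs_le_mul hcontdU hexp (fun x => Real.exp_pos _) hdU] with C hC hU hdU
  exact ⟨hC, hU, hdU⟩

section Zero

variable {N : ℝ → ℝ} (hN : N 0 = 0) (hdN : deriv N 0 = 0)

/-- The zero profile, with the fundamental system `exp (-x)`, `exp x / 2`. -/
def zeroProfile : Profile N where
  U := 0
  dU := 0
  hasDerivAt_U x := hasDerivAt_const x 0
  hasDerivAt_dU x := (hasDerivAt_const x (0 : ℝ)).congr_deriv (by simp [hN])
  system :=
    { f := fun x => Real.exp (-x)
      df := fun x => -Real.exp (-x)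
      g := fun x => Real.exp x / 2
      dg := fun x => Real.exp x / 2
      hasDerivAt_f := fun x => by simpa using (hasDerivAt_neg x).exp
      hasDerivAt_df := fun x => by simpa [hdN] using (hasDerivAt_neg x).exp.fun_neg
      hasDerivAt_g := fun x => (Real.hasDerivAt_exp x).div_const 2
      hasDerivAt_dg := fun x => by simpa [hdN] using (Real.hasDerivAt_exp x).div_const 2
      wronskian := fun x => by
        have hinv : Real.exp (-x) * Real.exp x = 1 := by
          rw [← Real.exp_add, neg_add_cancel, Real.exp_zero]
        linear_combination hinv }

lemma eventually_isDecaying_zeroProfile :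
    ∀ᶠ C in atTop, (zeroProfile hN hdN).IsDecaying C := by
  have hexp : (fun x => Real.exp x / 2) =Θ[atTop] Real.exp := by
    simpa only [div_eq_inv_mul] using
      (isTheta_refl Real.exp atTop).const_mul_left (inv_ne_zero two_ne_zero)
  have hpos : ∀ᶠ x in atTop, 0 < Real.exp x / 2 := Eventually.of_forall fun x => by positivity
  exact Profile.eventually_isDecaying _ (isBigO_zero _ _) (isBigO_zero _ _)
    (FundamentalSystem.eventually_isDichotomy _ (isBigO_refl _ _) (isBigO_refl _ _).neg_left
      hexp hexp hpos hpos)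

end Zero

lemma isLittleO_of_hasDerivAt_of_tendsto_atTop {f f' g g' : ℝ → ℝ}
    (hf : ∀ x, HasDerivAt f (f' x) x) (hg : ∀ x, HasDerivAt g (g' x) x)
    (hg' : ∀ᶠ x in atTop, 0 ≤ g' x) (hgtop : Tendsto g atTop atTop) (h : f' =o[atTop] g') :
    f =o[atTop] g := by
  refine isLittleO_iff.2 fun ε hε => ?_
  obtain ⟨a, ha⟩ := eventually_atTop.1 ((isLittleO_iff.1 h (half_pos hε)).and hg')
  filter_upwards [eventually_ge_atTop a, hgtop.eventually_ge_atTop 0,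
    hgtop.eventually_ge_atTop (2 / ε * (‖f a‖ - ε / 2 * g a))] with x hax hgx0 hgx
  have hbound : ‖f x‖ ≤ ε / 2 * (g x - g a) + ‖f a‖ :=
    image_norm_le_of_norm_deriv_right_le_deriv_boundary (b := x)
      (fun y _ => (hf y).continuousAt.continuousWithinAt)
      (fun y _ => (hf y).hasDerivWithinAt) (by simp)
      (fun y => (((hg y).sub_const (g a)).const_mul (ε / 2)).add_const ‖f a‖)
      (fun y hy => by simpa [abs_of_nonneg (ha y hy.1).2] using (ha y hy.1).1) ⟨hax, le_rfl⟩
  have hconst : ‖f a‖ - ε / 2 * g a ≤ ε / 2 * g x := by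
    rwa [← div_le_iff₀' (half_pos hε), div_eq_inv_mul, inv_div]
  rw [Real.norm_of_nonneg hgx0]
  linarith

lemma tendsto_tanh_atTop : Tendsto Real.tanh atTop (nhds 1) := by
  have hdist : ∀ x, 1 - Real.tanh x ≤ Real.exp (-x) := fun x => by
    have hcosh := Real.cosh_pos x
    rw [Real.tanh_eq_sinh_div_cosh, one_sub_div hcosh.ne', Real.cosh_sub_sinh]
    exact div_le_self (Real.exp_nonneg _) (Real.one_le_cosh x)
  have hlim : Tendsto (fun x => 1 - Real.tanh x) atTop (nhds 0) :=
    squeeze_zero (fun x => (sub_pos.2 (Real.tanh_lt_one x)).le) hdist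
      Real.tendsto_exp_neg_atTop_nhds_zero
  simpa using hlim.const_sub 1

/-! ### Linearisation at the soliton -/

/-- `cosh (a x) ^ (-1 / a)` with `a = (p - 1) / 2`: the soliton without its constant factor. -/
def coshPow (p x : ℝ) : ℝ := Real.cosh ((p - 1) / 2 * x) ^ (-(2 / (p - 1)))

/-- `∫₀ˣ coshPow p ^ (-2)`, which enters the second solution of the linearised equation by
reduction of order. -/
def coshPowInt (p x : ℝ) : ℝ := ∫ y in (0 : ℝ)..x, (coshPow p y ^ 2)⁻¹

/-- `tanh (a x)` with `a = (p - 1) / 2`: minus the logarithmic derivative of the soliton. -/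
def tanhScaled (p x : ℝ) : ℝ := Real.tanh ((p - 1) / 2 * x)

lemma coshPow_pos (p x : ℝ) : 0 < coshPow p x := Real.rpow_pos_of_pos (Real.cosh_pos _) _

@[simp] lemma coshPowInt_zero (p : ℝ) : coshPowInt p 0 = 0 := intervalIntegral.integral_same

@[simp] lemma tanhScaled_zero (p : ℝ) : tanhScaled p 0 = 0 := by simp [tanhScaled]

lemma soliton_eq (p x : ℝ) : soliton p x = ((p + 1) / 2) ^ (1 / (p - 1)) * coshPow p x := rfl

lemma one_sub_tanhScaled_sq (p x : ℝ) :
    1 - tanhScaled p x ^ 2 = (Real.cosh ((p - 1) / 2 * x) ^ 2)⁻¹ := by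
  have hcosh := Real.cosh_pos ((p - 1) / 2 * x)
  rw [tanhScaled, Real.tanh_eq_sinh_div_cosh, div_pow, one_sub_div (pow_pos hcosh 2).ne',
    Real.cosh_sq_sub_sinh_sq, one_div]

lemma hasDerivAt_tanhScaled (p x : ℝ) :
    HasDerivAt (tanhScaled p) ((p - 1) / 2 * (1 - tanhScaled p x ^ 2)) x := by
  have hlin : HasDerivAt (fun x : ℝ => (p - 1) / 2 * x) ((p - 1) / 2) x := by
    simpa using (hasDerivAt_id x).const_mul ((p - 1) / 2)
  refine ((hlin.sinh.fun_div hlin.cosh (Real.cosh_pos _).ne').congr_deriv ?_).congr_of_eventuallyEq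
    (Eventually.of_forall fun y => Real.tanh_eq_sinh_div_cosh _)
  rw [one_sub_tanhScaled_sq, div_eq_mul_inv]
  congr 1
  linear_combination (p - 1) / 2 * Real.cosh_sq ((p - 1) / 2 * x)

section Soliton

variable {p : ℝ} (hp : 1 < p)
include hp

lemma tendsto_tanhScaled : Tendsto (tanhScaled p) atTop (nhds 1) :=
  tendsto_tanh_atTop.comp (tendsto_id.const_mul_atTop (half_pos (sub_pos.2 hp)))

lemma hasDerivAt_coshPow (x : ℝ) :
    HasDerivAt (coshPow p) (-(tanhScaled p x * coshPow p x)) x := by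
  have hcosh := Real.cosh_pos ((p - 1) / 2 * x)
  have hlin : HasDerivAt (fun x : ℝ => (p - 1) / 2 * x) ((p - 1) / 2) x := by
    simpa using (hasDerivAt_id x).const_mul ((p - 1) / 2)
  refine (hlin.cosh.rpow_const (p := -(2 / (p - 1))) (Or.inl hcosh.ne')).congr_deriv ?_
  rw [Real.rpow_sub_one hcosh.ne', tanhScaled, Real.tanh_eq_sinh_div_cosh, coshPow]
  have : p - 1 ≠ 0 := (sub_pos.2 hp).ne'
  field_simp

lemma hasDerivAt_inv_coshPow_sq (x : ℝ) :
    HasDerivAt (fun x => (coshPow p x ^ 2)⁻¹) (2 * tanhScaled p x * (coshPow p x ^ 2)⁻¹) x := by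
  have hσ := coshPow_pos p x
  refine (((hasDerivAt_coshPow hp x).fun_pow 2).fun_inv (pow_pos hσ 2).ne').congr_deriv ?_
  push_cast
  field_simp

lemma hasDerivAt_coshPowInt (x : ℝ) : HasDerivAt (coshPowInt p) ((coshPow p x ^ 2)⁻¹) x := by
  have hcont : Continuous fun y => (coshPow p y ^ 2)⁻¹ :=
    continuous_iff_continuousAt.2 fun y => (hasDerivAt_inv_coshPow_sq hp y).continuousAt
  exact (hcont.integral_hasStrictDerivAt 0 x).hasDerivAt

lemma exp_neg_le_coshPow {x : ℝ} (hx : 0 ≤ x) : Real.exp (-x) ≤ coshPow p x := by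
  have hp' : 0 < p - 1 := sub_pos.2 hp
  have hcosh : Real.cosh ((p - 1) / 2 * x) ≤ Real.exp ((p - 1) / 2 * x) := by
    have : 0 ≤ (p - 1) / 2 * x := by positivity
    linarith [Real.cosh_eq ((p - 1) / 2 * x), Real.exp_le_exp.2 (neg_le_self this)]
  refine (Real.rpow_le_rpow_of_nonpos (Real.cosh_pos _) hcosh
    (neg_nonpos.2 (div_pos two_pos hp').le)).trans_eq' ?_
  rw [← Real.exp_mul]
  congr 1
  field_simp

lemma coshPow_le_exp_neg (x : ℝ) : coshPow p x ≤ 2 ^ (2 / (p - 1)) * Real.exp (-x) := by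
  have hp' : 0 < p - 1 := sub_pos.2 hp
  have hcosh : Real.exp ((p - 1) / 2 * x) / 2 ≤ Real.cosh ((p - 1) / 2 * x) := by
    linarith [Real.cosh_eq ((p - 1) / 2 * x), Real.exp_pos (-((p - 1) / 2 * x))]
  refine (Real.rpow_le_rpow_of_nonpos (by positivity) hcosh
    (neg_nonpos.2 (div_pos two_pos hp').le)).trans_eq ?_
  rw [Real.div_rpow (Real.exp_nonneg _) zero_le_two, Real.rpow_neg zero_le_two, div_inv_eq_mul,
    ← Real.exp_mul, mul_comm]
  congr 2
  field_simp

lemma isTheta_coshPow : coshPow p =Θ[atTop] fun x => Real.exp (-x) := by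
  constructor
  · refine IsBigO.of_bound (2 ^ (2 / (p - 1))) (Eventually.of_forall fun x => ?_)
    rw [Real.norm_of_nonneg (coshPow_pos p x).le, Real.norm_of_nonneg (Real.exp_nonneg _)]
    exact coshPow_le_exp_neg hp x
  · refine IsBigO.of_bound 1 ((eventually_ge_atTop 0).mono fun x hx => ?_)
    rw [Real.norm_of_nonneg (coshPow_pos p x).le, Real.norm_of_nonneg (Real.exp_nonneg _), one_mul]
    exact exp_neg_le_coshPow hp hx

lemma tendsto_coshPow_sq_mul_coshPowInt :
    Tendsto (fun x => coshPow p x ^ 2 * coshPowInt p x) atTop (nhds (1 / 2)) := by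
  have hinv : Tendsto (fun x => (coshPow p x ^ 2)⁻¹) atTop atTop := by
    have hσ := (isTheta_coshPow hp).1.trans_tendsto Real.tendsto_exp_neg_atTop_nhds_zero
    refine Tendsto.inv_tendsto_nhdsGT_zero (tendsto_nhdsWithin_iff.2 ⟨by simpa using hσ.pow 2, ?_⟩)
    exact Eventually.of_forall fun x => pow_pos (coshPow_pos p x) 2
  have hderiv : (fun x => (coshPow p x ^ 2)⁻¹ - 1 / 2 * (2 * tanhScaled p x * (coshPow p x ^ 2)⁻¹))
      =o[atTop] fun x => 2 * tanhScaled p x * (coshPow p x ^ 2)⁻¹ := by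
    have hone : (fun x => 1 - tanhScaled p x) =o[atTop] fun x => 2 * tanhScaled p x := by
      refine (isLittleO_iff_tendsto' ?_).2 ?_
      · filter_upwards [(tendsto_tanhScaled hp).eventually_ne one_ne_zero] with x hx h0
        exact absurd ((mul_eq_zero.1 h0).resolve_left two_ne_zero) hx
      · simpa using! ((tendsto_tanhScaled hp).const_sub 1).div
          ((tendsto_tanhScaled hp).const_mul 2) (by norm_num)
    refine (hone.mul_isBigO (isBigO_refl (fun x => (coshPow p x ^ 2)⁻¹) atTop)).congr_left
      fun x => by ring
  have hnonneg : ∀ᶠ x in atTop, 0 ≤ 2 * tanhScaled p x * (coshPow p x ^ 2)⁻¹ := by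
    filter_upwards [(tendsto_tanhScaled hp).eventually_const_le zero_lt_one] with x hx
    positivity
  have hlim := (isLittleO_of_hasDerivAt_of_tendsto_atTop
    (fun x => (hasDerivAt_coshPowInt hp x).sub ((hasDerivAt_inv_coshPow_sq hp x).const_mul (1 / 2)))
    (hasDerivAt_inv_coshPow_sq hp) hnonneg hinv hderiv).tendsto_div_nhds_zero.add_const (1 / 2)
  rw [zero_add] at hlim
  refine hlim.congr fun x => ?_
  have hσ := (coshPow_pos p x).ne'
  simp only [Pi.sub_apply]
  field_simp
  ring

lemma isTheta_exp_of_tendsto_mul_coshPow {h : ℝ → ℝ} {c : ℝ} (hc : 0 < c)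
    (hlim : Tendsto (fun x => h x * coshPow p x) atTop (nhds c)) : h =Θ[atTop] Real.exp := by
  have hinv : h =Θ[atTop] fun x => (coshPow p x)⁻¹ :=
    (isTheta_of_div_tendsto_nhds_ne_zero (by simpa only [div_inv_eq_mul] using hlim) hc.ne').symm
  refine hinv.trans ((isTheta_coshPow hp).inv.trans (isTheta_of_div_tendsto_nhds_ne_zero
    (c := 1) (tendsto_const_nhds.congr fun x => ?_) one_ne_zero))
  rw [Real.exp_neg, inv_inv, div_self (Real.exp_ne_zero x)]

omit hp in
lemma eventually_pos_of_tendsto_mul_coshPow {h : ℝ → ℝ} {c : ℝ} (hc : 0 < c)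
    (hlim : Tendsto (fun x => h x * coshPow p x) atTop (nhds c)) : ∀ᶠ x in atTop, 0 < h x :=
  (hlim.eventually_const_lt hc).mono fun x hx => pos_of_mul_pos_left hx (coshPow_pos p x).le

lemma soliton_pos (x : ℝ) : 0 < soliton p x :=
  mul_pos (Real.rpow_pos_of_pos (by linarith) _) (coshPow_pos p x)

lemma abs_soliton_rpow (x : ℝ) :
    |soliton p x| ^ (p - 1) = (p + 1) / 2 * (1 - tanhScaled p x ^ 2) := by
  have hp' : p - 1 ≠ 0 := (sub_pos.2 hp).ne'
  have hcosh := Real.cosh_pos ((p - 1) / 2 * x)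
  have hcoeff : (((p + 1) / 2) ^ (1 / (p - 1))) ^ (p - 1) = (p + 1) / 2 := by
    rw [← Real.rpow_mul (by linarith), one_div, inv_mul_cancel₀ hp', Real.rpow_one]
  have hexponent : -(2 / (p - 1)) * (p - 1) = -((2 : ℕ) : ℝ) := by
    push_cast
    field_simp
  rw [abs_of_pos (soliton_pos hp x), soliton_eq,
    Real.mul_rpow (Real.rpow_nonneg (by linarith) _) (coshPow_pos p x).le, hcoeff, coshPow,
    ← Real.rpow_mul hcosh.le, one_sub_tanhScaled_sq, hexponent, Real.rpow_neg hcosh.le,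
    Real.rpow_natCast]

lemma hasDerivAt_soliton (x : ℝ) :
    HasDerivAt (soliton p) (-(tanhScaled p x * soliton p x)) x :=
  ((hasDerivAt_coshPow hp x).const_mul _).congr_deriv (by rw [soliton_eq]; ring)

/-- The fundamental system at the soliton: a multiple of its derivative, and the solution obtained
from it by reduction of order. -/
def solitonSystem : FundamentalSystem fun x => 1 - deriv (oddPow p) (soliton p x) where
  f x := 2 / (p - 1) * (tanhScaled p x * coshPow p x)
  df x := 2 / (p - 1) * (((p - 1) / 2 - (p + 1) / 2 * tanhScaled p x ^ 2) * coshPow p x)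
  g x := (p + 3) / 2 * (tanhScaled p x * coshPow p x * coshPowInt p x) - (coshPow p x)⁻¹
  dg x := (p + 3) / 2 * (((p - 1) / 2 - (p + 1) / 2 * tanhScaled p x ^ 2) * coshPow p x *
    coshPowInt p x) + (p + 1) / 2 * tanhScaled p x * (coshPow p x)⁻¹
  hasDerivAt_f x := by
    refine (((hasDerivAt_tanhScaled p x).mul (hasDerivAt_coshPow hp x)).const_mul _).congr_deriv ?_
    ring
  hasDerivAt_df x := by
    refine ((((((hasDerivAt_tanhScaled p x).fun_pow 2).const_mul _).const_sub _).mul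
      (hasDerivAt_coshPow hp x)).const_mul _).congr_deriv ?_
    rw [(hasDerivAt_oddPow hp _).deriv, abs_soliton_rpow hp]
    push_cast
    ring
  hasDerivAt_g x := by
    have hσ := coshPow_pos p x
    refine (((((hasDerivAt_tanhScaled p x).mul (hasDerivAt_coshPow hp x)).mul
      (hasDerivAt_coshPowInt hp x)).const_mul _).sub
      ((hasDerivAt_coshPow hp x).fun_inv hσ.ne')).congr_deriv ?_
    simp only [Pi.mul_apply]
    field_simp
    ring
  hasDerivAt_dg x := by
    have hσ := coshPow_pos p x
    refine (((((((hasDerivAt_tanhScaled p x).fun_pow 2).const_mul _).const_sub _).mul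
      (hasDerivAt_coshPow hp x)).mul (hasDerivAt_coshPowInt hp x)).const_mul _ |>.add
      (((hasDerivAt_tanhScaled p x).const_mul _).mul
      ((hasDerivAt_coshPow hp x).fun_inv hσ.ne'))).congr_deriv ?_
    rw [(hasDerivAt_oddPow hp _).deriv, abs_soliton_rpow hp]
    simp only [Pi.mul_apply]
    push_cast
    field_simp
    ring
  wronskian x := by
    have hσ := coshPow_pos p x
    have : p - 1 ≠ 0 := (sub_pos.2 hp).ne'
    field_simp
    ring

/-- The soliton as a profile. -/
def solitonProfile : Profile (oddPow p) where
  U := soliton p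
  dU x := -(tanhScaled p x * soliton p x)
  hasDerivAt_U := hasDerivAt_soliton hp
  hasDerivAt_dU x := by
    refine (((hasDerivAt_tanhScaled p x).mul (hasDerivAt_soliton hp x)).neg).congr_deriv ?_
    rw [oddPow, abs_soliton_rpow hp]
    ring
  system := solitonSystem hp

lemma eventually_isDichotomy_solitonSystem : ∀ᶠ C in atTop, (solitonSystem hp).IsDichotomy C := by
  have ht := tendsto_tanhScaled hp
  have hJ := tendsto_coshPow_sq_mul_coshPowInt hp
  have ht1 : tanhScaled p =O[atTop] fun _ => (1 : ℝ) := ht.isBigO_one ℝ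
  have hσ := (isTheta_coshPow hp).1
  have hlim : 0 < (p - 1) / 4 := by linarith
  have hg : Tendsto (fun x => (solitonSystem hp).g x * coshPow p x) atTop (nhds ((p - 1) / 4)) := by
    have := ((ht.mul hJ).const_mul ((p + 3) / 2)).sub_const 1
    convert this using 2
    · rename_i x
      have hσx := (coshPow_pos p x).ne'
      simp only [solitonSystem]
      field_simp
    · ring
  have hdg : Tendsto (fun x => (solitonSystem hp).dg x * coshPow p x) atTop
      (nhds ((p - 1) / 4)) := by
    have := ((((((ht.pow 2).const_mul ((p + 1) / 2)).const_sub ((p - 1) / 2)).mul hJ).const_mul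
      ((p + 3) / 2))).add (ht.const_mul ((p + 1) / 2))
    convert this using 2
    · rename_i x
      have hσx := (coshPow_pos p x).ne'
      simp only [solitonSystem]
      field_simp
    · ring
  have hf : (solitonSystem hp).f =O[atTop] fun x => Real.exp (-x) := by
    simpa [solitonSystem] using (ht1.mul hσ).const_mul_left (2 / (p - 1))
  have hdf : (solitonSystem hp).df =O[atTop] fun x => Real.exp (-x) := by
    have hcoeff := (((ht.pow 2).const_mul ((p + 1) / 2)).const_sub ((p - 1) / 2)).isBigO_one ℝ
    simpa [solitonSystem] using (hcoeff.mul hσ).const_mul_left (2 / (p - 1))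
  exact FundamentalSystem.eventually_isDichotomy _ hf hdf
    (isTheta_exp_of_tendsto_mul_coshPow hp hlim hg)
    (isTheta_exp_of_tendsto_mul_coshPow hp hlim hdg)
    (eventually_pos_of_tendsto_mul_coshPow hlim hg)
    (eventually_pos_of_tendsto_mul_coshPow hlim hdg)

lemma eventually_isDecaying_solitonProfile : ∀ᶠ C in atTop, (solitonProfile hp).IsDecaying C := by
  have hU : soliton p =O[atTop] fun x => Real.exp (-x) :=
    (isTheta_coshPow hp).1.const_mul_left _
  refine Profile.eventually_isDecaying _ hU ?_ (eventually_isDichotomy_solitonSystem hp)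
  simpa [solitonProfile] using (((tendsto_tanhScaled hp).isBigO_one ℝ).mul hU).neg_left

end Soliton

/-! ### Weak derivatives of functions of class `C¹` -/

lemma memLp_two_restrict_Icc {l : ℝ} {f : ℝ → ℝ} (hf : ContinuousOn f (Icc 0 l)) :
    MemLp f 2 (volume.restrict (Icc 0 l)) := by
  obtain ⟨K, hK⟩ := isCompact_Icc.exists_bound_of_continuousOn hf
  exact MemLp.of_bound (hf.aestronglyMeasurable measurableSet_Icc) K
    ((ae_restrict_iff' measurableSet_Icc).2 (ae_of_all _ hK))

section WeakDeriv

variable {l : ℝ} {f f' : ℝ → ℝ}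

lemma isWeakDeriv_of_hasDerivAt (hl : 0 ≤ l) (hf : ∀ x ∈ Icc 0 l, HasDerivAt f (f' x) x)
    (hf' : ContinuousOn f' (Icc 0 l)) : IsWeakDeriv l f f' := by
  intro η hη _ hsupp
  have hη0 : η 0 = 0 := image_eq_zero_of_notMem_tsupport fun h => lt_irrefl _ (hsupp h).1
  have hηl : η l = 0 := image_eq_zero_of_notMem_tsupport fun h => lt_irrefl _ (hsupp h).2
  rw [← uIcc_of_le hl] at hf hf'
  rw [intervalIntegral.integral_mul_deriv_eq_deriv_mul hf
    (fun x _ => (hη.differentiable (by simp) x).hasDerivAt) hf'.intervalIntegrable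
    ((hη.continuous_deriv (by simp)).intervalIntegrable _ _), hη0, hηl]
  ring

lemma memH1Interval_of_hasDerivAt (hl : 0 ≤ l) (hf : ∀ x ∈ Icc 0 l, HasDerivAt f (f' x) x)
    (hf' : ContinuousOn f' (Icc 0 l)) : MemH1Interval l f :=
  ⟨memLp_two_restrict_Icc fun x hx => (hf x hx).continuousAt.continuousWithinAt,
    f', memLp_two_restrict_Icc hf', isWeakDeriv_of_hasDerivAt hl hf hf'⟩

lemma IsWeakDeriv.ae_eq {g g' : ℝ → ℝ} (hl : 0 ≤ l) (h : IsWeakDeriv l f g)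
    (h' : IsWeakDeriv l f g') (hg : IntegrableOn g (Icc 0 l)) (hg' : IntegrableOn g' (Icc 0 l)) :
    ∀ᵐ x, x ∈ Ioo 0 l → g x = g' x := by
  have hzero : ∀ᵐ x, x ∈ Ioo 0 l → (g - g') x = 0 := by
    refine isOpen_Ioo.ae_eq_zero_of_integral_contDiff_smul_eq_zero
      ((hg.sub hg').mono_set Ioo_subset_Icc_self).locallyIntegrableOn fun η hη hc hs => ?_
    have hmul : ∀ w, IntegrableOn w (Icc 0 l) →
        IntervalIntegrable (fun x => w x * η x) volume 0 l := fun w hw => by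
      obtain ⟨K, hK⟩ := hc.exists_bound_of_continuous hη.continuous
      rw [intervalIntegrable_iff_integrableOn_Icc_of_le hl]
      exact Integrable.mul_bdd hw hη.continuous.aestronglyMeasurable (ae_of_all _ hK)
    have hsupp : ∀ x ∉ Ioc 0 l, η x • (g - g') x = 0 := fun x hx => by
      rw [image_eq_zero_of_notMem_tsupport fun h => hx (Ioo_subset_Ioc_self (hs h)), zero_smul]
    calc ∫ x, η x • (g - g') x = ∫ x in (0 : ℝ)..l, η x • (g - g') x := by
          rw [intervalIntegral.integral_of_le hl,
            setIntegral_eq_integral_of_forall_compl_eq_zero hsupp]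
      _ = ∫ x in (0 : ℝ)..l, (g x * η x - g' x * η x) := by
          simp only [smul_eq_mul, Pi.sub_apply, mul_sub, mul_comm]
      _ = 0 := by
          rw [intervalIntegral.integral_sub (hmul g hg) (hmul g' hg')]
          linarith [h η hη hc hs, h' η hη hc hs]
  filter_upwards [hzero] with x hx hxl using sub_eq_zero.1 (hx hxl)

lemma weakDeriv_ae_eq (hl : 0 ≤ l) (hf : ∀ x ∈ Icc 0 l, HasDerivAt f (f' x) x)
    (hf' : ContinuousOn f' (Icc 0 l)) : ∀ᵐ x, x ∈ Ioo 0 l → weakDeriv l f x = f' x := by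
  have h : HasL2WeakDeriv l f := (memH1Interval_of_hasDerivAt hl hf hf').2
  rw [weakDeriv, dif_pos h]
  exact h.choose_spec.2.ae_eq hl (isWeakDeriv_of_hasDerivAt hl hf hf')
    (h.choose_spec.1.integrable one_le_two) hf'.integrableOn_Icc

lemma integral_weakDeriv_mul_self (hl : 0 ≤ l) (hf : ∀ x ∈ Icc 0 l, HasDerivAt f (f' x) x)
    (hf' : ContinuousOn f' (Icc 0 l)) :
    ∫ x in (0 : ℝ)..l, weakDeriv l f x * weakDeriv l f x = ∫ x in (0 : ℝ)..l, f' x * f' x := by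
  refine intervalIntegral.integral_congr_ae ?_
  filter_upwards [weakDeriv_ae_eq hl hf hf', Measure.ae_ne volume l] with x hx hxl hm
  rw [uIoc_of_le hl] at hm
  rw [hx ⟨hm.1, lt_of_le_of_ne hm.2 hxl⟩]

end WeakDeriv

/-! ### Minima on an interval, and uniqueness for differential equations -/

section Minimum

variable {f : ℝ → ℝ} {a b x : ℝ}

lemma deriv_mul_sub_nonneg_of_isMinOn_Icc {d y : ℝ} (h : IsMinOn f (Icc a b) x)
    (hx : x ∈ Icc a b) (hf : HasDerivAt f d x) (hy : y ∈ Icc a b) : 0 ≤ d * (y - x) := by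
  have hcone : y - x ∈ posTangentConeAt (Icc a b) x :=
    sub_mem_posTangentConeAt_of_segment_subset ((convex_Icc a b).segment_subset hx hy)
  simpa [mul_comm] using
    h.localize.hasFDerivWithinAt_nonneg hf.hasFDerivAt.hasFDerivWithinAt hcone

lemma second_deriv_nonneg_of_isMinOn_Icc {f' : ℝ → ℝ} {c : ℝ} (hab : a < b)
    (h : IsMinOn f (Icc a b) x) (hx : x ∈ Icc a b) (hf : ∀ y, HasDerivAt f (f' y) y)
    (hf'x : f' x = 0) (hf' : HasDerivAt f' c x) : 0 ≤ c := by
  by_contra! hc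
  -- `f` plus a small parabola still has a maximum at `x`, by the second derivative test
  set q : ℝ → ℝ := fun y => f y + -c / 4 * (y - x) ^ 2 with hq
  have hdq : ∀ y, HasDerivAt q (f' y + -c / 2 * (y - x)) y := fun y =>
    ((hf y).add ((((hasDerivAt_id y).sub_const x).pow 2).const_mul (-c / 4))).congr_deriv
      (by simp; ring)
  have hmax : IsLocalMax q x := by
    have hdq' : deriv q = fun y => f' y + -c / 2 * (y - x) := funext fun y => (hdq y).deriv
    have hddq : HasDerivAt (deriv q) (c + -c / 2) x := by
      rw [hdq']
      exact (hf'.add (((hasDerivAt_id x).sub_const x).const_mul (-c / 2))).congr_deriv (by simp)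
    refine isLocalMax_of_deriv_deriv_neg ?_ (by simp [hdq', hf'x]) (hdq x).continuousAt
    rw [hddq.deriv]
    linarith
  have hfreq : ∃ᶠ y in nhds x, y ≠ x ∧ y ∈ Icc a b :=
    accPt_iff_frequently.1 <| isPreconnected_Icc.preperfect_of_nontrivial
      ⟨a, left_mem_Icc.2 hab.le, b, right_mem_Icc.2 hab.le, hab.ne⟩ x hx
  obtain ⟨y, ⟨hyx, hy⟩, hqy⟩ := (hfreq.and_eventually hmax).exists
  have hfxy : f x ≤ f y := h hy
  have hpos : 0 < -c / 4 * (y - x) ^ 2 :=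
    mul_pos (by linarith) (sq_pos_of_ne_zero (sub_ne_zero.2 hyx))
  simp only [hq, sub_self] at hqy
  linarith

end Minimum

lemma eqOn_Icc_of_hasDerivAt_of_lipschitzOnWith {X : Type*} [NormedAddCommGroup X]
    [NormedSpace ℝ X] {F : X → X} {s : Set X} {K : NNReal} (hF : LipschitzOnWith K F s)
    {y z : ℝ → X} {a b x₀ : ℝ} (hx₀ : x₀ ∈ Icc a b)
    (hy : ∀ x ∈ Icc a b, HasDerivAt y (F (y x)) x) (hys : MapsTo y (Icc a b) s)
    (hz : ∀ x ∈ Icc a b, HasDerivAt z (F (z x)) x) (hzs : MapsTo z (Icc a b) s)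
    (h₀ : y x₀ = z x₀) : EqOn y z (Icc a b) := by
  rw [← Icc_union_Icc_eq_Icc hx₀.1 hx₀.2]
  have hleft : Icc a x₀ ⊆ Icc a b := Icc_subset_Icc_right hx₀.2
  have hright : Icc x₀ b ⊆ Icc a b := Icc_subset_Icc_left hx₀.1
  refine EqOn.union ?_ ?_
  · have hsub := Ioc_subset_Icc_self.trans hleft
    exact ODE_solution_unique_of_mem_Icc_left (fun _ _ => hF)
      (HasDerivAt.continuousOn fun x hx => hy x (hleft hx))
      (fun x hx => (hy x (hsub hx)).hasDerivWithinAt) (fun x hx => hys (hsub hx))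
      (HasDerivAt.continuousOn fun x hx => hz x (hleft hx))
      (fun x hx => (hz x (hsub hx)).hasDerivWithinAt) (fun x hx => hzs (hsub hx)) h₀
  · have hsub := Ico_subset_Icc_self.trans hright
    exact ODE_solution_unique_of_mem_Icc_right (fun _ _ => hF)
      (HasDerivAt.continuousOn fun x hx => hy x (hright hx))
      (fun x hx => (hy x (hsub hx)).hasDerivWithinAt) (fun x hx => hys (hsub hx))
      (HasDerivAt.continuousOn fun x hx => hz x (hright hx))
      (fun x hx => (hz x (hsub hx)).hasDerivWithinAt) (fun x hx => hzs (hsub hx)) h₀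

/-- Functions on the graph, with derivatives `du`, of class `C²` up to the ends of the edges and
satisfying `-u'' + λ u = N u` on the edges, continuity and Kirchhoff conditions at the vertices. The
functions are extended past the ends of the edges, so that derivatives there are two-sided. -/
structure MetricGraph.IsClassicalSolution {V E : Type*} [Fintype E] [DecidableEq V]
    (G : MetricGraph V E) (N : ℝ → ℝ) (lam : ℝ) (u du : E → ℝ → ℝ) : Prop where
  hasDerivAt : ∀ e x, HasDerivAt (u e) (du e x) x
  hasDerivAt_deriv : ∀ e, ∀ x ∈ Icc 0 (G.len e), HasDerivAt (du e) (lam * u e x - N (u e x)) x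
  exists_vertex : ∃ c : V → ℝ, ∀ e, u e 0 = c (G.src e) ∧ u e (G.len e) = c (G.tgt e)
  kirchhoff : ∀ v, ∑ e, ((if G.src e = v then du e 0 else 0) +
    (if G.tgt e = v then -du e (G.len e) else 0)) = 0

namespace MetricGraph.IsClassicalSolution

variable {V E : Type*} [Fintype E] [DecidableEq V] {G : MetricGraph V E} {N : ℝ → ℝ} {lam : ℝ}
  {u du : E → ℝ → ℝ} (h : G.IsClassicalSolution N lam u du)

include h

lemma continuous (e : E) : Continuous (u e) :=
  continuous_iff_continuousAt.2 fun x => (h.hasDerivAt e x).continuousAt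

lemma continuousOn_deriv (e : E) : ContinuousOn (du e) (Icc 0 (G.len e)) :=
  HasDerivAt.continuousOn (h.hasDerivAt_deriv e)

lemma deriv_eq_zero_of_forall_le {m : ℝ} (hm : ∀ e, ∀ x ∈ Icc 0 (G.len e), m ≤ u e x) {e : E}
    {x : ℝ} (hx : x ∈ Icc 0 (G.len e)) (hux : u e x = m) : du e x = 0 := by
  obtain ⟨c, hc⟩ := h.exists_vertex
  have hmin : ∀ e, ∀ x ∈ Icc 0 (G.len e), u e x = m → ∀ y ∈ Icc 0 (G.len e),
      0 ≤ du e x * (y - x) := fun e x hx hux y hy =>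
    deriv_mul_sub_nonneg_of_isMinOn_Icc (fun z hz => hux.trans_le (hm e z hz)) hx
      (h.hasDerivAt e x) hy
  have h0 : ∀ e, (0 : ℝ) ∈ Icc 0 (G.len e) := fun e => left_mem_Icc.2 (G.len_pos e).le
  have hl : ∀ e, G.len e ∈ Icc 0 (G.len e) := fun e => right_mem_Icc.2 (G.len_pos e).le
  -- at a vertex where the minimum is attained all the outward derivatives are nonnegative
  have hsrc : ∀ v, c v = m → ∀ e, 0 ≤ (if G.src e = v then du e 0 else 0) := fun v hv e => by
    split_ifs with he
    · have := hmin e 0 (h0 e) (by rw [(hc e).1, he, hv]) _ (hl e)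
      exact nonneg_of_mul_nonneg_left this (by linarith [G.len_pos e])
    · exact le_rfl
  have htgt : ∀ v, c v = m → ∀ e, 0 ≤ (if G.tgt e = v then -du e (G.len e) else 0) :=
    fun v hv e => by
    split_ifs with he
    · have := hmin e _ (hl e) (by rw [(hc e).2, he, hv]) 0 (h0 e)
      exact nonneg_of_mul_nonneg_left (b := G.len e) (by linarith) (G.len_pos e)
    · exact le_rfl
  have hzero : ∀ v, c v = m → ∀ e, (if G.src e = v then du e 0 else 0) = 0 ∧
      (if G.tgt e = v then -du e (G.len e) else 0) = 0 := fun v hv e =>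
    (add_eq_zero_iff_of_nonneg (hsrc v hv e) (htgt v hv e)).1 <|
      (Finset.sum_eq_zero_iff_of_nonneg fun e _ => add_nonneg (hsrc v hv e) (htgt v hv e)).1
        (h.kirchhoff v) e (Finset.mem_univ e)
  rcases hx.1.eq_or_lt with rfl | hx0
  · simpa using (hzero (G.src e) ((hc e).1.symm.trans hux) e).1
  rcases hx.2.eq_or_lt with rfl | hxl
  · simpa using (hzero (G.tgt e) ((hc e).2.symm.trans hux) e).2
  · have hleft := hmin e x hx hux 0 (h0 e)
    have hright := hmin e x hx hux _ (hl e)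
    exact le_antisymm (by nlinarith) (nonneg_of_mul_nonneg_left hright (by linarith))

lemma nonneg (hneg : ∀ e, ∀ x ∈ Icc 0 (G.len e), u e x < 0 → lam * u e x < N (u e x)) (e : E)
    {x : ℝ} (hx : x ∈ Icc 0 (G.len e)) : 0 ≤ u e x := by
  have : Nonempty E := ⟨e⟩
  have hmin : ∀ e, ∃ x ∈ Icc 0 (G.len e), IsMinOn (u e) (Icc 0 (G.len e)) x := fun e =>
    isCompact_Icc.exists_isMinOn (nonempty_Icc.2 (G.len_pos e).le) (h.continuous e).continuousOn
  choose z hz hzmin using hmin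
  obtain ⟨e₀, he₀⟩ := Finite.exists_min fun e => u e (z e)
  have hle : ∀ e, ∀ y ∈ Icc 0 (G.len e), u e₀ (z e₀) ≤ u e y := fun e y hy =>
    (he₀ e).trans (hzmin e hy)
  refine le_trans ?_ (hle e x hx)
  by_contra! hlt
  have hconvex := second_deriv_nonneg_of_isMinOn_Icc (G.len_pos e₀) (hzmin e₀) (hz e₀)
    (h.hasDerivAt e₀) (h.deriv_eq_zero_of_forall_le hle (hz e₀) rfl)
    (h.hasDerivAt_deriv e₀ _ (hz e₀))
  linarith [hneg e₀ _ (hz e₀) hlt]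

lemma eq_zero_of_eq_zero_of_deriv_eq_zero (hN : ContDiff ℝ 1 N) (hN0 : N 0 = 0) {e : E} {x : ℝ}
    (hx : x ∈ Icc 0 (G.len e)) (hux : u e x = 0) (hdux : du e x = 0) :
    ∀ y ∈ Icc 0 (G.len e), u e y = 0 := by
  set F : ℝ × ℝ → ℝ × ℝ := fun z => (z.2, lam * z.1 - N z.1) with hF
  have hcont : ContinuousOn (fun y => (u e y, du e y)) (Icc 0 (G.len e)) :=
    (h.continuous e).continuousOn.prodMk (h.continuousOn_deriv e)
  obtain ⟨R, hR⟩ := isCompact_Icc.exists_bound_of_continuousOn hcont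
  have hFdiff : ContDiff ℝ 1 F :=
    contDiff_snd.prodMk ((contDiff_const.mul contDiff_fst).sub (hN.comp contDiff_fst))
  obtain ⟨K, hK⟩ := hFdiff.contDiffOn.exists_lipschitzOnWith one_ne_zero
    (convex_closedBall (0 : ℝ × ℝ) R) (isCompact_closedBall _ _)
  have hF0 : F 0 = 0 := Prod.ext rfl (by simp [hF, hN0])
  have hR0 : 0 ≤ R := (norm_nonneg _).trans (hR x hx)
  have heq := eqOn_Icc_of_hasDerivAt_of_lipschitzOnWith hK hx (z := fun _ => 0)
    (fun y hy => (h.hasDerivAt e y).prodMk (h.hasDerivAt_deriv e y hy))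
    (fun y hy => mem_closedBall_zero_iff.2 (hR y hy))
    (fun y _ => hF0.symm ▸ hasDerivAt_const y (0 : ℝ × ℝ))
    (fun _ _ => mem_closedBall_zero_iff.2 (by simpa using hR0)) (by simp [hux, hdux])
  exact fun y hy => congrArg Prod.fst (heq hy)

lemma pos (hG : G.Connected) (hN : ContDiff ℝ 1 N) (hN0 : N 0 = 0)
    (hneg : ∀ e, ∀ x ∈ Icc 0 (G.len e), u e x < 0 → lam * u e x < N (u e x))
    (hne : ∃ e, ∃ x ∈ Icc 0 (G.len e), u e x ≠ 0) (e : E) {x : ℝ} (hx : x ∈ Icc 0 (G.len e)) :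
    0 < u e x := by
  have hnn : ∀ e, ∀ x ∈ Icc 0 (G.len e), 0 ≤ u e x := fun e x hx => h.nonneg hneg e hx
  have hzero : ∀ e, ∀ x ∈ Icc 0 (G.len e), u e x = 0 → ∀ y ∈ Icc 0 (G.len e), u e y = 0 :=
    fun e x hx hux => h.eq_zero_of_eq_zero_of_deriv_eq_zero hN hN0 hx hux
      (h.deriv_eq_zero_of_forall_le hnn hx hux)
  obtain ⟨c, hc⟩ := h.exists_vertex
  have h0 : ∀ e, (0 : ℝ) ∈ Icc 0 (G.len e) := fun e => left_mem_Icc.2 (G.len_pos e).le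
  have hl : ∀ e, G.len e ∈ Icc 0 (G.len e) := fun e => right_mem_Icc.2 (G.len_pos e).le
  refine (hnn e x hx).lt_of_ne fun hux => ?_
  have hc0 : c (G.src e) = 0 := (hc e).1.symm.trans (hzero e x hx hux.symm 0 (h0 e))
  have hadj : ∀ v w, (SimpleGraph.fromRel fun v w : V => ∃ e, G.src e = v ∧ G.tgt e = w).Adj v w →
      c v = 0 → c w = 0 := by
    rintro v w ⟨-, ⟨e, rfl, rfl⟩ | ⟨e, rfl, rfl⟩⟩ hv
    · exact (hc e).2.symm.trans (hzero e 0 (h0 e) ((hc e).1.trans hv) _ (hl e))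
    · exact (hc e).1.symm.trans (hzero e _ (hl e) ((hc e).2.trans hv) _ (h0 e))
  have hall : ∀ v, c v = 0 := fun v => by
    have hreach := SimpleGraph.reachable_iff_reflTransGen _ _ |>.1 (hG.preconnected (G.src e) v)
    induction hreach with
    | refl => exact hc0
    | tail _ hvw ih => exact hadj _ _ hvw ih
  obtain ⟨e', y, hy, hy0⟩ := hne
  exact hy0 (hzero e' 0 (h0 e') ((hc e').1.trans (hall _)) y hy)

end MetricGraph.IsClassicalSolution

/-! ### Gluing half-edges -/

/-- The function `x ↦ Λ f(μ x)`. -/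
def rescale (Λ μ : ℝ) (f : ℝ → ℝ) (x : ℝ) : ℝ := Λ * f (μ * x)

lemma hasDerivAt_rescale {f : ℝ → ℝ} {d x : ℝ} (Λ μ : ℝ) (h : HasDerivAt f d (μ * x)) :
    HasDerivAt (rescale Λ μ f) (Λ * μ * d) x := by
  have hμ : HasDerivAt (fun y => μ * y) μ x := by simpa using (hasDerivAt_id x).const_mul μ
  exact ((h.comp x hμ).const_mul Λ).congr_deriv (by ring)

lemma hasDerivAt_ite_le {f g : ℝ → ℝ} {f' g' a x : ℝ} (hf : x ≤ a → HasDerivAt f f' x)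
    (hg : a ≤ x → HasDerivAt g g' x) (h : f a = g a) (h' : x = a → f' = g') :
    HasDerivAt (fun y => if y ≤ a then f y else g y) (if x ≤ a then f' else g') x := by
  rcases lt_trichotomy x a with hx | rfl | hx
  · rw [if_pos hx.le]
    refine (hf hx.le).congr_of_eventuallyEq ?_
    filter_upwards [Iio_mem_nhds hx] with y hy using if_pos hy.le
  · rw [if_pos le_rfl, ← hasDerivWithinAt_univ, ← Iic_union_Ici (a := x)]
    have hfx : HasDerivWithinAt (fun y => if y ≤ x then f y else g y) f' (Iic x) x :=
      (hf le_rfl).hasDerivWithinAt.congr (fun y hy => if_pos hy) (if_pos le_rfl)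
    refine hfx.union ?_
    have hgx : HasDerivWithinAt g f' (Ici x) x := h' rfl ▸ (hg le_rfl).hasDerivWithinAt
    refine hgx.congr (fun y hy => ?_) ((if_pos le_rfl).trans h)
    rcases (mem_Ici.1 hy).eq_or_lt with rfl | hy
    · exact (if_pos le_rfl).trans h
    · exact if_neg hy.not_ge
  · rw [if_neg hx.not_ge]
    refine (hg hx.le).congr_of_eventuallyEq ?_
    filter_upwards [Ioi_mem_nhds hx] with y hy using if_neg (mem_Ioi.1 hy).not_ge

namespace MetricGraph

variable {V E : Type*} (G : MetricGraph V E)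

section Glue

variable {σ : ℝ} {w dw : E × Bool → ℝ → ℝ} {e : E} {x : ℝ}

/-- The function on the graph which is `w (e, false)` on the half of the edge `e` next to `src e`
and `σ w (e, true)` on the half next to `tgt e`, both in terms of the distance to the vertex. One
takes `σ = 1` for functions and `σ = -1` for their derivatives. -/
def glue (σ : ℝ) (w : E × Bool → ℝ → ℝ) (e : E) (x : ℝ) : ℝ :=
  if x ≤ G.len e / 2 then w (e, false) x else σ * w (e, true) (G.len e - x)

variable (σ w e) in
@[simp]
lemma glue_zero : G.glue σ w e 0 = w (e, false) 0 :=
  if_pos (half_pos (G.len_pos e)).le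

variable (σ w e) in
@[simp]
lemma glue_len : G.glue σ w e (G.len e) = σ * w (e, true) 0 := by
  rw [glue, if_neg (half_lt_self (G.len_pos e)).not_ge, sub_self]

lemma hasDerivAt_glue (h₀ : x ≤ G.len e / 2 → HasDerivAt (w (e, false)) (dw (e, false) x) x)
    (h₁ : G.len e - x ≤ G.len e / 2 →
      HasDerivAt (w (e, true)) (dw (e, true) (G.len e - x)) (G.len e - x))
    (hw : w (e, false) (G.len e / 2) = σ * w (e, true) (G.len e / 2))
    (hdw : dw (e, false) (G.len e / 2) = -(σ * dw (e, true) (G.len e / 2))) :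
    HasDerivAt (G.glue σ w e) (G.glue (-σ) dw e x) x := by
  refine hasDerivAt_ite_le (g := fun y => σ * w (e, true) (G.len e - y)) h₀ (fun hx => ?_) ?_ ?_
  · exact (((h₁ (by linarith)).comp_const_sub (G.len e) x).const_mul σ).congr_deriv (by ring)
  · simpa only [sub_half] using hw
  · rintro rfl
    simpa only [sub_half, neg_mul] using hdw

end Glue

/-- On the halves of the edges, the functions `w` and `dw` are at distance at most `K Λ exp (-d μ)`
and `K Λ μ exp (-d μ)` of the rescaled profiles and of their derivatives. -/
def IsNear {N : ℝ → ℝ} (P : E × Bool → Profile N) (d K Λ μ : ℝ) (w dw : E × Bool → ℝ → ℝ) : Prop :=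
  ∀ s, ∀ x ∈ Icc 0 (G.len s.1 / 2),
    |w s x - rescale Λ μ (P s).U x| ≤ K * (Λ * Real.exp (-(d * μ))) ∧
    |dw s x - rescale (Λ * μ) μ (P s).dU x| ≤ K * (Λ * μ * Real.exp (-(d * μ)))

section HalfEdges

/-- The vertex of the half-edge `(e, b)`: the end `tgt e` of `e` if `b` is true, the end `src e`
otherwise. -/
def halfVert (s : E × Bool) : V := if s.2 then G.tgt s.1 else G.src s.1

lemma degree_eq_card_halfVert [Finite E] (v : V) :
    G.degree v = Nat.card {s : E × Bool // G.halfVert s = v} := by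
  rw [degree, add_comm, ← Nat.card_sum]
  refine Nat.card_congr
    { toFun := Sum.elim (fun e => ⟨(e, true), e.2⟩) fun e => ⟨(e, false), e.2⟩
      invFun := fun
        | ⟨(e, true), h⟩ => Sum.inl ⟨e, h⟩
        | ⟨(e, false), h⟩ => Sum.inr ⟨e, h⟩
      left_inv := ?_
      right_inv := ?_ }
  · rintro (e | e) <;> rfl
  · rintro ⟨⟨e, _ | _⟩, h⟩ <;> rfl

lemma eq_of_degree_eq_one [Finite E] {v : V} (h : G.degree v = 1) {s s' : E × Bool}
    (hs : G.halfVert s = v) (hs' : G.halfVert s' = v) : s' = s := by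
  rw [degree_eq_card_halfVert, Nat.card_eq_one_iff_unique] at h
  have := h.1
  exact congrArg Subtype.val
    (Subsingleton.elim (⟨s', hs'⟩ : {s // G.halfVert s = v}) ⟨s, hs⟩)

/-- The half-edges of a metric graph, with peaks at the vertices of a set `T` of vertices of degree
one. -/
def halfEdges [Finite E] (T : Set V) (hT : ∀ v ∈ T, G.degree v = 1) : HalfEdges (E × Bool) V where
  vert := G.halfVert
  bar s := (s.1, !s.2)
  bar_bar s := by simp
  peaks := {s | G.halfVert s ∈ T}
  eq_of_mem_peaks _ _ hs hss' := G.eq_of_degree_eq_one (hT _ hs) rfl hss'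

variable {G} [Fintype E] [DecidableEq V] {T : Set V} {hT : ∀ v ∈ T, G.degree v = 1} {N : ℝ → ℝ}

lemma isClassicalSolution_glue {Λ μ : ℝ} (hμ : 0 < μ) (hN : ∀ y, N (Λ * y) = Λ * (μ ^ 2 * N y))
    {w dw : E × Bool → ℝ → ℝ}
    (h : (G.halfEdges T hT).IsSolution N (fun s => μ * (G.len s.1 / 2)) w dw) :
    G.IsClassicalSolution N (μ ^ 2) (G.glue 1 fun s => rescale Λ μ (w s))
      (G.glue (-1) fun s => rescale (Λ * μ) μ (dw s)) where
  hasDerivAt e x := by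
    have hmid := h.midpoint_eq (e, false)
    have hmid' := h.midpoint_deriv_eq (e, false)
    simp only [halfEdges, Bool.not_false] at hmid hmid'
    exact G.hasDerivAt_glue (fun _ => hasDerivAt_rescale _ _ (h.hasDerivAt _ _))
      (fun _ => hasDerivAt_rescale _ _ (h.hasDerivAt _ _)) (by simp only [rescale, hmid, one_mul])
      (by simp only [rescale, hmid', one_mul, mul_neg])
  hasDerivAt_deriv e x hx := by
    have hmid := h.midpoint_eq (e, false)
    have hmid' := h.midpoint_deriv_eq (e, false)
    simp only [halfEdges, Bool.not_false] at hmid hmid'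
    have hderiv : ∀ b, ∀ y ∈ Icc 0 (G.len e), y ≤ G.len e / 2 →
        HasDerivAt (rescale (Λ * μ) μ (dw (e, b))) (μ ^ 2 * rescale Λ μ (w (e, b)) y -
          N (rescale Λ μ (w (e, b)) y)) y := fun b y hy hy' => by
      refine (hasDerivAt_rescale _ _ (h.hasDerivAt_deriv (e, b) (μ * y)
        ⟨mul_nonneg hμ.le hy.1, mul_le_mul_of_nonneg_left hy' hμ.le⟩)).congr_deriv ?_
      rw [rescale, hN]
      ring
    refine (G.hasDerivAt_glue (dw := fun s y => μ ^ 2 * rescale Λ μ (w s) y -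
      N (rescale Λ μ (w s) y)) (hderiv false x hx)
      (hderiv true (G.len e - x) ⟨by linarith [hx.2], by linarith [hx.1]⟩) ?_ ?_).congr_deriv ?_
    · simp only [rescale, hmid', neg_mul, one_mul, mul_neg]
    · simp only [rescale, hmid, neg_mul, one_mul, neg_neg]
    · simp only [glue]
      split_ifs <;> simp
  exists_vertex := by
    have hext : ∀ s, Function.extend G.halfVert (fun s => Λ * w s 0) 0 (G.halfVert s) = Λ * w s 0 :=
      Function.FactorsThrough.extend_apply (f := G.halfVert) (g := fun s => Λ * w s 0)
        (fun s s' hs => congrArg (Λ * ·) (h.vertex_eq hs)) 0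
    exact ⟨_, fun e => ⟨by simpa [rescale, halfVert] using (hext (e, false)).symm,
      by simpa [rescale, halfVert] using (hext (e, true)).symm⟩⟩
  kirchhoff v := by
    have hsum := h.sum_deriv_eq_zero v
    rw [Finset.sum_filter, Fintype.sum_prod_type] at hsum
    have hscale := congrArg (Λ * μ * ·) hsum
    simp only [Finset.mul_sum, mul_zero] at hscale
    refine (Finset.sum_congr rfl fun e _ => ?_).trans hscale
    simp [halfEdges, halfVert, rescale, add_comm]

theorem exists_isClassicalSolution_glue (hN : ContDiff ℝ 1 N) {P : E × Bool → Profile N} {C : ℝ}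
    (hC : 1 ≤ C) (hP : ∀ s, (P s).IsDecaying C) (hPT : (G.halfEdges T hT).IsCompatible P) {d : ℝ}
    (hd : 0 < d) (hdG : ∀ e, d ≤ G.len e / 2) :
    ∃ K, ∀ᶠ μ in atTop, ∀ Λ, 0 ≤ Λ → (∀ y, N (Λ * y) = Λ * (μ ^ 2 * N y)) →
      ∃ w dw : E × Bool → ℝ → ℝ, (∀ s, Continuous (w s)) ∧
        G.IsClassicalSolution N (μ ^ 2) (G.glue 1 w) (G.glue (-1) dw) ∧
        G.IsNear P d K Λ μ w dw := by
  obtain ⟨K, m₀, H⟩ := (G.halfEdges T hT).exists_isSolution hN hC hP hPT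
  refine ⟨K, ?_⟩
  filter_upwards [eventually_gt_atTop 0, eventually_ge_atTop (m₀ / d)] with μ hμ hμm Λ hΛ hNΛ
  obtain ⟨w, dw, hw, hwP⟩ := H (fun s => μ * (G.len s.1 / 2)) (d * μ) ((div_le_iff₀' hd).1 hμm)
    (fun s => by rw [mul_comm]; exact mul_le_mul_of_nonneg_left (hdG s.1) hμ.le)
  have hscale : ∀ {A a b B : ℝ}, 0 ≤ A → |a - b| ≤ K * B → |A * a - A * b| ≤ K * (A * B) :=
    fun hA hab => by
      rw [← mul_sub, abs_mul, abs_of_nonneg hA, mul_left_comm]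
      exact mul_le_mul_of_nonneg_left hab hA
  refine ⟨_, _, fun s => continuous_iff_continuousAt.2 fun x =>
    (hasDerivAt_rescale Λ μ (hw.hasDerivAt s (μ * x))).continuousAt,
    isClassicalSolution_glue hμ hNΛ hw, fun s x hx => ?_⟩
  obtain ⟨hU, hdU⟩ := hwP s (μ * x)
    ⟨mul_nonneg hμ.le hx.1, mul_le_mul_of_nonneg_left hx.2 hμ.le⟩
  exact ⟨hscale hΛ hU, hscale (mul_nonneg hΛ hμ.le) hdU⟩

end HalfEdges

end MetricGraph

/-! ### Cut-off profiles -/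

namespace Profile

variable {N : ℝ → ℝ} (P : Profile N) (χ : ℝ → ℝ) (Λ μ : ℝ)

/-- The rescaled profile multiplied by a cut-off function. -/
def cut (x : ℝ) : ℝ := χ x * rescale Λ μ P.U x

/-- The derivative of the rescaled profile multiplied by a cut-off function. -/
def dcut (x : ℝ) : ℝ := deriv χ x * rescale Λ μ P.U x + χ x * rescale (Λ * μ) μ P.dU x

variable {P χ Λ μ}

lemma hasDerivAt_cut (hχ : ContDiff ℝ ∞ χ) (x : ℝ) : HasDerivAt (P.cut χ Λ μ) (P.dcut χ Λ μ x) x :=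
  (hχ.differentiable (by simp) x).hasDerivAt.mul (hasDerivAt_rescale Λ μ (P.hasDerivAt_U _))

lemma continuous_dcut (hχ : ContDiff ℝ ∞ χ) : Continuous (P.dcut χ Λ μ) := by
  have hU := P.continuous_U
  have hdU : Continuous P.dU :=
    continuous_iff_continuousAt.2 fun x => (P.hasDerivAt_dU x).continuousAt
  have hχ₀ := hχ.continuous
  have hχ₁ := hχ.continuous_deriv (by simp)
  unfold dcut rescale
  fun_prop

lemma abs_rescale_le {f : ℝ → ℝ} {C d x : ℝ} (hC : 0 ≤ C) (hΛ : 0 ≤ Λ) (hμ : 0 ≤ μ)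
    (hf : ∀ x, 0 ≤ x → |f x| ≤ C * Real.exp (-x)) (hd : 0 ≤ d) (hx : d ≤ x) :
    |rescale Λ μ f x| ≤ C * (Λ * Real.exp (-(d * μ))) := by
  have hexp : Real.exp (-(μ * x)) ≤ Real.exp (-(d * μ)) := by
    rw [Real.exp_le_exp, neg_le_neg_iff, mul_comm]
    exact mul_le_mul_of_nonneg_left hx hμ
  calc |rescale Λ μ f x| = Λ * |f (μ * x)| := by rw [rescale, abs_mul, abs_of_nonneg hΛ]
    _ ≤ Λ * (C * Real.exp (-(d * μ))) := by
      gcongr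
      exact (hf _ (mul_nonneg hμ (hd.trans hx))).trans (by gcongr)
    _ = C * (Λ * Real.exp (-(d * μ))) := by ring

end Profile

lemma IsCutoff.deriv_eq_zero {δ : ℝ} {χ : ℝ → ℝ} (hχ : IsCutoff δ χ) {x : ℝ} (h0 : 0 ≤ x)
    (hx : x < δ / 2) : deriv χ x = 0 := by
  have hconst : HasDerivWithinAt χ 0 (Icc x (δ / 2)) x :=
    (hasDerivWithinAt_const x _ (1 : ℝ)).congr (fun y hy => hχ.2.1 y (h0.trans hy.1) hy.2)
      (hχ.2.1 x h0 hx.le)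
  exact (uniqueDiffOn_Icc hx x ⟨le_rfl, hx.le⟩).eq_deriv _
    (hχ.1.differentiable (by simp) x).hasDerivAt.hasDerivWithinAt hconst

namespace Profile.IsDecaying

variable {N : ℝ → ℝ} {P : Profile N} {C d δ : ℝ} {χ : ℝ → ℝ}

lemma eventually_abs_cut_le (hP : P.IsDecaying C) (hC : 0 ≤ C) (hχ : IsCutoff δ χ) (hd : 0 ≤ d)
    (L : ℝ) : ∀ᶠ D in atTop, ∀ Λ μ x, 0 ≤ Λ → 1 ≤ μ → d ≤ x → x ≤ L →
      |P.cut χ Λ μ x| ≤ D * (Λ * Real.exp (-(d * μ))) ∧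
      |P.dcut χ Λ μ x| ≤ D * (Λ * μ * Real.exp (-(d * μ))) := by
  obtain ⟨A, hA⟩ := (isCompact_Icc (a := d) (b := L)).exists_bound_of_continuousOn
    hχ.1.continuous.continuousOn
  obtain ⟨A', hA'⟩ := (isCompact_Icc (a := d) (b := L)).exists_bound_of_continuousOn
    (hχ.1.continuous_deriv (by simp)).continuousOn
  filter_upwards [eventually_ge_atTop (A * C), eventually_ge_atTop (A' * C + A * C)]
    with D hD hD' Λ μ x hΛ hμ hdx hxL
  have hμ0 : 0 ≤ μ := zero_le_one.trans hμ
  have hχx : |χ x| ≤ A := hA x ⟨hdx, hxL⟩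
  have hχ'x : |deriv χ x| ≤ A' := hA' x ⟨hdx, hxL⟩
  have hU := abs_rescale_le hC hΛ hμ0 hP.U_le hd hdx
  have hdU := abs_rescale_le hC (mul_nonneg hΛ hμ0) hμ0 hP.dU_le hd hdx
  have hA0 : 0 ≤ A := (abs_nonneg _).trans hχx
  have hA'0 : 0 ≤ A' := (abs_nonneg _).trans hχ'x
  have hΛμ : Λ ≤ Λ * μ := le_mul_of_one_le_right hΛ hμ
  constructor
  · calc |P.cut χ Λ μ x| = |χ x| * |rescale Λ μ P.U x| := abs_mul _ _
      _ ≤ A * (C * (Λ * Real.exp (-(d * μ)))) := by gcongr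
      _ = A * C * (Λ * Real.exp (-(d * μ))) := by ring
      _ ≤ _ := by gcongr
  · calc |P.dcut χ Λ μ x|
        ≤ |deriv χ x| * |rescale Λ μ P.U x| + |χ x| * |rescale (Λ * μ) μ P.dU x| := by
          rw [← abs_mul, ← abs_mul]
          exact abs_add_le _ _
      _ ≤ A' * (C * (Λ * μ * Real.exp (-(d * μ)))) + A * (C * (Λ * μ * Real.exp (-(d * μ)))) := by
          gcongr
          exact hU.trans (by gcongr)
      _ = (A' * C + A * C) * (Λ * μ * Real.exp (-(d * μ))) := by ring
      _ ≤ _ := by gcongr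

lemma eventually_abs_rescale_sub_cut_le (hP : P.IsDecaying C) (hC : 0 ≤ C) (hχ : IsCutoff δ χ)
    (hd : 0 ≤ d) (hdδ : d < δ / 2) (L : ℝ) : ∀ᶠ D in atTop, ∀ Λ μ x, 0 ≤ Λ → 1 ≤ μ → x ∈ Icc 0 L →
      |rescale Λ μ P.U x - P.cut χ Λ μ x| ≤ D * (Λ * Real.exp (-(d * μ))) ∧
      |rescale (Λ * μ) μ P.dU x - P.dcut χ Λ μ x| ≤ D * (Λ * μ * Real.exp (-(d * μ))) := by
  filter_upwards [(tendsto_atTop_add_const_right atTop (-C) tendsto_id).eventually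
    (hP.eventually_abs_cut_le hC hχ hd L), eventually_ge_atTop 0] with D hD hD0 Λ μ x hΛ hμ hx
  have hμ0 : 0 ≤ μ := zero_le_one.trans hμ
  rcases le_or_gt x d with hxd | hxd
  · rw [cut, dcut, hχ.2.1 x hx.1 (hxd.trans hdδ.le), hχ.deriv_eq_zero hx.1 (hxd.trans_lt hdδ)]
    simp only [one_mul, zero_mul, zero_add, sub_self, abs_zero]
    constructor <;> positivity
  · obtain ⟨hcut, hdcut⟩ := hD Λ μ x hΛ hμ hxd.le hx.2
    have hU := abs_rescale_le hC hΛ hμ0 hP.U_le hd hxd.le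
    have hdU := abs_rescale_le hC (mul_nonneg hΛ hμ0) hμ0 hP.dU_le hd hxd.le
    exact ⟨((abs_sub _ _).trans (add_le_add hU hcut)).trans_eq (by simp only [id]; ring),
      ((abs_sub _ _).trans (add_le_add hdU hdcut)).trans_eq (by simp only [id]; ring)⟩

end Profile.IsDecaying

namespace MetricGraph

variable {V E : Type*} (G : MetricGraph V E)

/-- The sum of the functions `w (e, false)`, in terms of the distance to `src e`, and
`σ w (e, true)`, in terms of the distance to `tgt e`. One takes `σ = 1` for functions and `σ = -1`
for their derivatives. -/
def superpose (σ : ℝ) (w : E × Bool → ℝ → ℝ) (e : E) (x : ℝ) : ℝ :=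
  w (e, false) x + σ * w (e, true) (G.len e - x)

lemma hasDerivAt_superpose {σ : ℝ} {w dw : E × Bool → ℝ → ℝ}
    (h : ∀ s x, HasDerivAt (w s) (dw s x) x) (e : E) (x : ℝ) :
    HasDerivAt (G.superpose σ w e) (G.superpose (-σ) dw e x) x :=
  ((h _ x).add (((h _ _).comp_const_sub (G.len e) x).const_mul σ)).congr_deriv
    (by simp only [superpose]; ring)

lemma abs_glue_le {σ B : ℝ} (hσ : |σ| = 1) {w : E × Bool → ℝ → ℝ}
    (hw : ∀ s, ∀ x ∈ Icc 0 (G.len s.1 / 2), |w s x| ≤ B) {e : E} {x : ℝ}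
    (hx : x ∈ Icc 0 (G.len e)) : |G.glue σ w e x| ≤ B := by
  unfold glue
  split_ifs with h
  · exact hw (e, false) x ⟨hx.1, h⟩
  · rw [abs_mul, hσ, one_mul]
    exact hw (e, true) _ ⟨sub_nonneg.2 hx.2, by linarith [not_le.1 h]⟩

lemma abs_glue_sub_superpose_le {σ B B' : ℝ} (hσ : σ * σ = 1) {w a : E × Bool → ℝ → ℝ}
    (hnear : ∀ s, ∀ x ∈ Icc 0 (G.len s.1 / 2), |w s x - a s x| ≤ B)
    (hfar : ∀ s, ∀ x ∈ Icc (G.len s.1 / 2) (G.len s.1), |a s x| ≤ B') {e : E} {x : ℝ}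
    (hx : x ∈ Icc 0 (G.len e)) : |G.glue σ w e x - G.superpose σ a e x| ≤ B + B' := by
  have hσ' : |σ| = 1 := by
    rcases mul_self_eq_one_iff.1 hσ with rfl | rfl <;> simp
  have hdiff : G.glue σ w e x - G.superpose σ a e x = G.glue σ
      (fun s y => w s y - a s y - σ * a (s.1, !s.2) (G.len s.1 - y)) e x := by
    simp only [glue, superpose, Bool.not_false, Bool.not_true, sub_sub_cancel]
    split_ifs
    · ring
    · linear_combination a (e, false) x * hσ
  rw [hdiff]
  refine G.abs_glue_le hσ' (fun s y hy => ?_) hx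
  refine (abs_sub _ _).trans (add_le_add (hnear s y hy) ?_)
  rw [abs_mul, hσ', one_mul]
  exact hfar (s.1, !s.2) _ ⟨by linarith [hy.2], by linarith [hy.1]⟩

/-- The difference between the glued function and the sum of the cut-off rescaled profiles. -/
def remainder {N : ℝ → ℝ} (P : E × Bool → Profile N) (χ : E × Bool → ℝ → ℝ) (Λ μ : ℝ)
    (w : E × Bool → ℝ → ℝ) (e : E) (x : ℝ) : ℝ :=
  G.glue 1 w e x - G.superpose 1 (fun s => (P s).cut (χ s) Λ μ) e x

/-- The derivative of `remainder P χ Λ μ w`, where `dw` is the derivative of `w`. -/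
def dremainder {N : ℝ → ℝ} (P : E × Bool → Profile N) (χ : E × Bool → ℝ → ℝ) (Λ μ : ℝ)
    (dw : E × Bool → ℝ → ℝ) (e : E) (x : ℝ) : ℝ :=
  G.glue (-1) dw e x - G.superpose (-1) (fun s => (P s).dcut (χ s) Λ μ) e x

lemma exists_abs_remainder_le [Finite E] {N : ℝ → ℝ} {P : E × Bool → Profile N}
    {C δ d : ℝ} (hC : 0 ≤ C) (hP : ∀ s, (P s).IsDecaying C) {χ : E × Bool → ℝ → ℝ}
    (hχ : ∀ s, IsCutoff δ (χ s)) (hd : 0 ≤ d) (hdδ : d < δ / 2) (hdG : ∀ e, d ≤ G.len e / 2)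
    (K : ℝ) : ∃ D, 0 ≤ D ∧ ∀ Λ μ w dw, 0 ≤ Λ → 1 ≤ μ → G.IsNear P d K Λ μ w dw →
      ∀ e, ∀ x ∈ Icc 0 (G.len e),
        |G.remainder P χ Λ μ w e x| ≤ D * (Λ * Real.exp (-(d * μ))) ∧
        |G.dremainder P χ Λ μ dw e x| ≤ D * (Λ * μ * Real.exp (-(d * μ))) := by
  obtain ⟨D, ⟨hfar, hnear⟩, hKD⟩ := (((eventually_all.2 fun s =>
    (hP s).eventually_abs_cut_le hC (hχ s) hd (G.len s.1)).and (eventually_all.2 fun s =>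
    (hP s).eventually_abs_rescale_sub_cut_le hC (hχ s) hd hdδ (G.len s.1))).and
    (eventually_ge_atTop (max 0 (-K / 2)))).exists
  obtain ⟨-, hKD⟩ := max_le_iff.1 hKD
  refine ⟨K + 2 * D, by linarith, fun Λ μ w dw hΛ hμ hw e x hx => ?_⟩
  have hhalf : ∀ e, ∀ x ∈ Icc 0 (G.len e / 2), x ∈ Icc 0 (G.len e) := fun e x hx =>
    ⟨hx.1, hx.2.trans (half_le_self (G.len_pos e).le)⟩
  constructor
  · refine (G.abs_glue_sub_superpose_le (B := K * (Λ * Real.exp (-(d * μ))) +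
      D * (Λ * Real.exp (-(d * μ)))) (mul_one 1) (fun s y hy => ?_) (fun s y hy =>
      (hfar s Λ μ y hΛ hμ ((hdG _).trans hy.1) hy.2).1) hx).trans_eq ?_
    · exact (abs_sub_le _ _ _).trans
        (add_le_add (hw s y hy).1 (hnear s Λ μ y hΛ hμ (hhalf _ _ hy)).1)
    · ring
  · refine (G.abs_glue_sub_superpose_le (B := K * (Λ * μ * Real.exp (-(d * μ))) +
      D * (Λ * μ * Real.exp (-(d * μ)))) (by norm_num) (fun s y hy => ?_) (fun s y hy =>
      (hfar s Λ μ y hΛ hμ ((hdG _).trans hy.1) hy.2).2) hx).trans_eq ?_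
    · exact (abs_sub_le _ _ _).trans
        (add_le_add (hw s y hy).2 (hnear s Λ μ y hΛ hμ (hhalf _ _ hy)).2)
    · ring

end MetricGraph

/-! ### Norms and regularity on the graph -/

lemma contDiffOn_two_of_hasDerivAt {f f' f'' : ℝ → ℝ} {a b : ℝ} (hab : a < b)
    (hf : ∀ x ∈ Icc a b, HasDerivAt f (f' x) x) (hf' : ∀ x ∈ Icc a b, HasDerivAt f' (f'' x) x)
    (hf'' : ContinuousOn f'' (Icc a b)) : ContDiffOn ℝ 2 f (Icc a b) := by
  have hU := uniqueDiffOn_Icc hab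
  have hderiv : ∀ {g g' : ℝ → ℝ}, (∀ x ∈ Icc a b, HasDerivAt g (g' x) x) →
      ∀ x ∈ Icc a b, derivWithin g (Icc a b) x = g' x := fun hg x hx =>
    (hg x hx).hasDerivWithinAt.derivWithin (hU x hx)
  have hf'₁ : ContDiffOn ℝ 1 f' (Icc a b) := by
    rw [← zero_add 1, contDiffOn_succ_iff_derivWithin hU]
    exact ⟨fun x hx => (hf' x hx).differentiableAt.differentiableWithinAt, by simp,
      (contDiffOn_zero.2 hf'').congr (hderiv hf')⟩
  rw [← one_add_one_eq_two, contDiffOn_succ_iff_derivWithin hU]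
  exact ⟨fun x hx => (hf x hx).differentiableAt.differentiableWithinAt, by simp,
    hf'₁.congr (hderiv hf)⟩

namespace MetricGraph

variable {V E : Type*} (G : MetricGraph V E) {u du : E → ℝ → ℝ}

lemma memH1_of_hasDerivAt (hu : ∀ e, ∀ x ∈ Icc 0 (G.len e), HasDerivAt (u e) (du e x) x)
    (hdu : ∀ e, ContinuousOn (du e) (Icc 0 (G.len e)))
    (hvert : ∃ c : V → ℝ, ∀ e, u e 0 = c (G.src e) ∧ u e (G.len e) = c (G.tgt e)) : G.MemH1 u :=
  ⟨⟨fun e x hx => (hu e x hx).continuousAt.continuousWithinAt, hvert⟩,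
    fun e => memH1Interval_of_hasDerivAt (G.len_pos e).le (hu e) (hdu e)⟩

variable [Fintype E]

lemma normLam_le {lam D : ℝ} (hlam : 0 ≤ lam) (hD : 0 ≤ D)
    (hu : ∀ e, ∀ x ∈ Icc 0 (G.len e), HasDerivAt (u e) (du e x) x)
    (hdu : ∀ e, ContinuousOn (du e) (Icc 0 (G.len e)))
    (huD : ∀ e, ∀ x ∈ Icc 0 (G.len e), |u e x| ≤ D)
    (hduD : ∀ e, ∀ x ∈ Icc 0 (G.len e), |du e x| ≤ Real.sqrt lam * D) :
    G.normLam lam u ≤ Real.sqrt (2 * ∑ e, G.len e) * (Real.sqrt lam * D) := by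
  have hsum : ∀ {f : E → ℝ → ℝ} {A : ℝ}, (∀ e, ∀ x ∈ Icc 0 (G.len e), |f e x| ≤ A) →
      ∑ e, ∫ x in (0 : ℝ)..G.len e, f e x * f e x ≤ A * A * ∑ e, G.len e := fun {f A} hf => by
    rw [Finset.mul_sum]
    refine Finset.sum_le_sum fun e _ => (Real.le_norm_self _).trans
      ((intervalIntegral.norm_integral_le_of_norm_le_const (C := A * A) fun x hx => ?_).trans_eq ?_)
    · rw [uIoc_of_le (G.len_pos e).le] at hx
      have hfx := hf e x ⟨hx.1.le, hx.2⟩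
      rw [norm_mul]
      exact mul_le_mul hfx hfx (abs_nonneg _) ((abs_nonneg _).trans hfx)
    · rw [sub_zero, abs_of_pos (G.len_pos e)]
  have hderiv : ∑ e, ∫ x in (0 : ℝ)..G.len e,
      weakDeriv (G.len e) (u e) x * weakDeriv (G.len e) (u e) x ≤
        lam * (D * D) * ∑ e, G.len e := by
    rw [Finset.sum_congr rfl fun e _ =>
      integral_weakDeriv_mul_self (G.len_pos e).le (hu e) (hdu e)]
    refine (hsum hduD).trans_eq ?_
    rw [mul_mul_mul_comm, Real.mul_self_sqrt hlam]
  calc G.normLam lam u ≤ Real.sqrt (2 * (∑ e, G.len e) * (lam * (D * D))) := by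
        refine Real.sqrt_le_sqrt ((add_le_add hderiv
          (mul_le_mul_of_nonneg_left (hsum huD) hlam)).trans_eq ?_)
        ring
    _ = _ := by
        rw [Real.sqrt_mul' _ (by positivity), Real.sqrt_mul hlam, Real.sqrt_mul_self hD]

lemma l2Norm_sq (u : E → ℝ → ℝ) : G.l2Norm u ^ 2 = ∑ e, ∫ x in (0 : ℝ)..G.len e, u e x ^ 2 :=
  Real.sq_sqrt <| Finset.sum_nonneg fun e _ =>
    intervalIntegral.integral_nonneg (G.len_pos e).le fun _ _ => sq_nonneg _

lemma l2Norm_pos [Nonempty E] (hu : ∀ e, ContinuousOn (u e) (Icc 0 (G.len e)))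
    (hpos : ∀ e, ∀ x ∈ Icc 0 (G.len e), 0 < u e x) : 0 < G.l2Norm u :=
  Real.sqrt_pos.2 <| Finset.sum_pos (fun e _ => intervalIntegral.intervalIntegral_pos_of_pos_on
    (((hu e).pow 2).intervalIntegrable_of_Icc (G.len_pos e).le)
    (fun x hx => pow_pos (hpos e x (Ioo_subset_Icc_self hx)) 2) (G.len_pos e)) Finset.univ_nonempty

namespace IsClassicalSolution

variable {G} [DecidableEq V] {p lam : ℝ}

lemma isPositiveSolution (h : G.IsClassicalSolution (oddPow p) lam u du) (hp : 1 < p)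
    (hpos : ∀ e, ∀ x ∈ Icc 0 (G.len e), 0 < u e x) :
    G.IsPositiveSolution p lam (G.l2Norm u) u where
  memH1 :=
    G.memH1_of_hasDerivAt (fun e x _ => h.hasDerivAt e x) h.continuousOn_deriv h.exists_vertex
  contDiffOn e := contDiffOn_two_of_hasDerivAt (G.len_pos e) (fun x _ => h.hasDerivAt e x)
    (h.hasDerivAt_deriv e) ((continuous_const.mul (h.continuous e)).sub
      ((contDiff_oddPow hp).continuous.comp (h.continuous e))).continuousOn
  equation e x hx := by
    rw [funext fun y => (h.hasDerivAt e y).deriv,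
      (h.hasDerivAt_deriv e x (Ioo_subset_Icc_self hx)).deriv, oddPow]
    ring
  kirchhoff v := by
    have hderiv : ∀ e, ∀ x ∈ Icc 0 (G.len e), derivWithin (u e) (Icc 0 (G.len e)) x = du e x :=
      fun e x hx => (h.hasDerivAt e x).hasDerivWithinAt.derivWithin
        (uniqueDiffOn_Icc (G.len_pos e) x hx)
    refine (Finset.sum_congr rfl fun e _ => ?_).trans (h.kirchhoff v)
    rw [hderiv e 0 (left_mem_Icc.2 (G.len_pos e).le),
      hderiv e _ (right_mem_Icc.2 (G.len_pos e).le)]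
  mass := rfl
  pos := hpos

/-- Near nonnegative profiles the values exceed `-Λ`, and at a negative minimum with such a value
the nonlinearity is too weak for the equation to hold. -/
lemma pos_of_isNear {N : ℝ → ℝ} {P : E × Bool → Profile N} {d K Λ μ : ℝ}
    {w dw : E × Bool → ℝ → ℝ}
    (h : G.IsClassicalSolution (oddPow p) (Λ ^ (p - 1)) (G.glue 1 w) (G.glue (-1) dw))
    (hG : G.Connected) (hp : 1 < p) (hΛ : 0 < Λ) (hw : G.IsNear P d K Λ μ w dw)
    (hP : ∀ s x, 0 ≤ (P s).U x) (hK : K * Real.exp (-(d * μ)) < 1)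
    (hPK : ∃ s, K * Real.exp (-(d * μ)) < (P s).U 0) (e : E) {x : ℝ} (hx : x ∈ Icc 0 (G.len e)) :
    0 < G.glue 1 w e x := by
  have hlow : ∀ s, ∀ x ∈ Icc 0 (G.len s.1 / 2),
      Λ * ((P s).U (μ * x) - K * Real.exp (-(d * μ))) ≤ w s x := fun s x hx => by
    have hws := (abs_le.1 (hw s x hx).1).1
    rw [rescale] at hws
    linarith
  have hw1 : ∀ s, ∀ x ∈ Icc 0 (G.len s.1 / 2), -Λ < w s x := fun s x hx => by
    refine lt_of_lt_of_le ?_ (hlow s x hx)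
    rw [← mul_neg_one]
    exact mul_lt_mul_of_pos_left (by linarith [hP s (μ * x)]) hΛ
  refine h.pos hG (contDiff_oddPow hp) (oddPow_zero p) (fun e x hx hneg => ?_) ?_ e hx
  · have hglue : -Λ < G.glue 1 w e x := by
      unfold glue
      split_ifs with hxe
      · exact hw1 (e, false) x ⟨hx.1, hxe⟩
      · rw [one_mul]
        exact hw1 (e, true) _ ⟨sub_nonneg.2 hx.2, by linarith [not_le.1 hxe]⟩
    refine mul_lt_mul_of_neg_right (Real.rpow_lt_rpow (abs_nonneg _) ?_ (sub_pos.2 hp)) hneg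
    rwa [abs_of_neg hneg, neg_lt]
  · obtain ⟨⟨e, b⟩, hs⟩ := hPK
    have hw0 : 0 < w (e, b) 0 := by
      refine lt_of_lt_of_le ?_ (hlow (e, b) 0 (left_mem_Icc.2 (half_pos (G.len_pos e)).le))
      rw [mul_zero]
      exact mul_pos hΛ (sub_pos.2 hs)
    refine ⟨e, ?_⟩
    cases b
    · exact ⟨0, left_mem_Icc.2 (G.len_pos e).le, by simpa using hw0.ne'⟩
    · exact ⟨G.len e, right_mem_Icc.2 (G.len_pos e).le, by simpa using hw0.ne'⟩

end IsClassicalSolution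

end MetricGraph

/-! ### The mass -/

lemma abs_integral_sq_sub_le {f g : ℝ → ℝ} {a A B : ℝ} (ha : 0 ≤ a) (hf : Continuous f)
    (hg : Continuous g) (hgA : ∀ x ∈ Icc 0 a, |g x| ≤ A) (hfg : ∀ x ∈ Icc 0 a, |f x - g x| ≤ B) :
    |(∫ x in (0 : ℝ)..a, f x ^ 2) - ∫ x in (0 : ℝ)..a, g x ^ 2| ≤ B * (B + 2 * A) * a := by
  rw [← intervalIntegral.integral_sub (f := fun x => f x ^ 2) (g := fun x => g x ^ 2)
    ((hf.pow 2).intervalIntegrable _ _) ((hg.pow 2).intervalIntegrable _ _)]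
  suffices h : ∀ x ∈ uIoc 0 a, ‖f x ^ 2 - g x ^ 2‖ ≤ B * (B + 2 * A) by
    simpa only [Real.norm_eq_abs, sub_zero, abs_of_nonneg ha] using
      intervalIntegral.norm_integral_le_of_norm_le_const h
  intro x hx
  rw [uIoc_of_le ha] at hx
  have hB := hfg x ⟨hx.1.le, hx.2⟩
  have hsum : |f x + g x| ≤ B + 2 * A := by
    calc |f x + g x| = |(f x - g x) + 2 * g x| := by ring_nf
      _ ≤ |f x - g x| + |2 * g x| := abs_add_le _ _
      _ ≤ B + 2 * A := by
        rw [abs_mul, abs_two]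
        linarith [hgA x ⟨hx.1.le, hx.2⟩]
  rw [Real.norm_eq_abs, sq_sub_sq, mul_comm, abs_mul]
  exact mul_le_mul hB hsum (abs_nonneg _) ((abs_nonneg _).trans hB)

lemma integral_rescale_sq (Λ : ℝ) {μ : ℝ} (hμ : μ ≠ 0) (f : ℝ → ℝ) (a : ℝ) :
    ∫ x in (0 : ℝ)..a, rescale Λ μ f x ^ 2 = Λ ^ 2 / μ * ∫ x in (0 : ℝ)..μ * a, f x ^ 2 := by
  simp only [rescale, mul_pow Λ]
  rw [intervalIntegral.integral_const_mul,
    intervalIntegral.integral_comp_mul_left (fun y => f y ^ 2) hμ, mul_zero, smul_eq_mul]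
  ring

lemma isLittleO_integral_sq_sub {ι : Type*} {l : Filter ι} {f : ℝ → ℝ} {Λ μ : ι → ℝ}
    {w : ι → ℝ → ℝ} {a d A K : ℝ} (hf : Continuous f)
    (hf2 : IntegrableOn (fun x => f x ^ 2) (Ioi 0)) (hfA : ∀ x, 0 ≤ x → |f x| ≤ A) (ha : 0 < a)
    (hd : 0 < d) (hμ : Tendsto μ l atTop)
    (hw : ∀ᶠ i in l, 0 ≤ Λ i ∧ Continuous (w i) ∧ ∀ x ∈ Icc 0 a,
      |w i x - rescale (Λ i) (μ i) f x| ≤ K * (Λ i * Real.exp (-(d * μ i)))) :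
    (fun i => (∫ x in (0 : ℝ)..a, w i x ^ 2) - (∫ x in Ioi (0 : ℝ), f x ^ 2) * (Λ i ^ 2 / μ i))
      =o[l] fun i => Λ i ^ 2 / μ i := by
  have hscale := isBigO_refl (fun i => Λ i ^ 2 / μ i) l
  have hexp : Tendsto (fun t : ℝ => Real.exp (-(d * t))) atTop (nhds 0) :=
    Real.tendsto_exp_neg_atTop_nhds_zero.comp (tendsto_id.const_mul_atTop hd)
  have hmul_exp : Tendsto (fun t : ℝ => t * Real.exp (-(d * t))) atTop (nhds 0) := by
    simpa using tendsto_rpow_mul_exp_neg_mul_atTop_nhds_zero 1 d hd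
  have herr : Tendsto (fun t : ℝ => K * (t * Real.exp (-(d * t))) *
      (K * Real.exp (-(d * t)) + 2 * A) * a) atTop (nhds 0) := by
    simpa using ((hmul_exp.const_mul K).mul ((hexp.const_mul K).add_const (2 * A))).mul_const a
  have htail : Tendsto (fun i => (∫ x in (0 : ℝ)..μ i * a, f x ^ 2) - ∫ x in Ioi (0 : ℝ), f x ^ 2)
      l (nhds 0) :=
    tendsto_sub_nhds_zero_iff.2 ((intervalIntegral_tendsto_integral_Ioi 0 hf2 tendsto_id).comp
      (hμ.atTop_mul_const ha))
  have hnear : (fun i => (∫ x in (0 : ℝ)..a, w i x ^ 2) -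
      ∫ x in (0 : ℝ)..a, rescale (Λ i) (μ i) f x ^ 2) =o[l] fun i => Λ i ^ 2 / μ i := by
    refine (IsBigO.of_bound' ?_).trans_isLittleO
      ((hscale.mul_isLittleO ((isLittleO_one_iff ℝ).2 (herr.comp hμ))).congr_right
        fun i => mul_one _)
    filter_upwards [hw, hμ.eventually (eventually_gt_atTop 0)] with i ⟨hΛ, hwc, hwi⟩ hμi
    refine (abs_integral_sq_sub_le (g := rescale (Λ i) (μ i) f) (A := Λ i * A) ha.le hwc
      (continuous_const.mul (hf.comp (continuous_const_mul _))) (fun x hx => ?_) hwi).trans ?_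
    · simp only [rescale, abs_mul, abs_of_nonneg hΛ]
      exact mul_le_mul_of_nonneg_left (hfA _ (mul_nonneg hμi.le hx.1)) hΛ
    · refine le_trans (le_of_eq ?_) (Real.le_norm_self _)
      simp only [Function.comp]
      field_simp
  have hlimit : (fun i => (∫ x in (0 : ℝ)..a, rescale (Λ i) (μ i) f x ^ 2) -
      (∫ x in Ioi (0 : ℝ), f x ^ 2) * (Λ i ^ 2 / μ i)) =o[l] fun i => Λ i ^ 2 / μ i := by
    refine (hscale.mul_isLittleO ((isLittleO_one_iff ℝ).2 htail)).congr' ?_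
      (Eventually.of_forall fun i => mul_one _)
    filter_upwards [hμ.eventually (eventually_ne_atTop 0)] with i hμi
    rw [integral_rescale_sq _ hμi]
    ring
  exact (hnear.add hlimit).congr_left fun i => sub_add_sub_cancel _ _ _

namespace Profile.IsDecaying

variable {N : ℝ → ℝ} {P : Profile N} {C : ℝ}

lemma abs_U_le (hP : P.IsDecaying C) (hC : 0 ≤ C) {x : ℝ} (hx : 0 ≤ x) : |P.U x| ≤ C :=
  (hP.U_le x hx).trans (mul_le_of_le_one_right hC (Real.exp_le_one_iff.2 (neg_nonpos.2 hx)))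

lemma integrableOn_U_sq (hP : P.IsDecaying C) (hC : 0 ≤ C) :
    IntegrableOn (fun x => P.U x ^ 2) (Ioi 0) := by
  refine Integrable.mono' ((integrableOn_exp_neg_Ioi 0).const_mul (C * C))
    (P.continuous_U.pow 2).aestronglyMeasurable ?_
  refine (ae_restrict_iff' measurableSet_Ioi).2 (ae_of_all _ fun x hx => ?_)
  have hx0 : 0 ≤ x := le_of_lt hx
  calc ‖P.U x ^ 2‖ = |P.U x| * |P.U x| := by rw [Real.norm_eq_abs, sq, abs_mul]
    _ ≤ C * (C * Real.exp (-x)) := mul_le_mul (hP.abs_U_le hC hx0) (hP.U_le x hx0) (abs_nonneg _) hC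
    _ = C * C * Real.exp (-x) := (mul_assoc _ _ _).symm

end Profile.IsDecaying

namespace MetricGraph

variable {V E : Type*} (G : MetricGraph V E)

lemma integral_glue_sq {σ : ℝ} (hσ : σ * σ = 1) {w : E × Bool → ℝ → ℝ} {e : E}
    (hw : ∀ b, Continuous (w (e, b))) :
    ∫ x in (0 : ℝ)..G.len e, G.glue σ w e x ^ 2 =
      ∑ b, ∫ x in (0 : ℝ)..G.len e / 2, w (e, b) x ^ 2 := by
  have hl := G.len_pos e
  have hsrc : EqOn (fun x => w (e, false) x ^ 2) (fun x => G.glue σ w e x ^ 2)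
      (uIoc 0 (G.len e / 2)) := fun x hx => by
    rw [uIoc_of_le (half_pos hl).le] at hx
    simp only [glue, if_pos hx.2]
  have htgt : EqOn (fun x => w (e, true) (G.len e - x) ^ 2) (fun x => G.glue σ w e x ^ 2)
      (uIoc (G.len e / 2) (G.len e)) := fun x hx => by
    rw [uIoc_of_le (half_le_self hl.le)] at hx
    simp only [glue, if_neg hx.1.not_ge, mul_pow, sq σ, hσ, one_mul]
  have hcont : Continuous fun x => w (e, true) (G.len e - x) ^ 2 :=
    ((hw true).comp (continuous_const.sub continuous_id)).pow 2
  rw [← intervalIntegral.integral_add_adjacent_intervals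
    ((((hw false).pow 2).intervalIntegrable _ _).congr hsrc)
    ((hcont.intervalIntegrable _ _).congr htgt), Fintype.sum_bool, add_comm,
    ← intervalIntegral.integral_congr_uIoo (hsrc.mono Ioo_subset_Ioc_self),
    ← intervalIntegral.integral_congr_uIoo (htgt.mono Ioo_subset_Ioc_self),
    intervalIntegral.integral_comp_sub_left (fun y => w (e, true) y ^ 2), sub_self, sub_half]

theorem isLittleO_l2Norm_glue_sq_sub [Fintype E] {N : ℝ → ℝ} {P : E × Bool → Profile N}
    {C d K : ℝ} (hC : 0 ≤ C) (hP : ∀ s, (P s).IsDecaying C) (hd : 0 < d) {ι : Type*} {l : Filter ι}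
    {Λ μ : ι → ℝ} {w dw : ι → E × Bool → ℝ → ℝ} (hμ : Tendsto μ l atTop)
    (hw : ∀ᶠ i in l, 0 ≤ Λ i ∧ (∀ s, Continuous (w i s)) ∧
      G.IsNear P d K (Λ i) (μ i) (w i) (dw i)) :
    (fun i => G.l2Norm (G.glue 1 (w i)) ^ 2 -
      (∑ s, ∫ x in Ioi (0 : ℝ), (P s).U x ^ 2) * (Λ i ^ 2 / μ i)) =o[l]
        fun i => Λ i ^ 2 / μ i := by
  have hhalf : ∀ s : E × Bool, (fun i => (∫ x in (0 : ℝ)..G.len s.1 / 2, w i s x ^ 2) -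
      (∫ x in Ioi (0 : ℝ), (P s).U x ^ 2) * (Λ i ^ 2 / μ i)) =o[l] fun i => Λ i ^ 2 / μ i :=
    fun s => isLittleO_integral_sq_sub (P s).continuous_U ((hP s).integrableOn_U_sq hC)
      (fun x hx => (hP s).abs_U_le hC hx) (half_pos (G.len_pos s.1)) hd hμ <| by
        filter_upwards [hw] with i hi
        exact ⟨hi.1, hi.2.1 s, fun x hx => (hi.2.2 s x hx).1⟩
  refine (IsLittleO.sum fun s (_ : s ∈ Finset.univ) => hhalf s).congr' ?_ EventuallyEq.rfl
  filter_upwards [hw] with i hi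
  rw [Finset.sum_apply, Finset.sum_sub_distrib, ← Finset.sum_mul, l2Norm_sq, Fintype.sum_prod_type]
  simp only [G.integral_glue_sq (one_mul 1) fun _ => hi.2.1 _]

end MetricGraph

/-! ### Solutions with peaks at terminal vertices -/

lemma integral_soliton_sq_pos {p : ℝ} (hp : 1 < p) :
    0 < ∫ x in Ioi (0 : ℝ), soliton p x ^ 2 := by
  obtain ⟨C, hC, hC0⟩ :=
    ((eventually_isDecaying_solitonProfile hp).and (eventually_ge_atTop 0)).exists
  have hint : IntegrableOn (fun x => soliton p x ^ 2) (Ioi 0) := hC.integrableOn_U_sq hC0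
  have hsupp : Function.support (fun x => soliton p x ^ 2) = univ :=
    eq_univ_of_forall fun x => pow_ne_zero 2 (soliton_pos hp x).ne'
  rw [integral_pos_iff_support_of_nonneg (fun x => sq_nonneg _) hint, hsupp,
    Measure.restrict_apply_univ, Real.volume_Ioi]
  exact ENNReal.zero_lt_top

lemma isBigO_rpow_mul_exp_neg_mul_sqrt {d : ℝ} (hd : 0 < d) (α β : ℝ) :
    (fun x : ℝ => x ^ β * Real.exp (-(d * Real.sqrt x))) =O[atTop] fun x : ℝ => x ^ (-α) := by
  have hexp := ((isLittleO_exp_neg_mul_rpow_atTop hd (2 * (-α - β))).comp_tendsto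
    Real.tendsto_sqrt_atTop).isBigO
  refine ((isBigO_refl (fun x : ℝ => x ^ β) atTop).mul hexp).congr' ?_ ?_
  · exact Eventually.of_forall fun x => by simp only [Function.comp, neg_mul]
  · filter_upwards [eventually_gt_atTop 0] with x hx
    simp only [Function.comp, Real.sqrt_eq_rpow]
    rw [← Real.rpow_mul hx.le, ← Real.rpow_add hx]
    congr 1
    ring

lemma rpow_sq_div_sqrt {p x : ℝ} (hp : 1 < p) (hx : 0 < x) :
    (x ^ (1 / (p - 1))) ^ 2 / Real.sqrt x = x ^ ((5 - p) / (2 * (p - 1))) := by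
  have hp0 : p - 1 ≠ 0 := (sub_pos.2 hp).ne'
  rw [Real.sqrt_eq_rpow, ← Real.rpow_natCast, ← Real.rpow_mul hx.le, ← Real.rpow_sub hx]
  congr 1
  push_cast
  field_simp
  ring

namespace MetricGraph

variable {V E : Type*} (G : MetricGraph V E) {p : ℝ} (hp : 1 < p) (T : Set V)

open Classical in
/-- The profile of a half-edge for a solution with peaks at the vertices of `T`: the soliton if the
vertex of the half-edge is in `T`, zero otherwise. -/
def halfProfile (s : E × Bool) : Profile (oddPow p) :=
  if G.halfVert s ∈ T then solitonProfile hp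
  else zeroProfile (oddPow_zero p) (deriv_oddPow_zero hp)

variable {T} {s : E × Bool}

lemma halfProfile_of_mem (hs : G.halfVert s ∈ T) : G.halfProfile hp T s = solitonProfile hp :=
  if_pos hs

lemma halfProfile_of_notMem (hs : G.halfVert s ∉ T) :
    G.halfProfile hp T s = zeroProfile (oddPow_zero p) (deriv_oddPow_zero hp) :=
  if_neg hs

variable (T s) in
lemma halfProfile_U_nonneg (x : ℝ) : 0 ≤ (G.halfProfile hp T s).U x := by
  by_cases hs : G.halfVert s ∈ T
  · rw [halfProfile_of_mem G hp hs]
    exact (soliton_pos hp x).le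
  · rw [halfProfile_of_notMem G hp hs]
    exact le_rfl

variable (T) in
lemma exists_isDecaying_halfProfile :
    ∃ C, 1 ≤ C ∧ ∀ s, (G.halfProfile hp T s).IsDecaying C := by
  obtain ⟨C, ⟨hsol, hzero⟩, hC⟩ := (((eventually_isDecaying_solitonProfile hp).and
    (eventually_isDecaying_zeroProfile (oddPow_zero p) (deriv_oddPow_zero hp))).and
    (eventually_ge_atTop 1)).exists
  refine ⟨C, hC, fun s => ?_⟩
  unfold halfProfile
  split_ifs
  exacts [hsol, hzero]

section Finite

variable [Finite E] (hT : ∀ v ∈ T, G.degree v = 1)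
include hT

lemma bijOn_halfVert : BijOn G.halfVert (G.halfVert ⁻¹' T) T := by
  refine ⟨mapsTo_preimage _ _, fun s _ s' hs' h => G.eq_of_degree_eq_one (hT _ hs') rfl h,
    fun v hv => ?_⟩
  have hcard : Nat.card {s // G.halfVert s = v} ≠ 0 := by
    rw [← degree_eq_card_halfVert, hT v hv]
    exact one_ne_zero
  obtain ⟨⟨⟨s, rfl⟩⟩, -⟩ := Nat.card_ne_zero.1 hcard
  exact ⟨s, hv, rfl⟩

lemma isCompatible_halfProfile : (G.halfEdges T hT).IsCompatible (G.halfProfile hp T) where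
  adapted :=
    { dg_of_mem := fun s hs => by
        rw [halfProfile_of_mem G hp hs]
        simp [solitonProfile, solitonSystem]
      f_of_notMem := fun s hs => by
        rw [halfProfile_of_notMem G hp hs]
        simp [zeroProfile]
      df_of_notMem := fun s hs => by
        rw [halfProfile_of_notMem G hp hs]
        simp [zeroProfile]
      g_of_notMem := fun s hs => by
        rw [halfProfile_of_notMem G hp hs]
        simp [zeroProfile]
      dg_of_notMem := fun s hs => by
        rw [halfProfile_of_notMem G hp hs]
        simp [zeroProfile] }
  dU_zero s := by
    by_cases hs : G.halfVert s ∈ T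
    · rw [halfProfile_of_mem G hp hs]
      simp [solitonProfile]
    · rw [halfProfile_of_notMem G hp hs]
      rfl
  U_zero s hs := by
    rw [halfProfile_of_notMem G hp hs]
    rfl

end Finite

lemma sum_integral_halfProfile_sq [Fintype E] (hT : ∀ v ∈ T, G.degree v = 1) :
    ∑ s, ∫ x in Ioi (0 : ℝ), (G.halfProfile hp T s).U x ^ 2 =
      T.ncard * ∫ x in Ioi (0 : ℝ), soliton p x ^ 2 := by
  classical
  have hs : ∀ s, ∫ x in Ioi (0 : ℝ), (G.halfProfile hp T s).U x ^ 2 =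
      if G.halfVert s ∈ T then ∫ x in Ioi (0 : ℝ), soliton p x ^ 2 else 0 := fun s => by
    split_ifs with hs
    · rw [halfProfile_of_mem G hp hs]
      rfl
    · rw [halfProfile_of_notMem G hp hs]
      simp [zeroProfile]
  rw [Finset.sum_congr rfl fun s _ => hs s, ← Finset.sum_filter, Finset.sum_const, nsmul_eq_mul,
    ← (G.bijOn_halfVert hT).ncard_eq, ncard_eq_toFinset_card']
  congr! 3
  ext s
  simp only [Finset.mem_filter_univ, mem_toFinset, mem_preimage]

section Superpose

variable {χ : V → ℝ → ℝ} {δ Λ μ : ℝ}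

lemma superpose_zero {σ : ℝ} {a : E × Bool → ℝ → ℝ} (ha : ∀ s, a s (G.len s.1) = 0) (e : E) :
    G.superpose σ a e 0 = a (e, false) 0 := by
  rw [superpose, sub_zero, ha (e, true), mul_zero, add_zero]

lemma superpose_len {σ : ℝ} {a : E × Bool → ℝ → ℝ} (ha : ∀ s, a s (G.len s.1) = 0) (e : E) :
    G.superpose σ a e (G.len e) = σ * a (e, true) 0 := by
  rw [superpose, sub_self, ha (e, false), zero_add]

lemma exists_vertex_superpose_cut (hδ : 0 ≤ δ) (hδT : ∀ s, G.halfVert s ∈ T → δ ≤ G.len s.1)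
    (hχ : ∀ v, IsCutoff δ (χ v)) : ∃ c : V → ℝ, ∀ e,
      G.superpose 1 (fun s => (G.halfProfile hp T s).cut (χ (G.halfVert s)) Λ μ) e 0 =
        c (G.src e) ∧
      G.superpose 1 (fun s => (G.halfProfile hp T s).cut (χ (G.halfVert s)) Λ μ) e (G.len e) =
        c (G.tgt e) := by
  classical
  have hlen : ∀ s, (G.halfProfile hp T s).cut (χ (G.halfVert s)) Λ μ (G.len s.1) = 0 := fun s => by
    by_cases hs : G.halfVert s ∈ T
    · rw [Profile.cut, (hχ _).2.2 _ (hδT s hs), zero_mul]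
    · rw [halfProfile_of_notMem G hp hs]
      simp [Profile.cut, rescale, zeroProfile]
  have hzero : ∀ s, (G.halfProfile hp T s).cut (χ (G.halfVert s)) Λ μ 0 =
      if G.halfVert s ∈ T then Λ * soliton p 0 else 0 := fun s => by
    rw [Profile.cut, (hχ _).2.1 0 le_rfl (by positivity), one_mul, rescale, mul_zero]
    split_ifs with hs
    · rw [halfProfile_of_mem G hp hs]
      rfl
    · rw [halfProfile_of_notMem G hp hs]
      exact mul_zero Λ
  refine ⟨fun v => if v ∈ T then Λ * soliton p 0 else 0, fun e => ⟨?_, ?_⟩⟩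
  · exact (G.superpose_zero hlen e).trans (hzero (e, false))
  · exact (G.superpose_len hlen e).trans ((one_mul _).trans (hzero (e, true)))

lemma sum_peak_eq_superpose [DecidableEq V] {ι : Type*} [Fintype ι] {v : ι → V}
    (hv : Function.Injective v) (χ : V → ℝ → ℝ) (lam : ℝ) (e : E) (x : ℝ) :
    ∑ i, G.peak p lam (χ (v i)) (v i) e x = G.superpose 1 (fun s =>
      (G.halfProfile hp (range v) s).cut (χ (G.halfVert s)) (lam ^ (1 / (p - 1))) (Real.sqrt lam))
      e x := by
  have hhalf : ∀ s y, ∑ i, (if G.halfVert s = v i then χ (v i) y * scaledSoliton p lam y else 0) =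
      (G.halfProfile hp (range v) s).cut (χ (G.halfVert s)) (lam ^ (1 / (p - 1)))
        (Real.sqrt lam) y := fun s y => by
    by_cases hs : G.halfVert s ∈ range v
    · obtain ⟨i, hi⟩ := id hs
      rw [Finset.sum_eq_single i (fun j _ hj => if_neg fun h => hj (hv (h.symm.trans hi.symm)))
        (fun h => absurd (Finset.mem_univ i) h), if_pos hi.symm, hi,
        halfProfile_of_mem G hp hs]
      rfl
    · rw [Finset.sum_eq_zero fun i _ => if_neg fun h => hs ⟨i, h.symm⟩,
        halfProfile_of_notMem G hp hs]
      simp [Profile.cut, rescale, zeroProfile]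
  simp only [peak, Finset.sum_add_distrib, superpose, one_mul]
  exact congrArg₂ _ (hhalf (e, false) x) (hhalf (e, true) _)

end Superpose

section Peaked

variable [Fintype E] [DecidableEq V]

/-- The functions `w s` on the half-edges form a positive solution on the graph, with derivatives
`dw s`, which is exponentially close to solitons centred at the vertices of `T`. -/
structure IsPeakedSolution (T : Set V) (d K lam : ℝ) (w dw : E × Bool → ℝ → ℝ) : Prop where
  continuous : ∀ s, Continuous (w s)
  isClassicalSolution : G.IsClassicalSolution (oddPow p) lam (G.glue 1 w) (G.glue (-1) dw)
  isNear : G.IsNear (G.halfProfile hp T) d K (lam ^ (1 / (p - 1))) (Real.sqrt lam) w dw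
  pos : ∀ e, ∀ x ∈ Icc 0 (G.len e), 0 < G.glue 1 w e x

variable {δ d K : ℝ}

theorem exists_isPeakedSolution (hG : G.Connected) (hT : ∀ v ∈ T, G.degree v = 1)
    (hTne : T.Nonempty) (hd : 0 < d) (hdG : ∀ e, d ≤ G.len e / 2) :
    ∃ K, ∀ᶠ lam in atTop, ∃ w dw, G.IsPeakedSolution hp T d K lam w dw := by
  obtain ⟨C, hC, hP⟩ := G.exists_isDecaying_halfProfile hp T
  obtain ⟨K, hK⟩ := exists_isClassicalSolution_glue (contDiff_oddPow hp) hC hP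
    (G.isCompatible_halfProfile hp hT) hd hdG
  have hexp : Tendsto (fun μ : ℝ => K * Real.exp (-(d * μ))) atTop (nhds 0) := by
    simpa using (Real.tendsto_exp_neg_atTop_nhds_zero.comp
      (tendsto_id.const_mul_atTop hd)).const_mul K
  have hsmall := hexp.eventually (gt_mem_nhds (lt_min one_pos (soliton_pos hp 0)))
  refine ⟨K, ?_⟩
  filter_upwards [Real.tendsto_sqrt_atTop.eventually (hK.and hsmall), eventually_gt_atTop 0]
    with lam ⟨hsol, hlt⟩ hlam
  have hΛ : (lam ^ (1 / (p - 1))) ^ (p - 1) = lam := by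
    rw [← Real.rpow_mul hlam.le, one_div_mul_cancel (sub_pos.2 hp).ne', Real.rpow_one]
  obtain ⟨w, dw, hwc, hw, hnear⟩ := hsol (lam ^ (1 / (p - 1))) (by positivity) fun y => by
    rw [oddPow_mul _ (by positivity), hΛ, Real.sq_sqrt hlam.le]
    ring
  rw [Real.sq_sqrt hlam.le] at hw
  obtain ⟨v, hv⟩ := hTne
  obtain ⟨s, hs, -⟩ := (G.bijOn_halfVert hT).surjOn hv
  refine ⟨w, dw, hwc, hw, hnear, fun e x hx => (hΛ.symm ▸ hw).pos_of_isNear hG hp (by positivity)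
    hnear (G.halfProfile_U_nonneg hp T) (hlt.trans_le (min_le_left _ _)) ⟨s, ?_⟩ e hx⟩
  rw [halfProfile_of_mem G hp (mem_preimage.1 hs)]
  exact hlt.trans_le (min_le_right _ _)

namespace IsPeakedSolution

variable {G hp} {χ : V → ℝ → ℝ}

lemma l2Norm_glue_pos {lam : ℝ} {w dw : E × Bool → ℝ → ℝ}
    (h : G.IsPeakedSolution hp T d K lam w dw) (hT : ∀ v ∈ T, G.degree v = 1)
    (hTne : T.Nonempty) : 0 < G.l2Norm (G.glue 1 w) := by
  obtain ⟨v, hv⟩ := hTne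
  obtain ⟨s, -, -⟩ := (G.bijOn_halfVert hT).surjOn hv
  have : Nonempty E := ⟨s.1⟩
  exact G.l2Norm_pos (fun e => (h.isClassicalSolution.continuous e).continuousOn) h.pos

lemma hasDerivAt_remainder {lam : ℝ} {w dw : E × Bool → ℝ → ℝ}
    (h : G.IsPeakedSolution hp T d K lam w dw) {χ : E × Bool → ℝ → ℝ}
    (hχ : ∀ s, IsCutoff δ (χ s)) (Λ μ : ℝ) (e : E) (x : ℝ) :
    HasDerivAt (G.remainder (G.halfProfile hp T) χ Λ μ w e)
      (G.dremainder (G.halfProfile hp T) χ Λ μ dw e x) x :=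
  (h.isClassicalSolution.hasDerivAt e x).sub
    (G.hasDerivAt_superpose (fun s => Profile.hasDerivAt_cut (hχ s).1) e x)

lemma continuousOn_dremainder {lam : ℝ} {w dw : E × Bool → ℝ → ℝ}
    (h : G.IsPeakedSolution hp T d K lam w dw) {χ : E × Bool → ℝ → ℝ}
    (hχ : ∀ s, IsCutoff δ (χ s)) (Λ μ : ℝ) (e : E) :
    ContinuousOn (G.dremainder (G.halfProfile hp T) χ Λ μ dw e) (Icc 0 (G.len e)) := by
  have hcut : ∀ b, Continuous ((G.halfProfile hp T (e, b)).dcut (χ (e, b)) Λ μ) := fun b =>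
    Profile.continuous_dcut (hχ _).1
  exact (h.isClassicalSolution.continuousOn_deriv e).sub ((hcut false).add
    (continuous_const.mul ((hcut true).comp (continuous_const.sub continuous_id)))).continuousOn

lemma memH1_remainder {lam : ℝ} {w dw : E × Bool → ℝ → ℝ}
    (h : G.IsPeakedSolution hp T d K lam w dw) (hδ : 0 ≤ δ)
    (hδT : ∀ s, G.halfVert s ∈ T → δ ≤ G.len s.1) (hχ : ∀ v, IsCutoff δ (χ v)) (Λ μ : ℝ) :
    G.MemH1 (G.remainder (G.halfProfile hp T) (fun s => χ (G.halfVert s)) Λ μ w) := by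
  refine G.memH1_of_hasDerivAt (fun e x _ => h.hasDerivAt_remainder (fun s => hχ _) Λ μ e x)
    (h.continuousOn_dremainder (fun s => hχ _) Λ μ) ?_
  obtain ⟨c, hc⟩ := h.isClassicalSolution.exists_vertex
  obtain ⟨c', hc'⟩ := G.exists_vertex_superpose_cut hp (Λ := Λ) (μ := μ) hδ hδT hχ
  exact ⟨c - c', fun e => ⟨congrArg₂ _ (hc e).1 (hc' e).1, congrArg₂ _ (hc e).2 (hc' e).2⟩⟩

variable {w dw : ℝ → E × Bool → ℝ → ℝ}

theorem isBigO_normLam_remainder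
    (h : ∀ᶠ lam in atTop, G.IsPeakedSolution hp T d K lam (w lam) (dw lam))
    {χ : E × Bool → ℝ → ℝ} (hχ : ∀ s, IsCutoff δ (χ s)) (hd : 0 < d) (hdδ : d < δ / 2)
    (hdG : ∀ e, d ≤ G.len e / 2) (α : ℝ) :
    (fun lam => G.normLam lam (G.remainder (G.halfProfile hp T) χ (lam ^ (1 / (p - 1)))
      (Real.sqrt lam) (w lam))) =O[atTop] fun lam : ℝ => lam ^ (-α) := by
  obtain ⟨C, hC, hP⟩ := G.exists_isDecaying_halfProfile hp T
  obtain ⟨D, hD, hrem⟩ :=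
    G.exists_abs_remainder_le (zero_le_one.trans hC) hP hχ hd.le hdδ hdG K
  refine (IsBigO.of_bound (Real.sqrt (2 * ∑ e, G.len e) * D) ?_).trans
    (isBigO_rpow_mul_exp_neg_mul_sqrt hd α (1 / (p - 1) + 1 / 2))
  filter_upwards [h, eventually_ge_atTop 1] with lam hw hlam
  have hlam0 : 0 < lam := one_pos.trans_le hlam
  have hbound := hrem (lam ^ (1 / (p - 1))) _ _ _ (by positivity) (Real.one_le_sqrt.2 hlam)
    hw.isNear
  have hnorm := G.normLam_le (D := D * (lam ^ (1 / (p - 1)) * Real.exp (-(d * Real.sqrt lam))))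
    hlam0.le (by positivity) (fun e x _ => hw.hasDerivAt_remainder hχ _ _ e x)
    (hw.continuousOn_dremainder hχ _ _) (fun e x hx => (hbound e x hx).1)
    (fun e x hx => (hbound e x hx).2.trans_eq (by ring))
  refine (Real.norm_of_nonneg (Real.sqrt_nonneg _)).trans_le (hnorm.trans_eq ?_)
  rw [Real.norm_of_nonneg (by positivity), Real.rpow_add hlam0, ← Real.sqrt_eq_rpow]
  ring

theorem isLittleO_l2Norm_sq_sub (hT : ∀ v ∈ T, G.degree v = 1) (hd : 0 < d)
    (h : ∀ᶠ lam in atTop, G.IsPeakedSolution hp T d K lam (w lam) (dw lam)) :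
    (fun lam => G.l2Norm (G.glue 1 (w lam)) ^ 2 -
      (T.ncard * ∫ x in Ioi (0 : ℝ), soliton p x ^ 2) * lam ^ ((5 - p) / (2 * (p - 1))))
      =o[atTop] fun lam : ℝ => lam ^ ((5 - p) / (2 * (p - 1))) := by
  obtain ⟨C, hC, hP⟩ := G.exists_isDecaying_halfProfile hp T
  have hmass := G.isLittleO_l2Norm_glue_sq_sub (K := K) (w := w) (dw := dw)
    (Λ := fun lam => lam ^ (1 / (p - 1))) (zero_le_one.trans hC) hP hd Real.tendsto_sqrt_atTop <| by
      filter_upwards [h, eventually_ge_atTop 0] with lam hw hlam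
      exact ⟨by positivity, hw.continuous, hw.isNear⟩
  rw [G.sum_integral_halfProfile_sq hp hT] at hmass
  refine hmass.congr' ?_ ?_ <;> filter_upwards [eventually_gt_atTop 0] with lam hlam <;>
    rw [rpow_sq_div_sqrt hp hlam]

end IsPeakedSolution

end Peaked

lemma exists_pos_lt_half [Finite E] {δ : ℝ} (hδ : 0 < δ) :
    ∃ d, 0 < d ∧ d < δ / 2 ∧ ∀ e, d ≤ G.len e / 2 := by
  have hsmall : ∀ {a : ℝ}, 0 < a → ∀ᶠ d in nhdsWithin (0 : ℝ) (Ioi 0), d < a := fun ha =>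
    nhdsWithin_le_nhds (Iio_mem_nhds ha)
  exact (eventually_mem_nhdsWithin.and ((hsmall (half_pos hδ)).and (eventually_all.2 fun e =>
    (hsmall (half_pos (G.len_pos e))).mono fun _ => le_of_lt))).exists

end MetricGraph

lemma exists_isCutoff_comp {V ι : Type*} {v : ι → V} (hv : Function.Injective v) {δ : ℝ}
    {χ : ι → ℝ → ℝ} (hχ : ∀ i, IsCutoff δ (χ i)) (i₀ : ι) :
    ∃ κ : V → ℝ → ℝ, (∀ x, IsCutoff δ (κ x)) ∧ χ = fun i => κ (v i) := by
  refine ⟨Function.extend v χ fun _ => χ i₀, fun x => ?_,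
    funext fun i => (hv.extend_apply _ _ i).symm⟩
  by_cases hx : ∃ i, v i = x
  · obtain ⟨i, rfl⟩ := hx
    rw [hv.extend_apply]
    exact hχ i
  · rw [Function.extend_apply' _ _ _ hx]
    exact hχ i₀

end

theorem mainTheorem4 {V E : Type*} [Fintype V] [DecidableEq V] [Fintype E]
    (G : MetricGraph V E) (hG : G.Connected) (p : ℝ) (hp : 1 < p)
    (k : ℕ) (hk : 1 ≤ k) (v : Fin k → V) (hv : Function.Injective v)
    (hdeg : ∀ i, G.degree (v i) = 1)
    (δ : ℝ) (hδ : 0 < δ)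
    (hδl : ∀ i e, G.src e = v i ∨ G.tgt e = v i → δ < G.len e)
    (χ : Fin k → ℝ → ℝ) (hχ : ∀ i, IsCutoff δ (χ i)) :
    ∃ lam₀ : ℝ, 0 < lam₀ ∧ ∃ (u φ : ℝ → E → ℝ → ℝ) (ρ : ℝ → ℝ),
      (∀ lam : ℝ, lam₀ < lam →
        0 < ρ lam ∧
        G.IsPositiveSolution p lam (ρ lam) (u lam) ∧
        G.MemH1 (φ lam) ∧
        ∀ e, ∀ x ∈ Icc 0 (G.len e),
          u lam e x = (∑ i, G.peak p lam (χ i) (v i) e x) + φ lam e x) ∧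
      (∀ α : ℝ, 0 < α →
        (fun lam : ℝ => G.normLam lam (φ lam)) =O[atTop] fun lam : ℝ => lam ^ (-α)) ∧
      ∃ C : ℝ, 0 < C ∧ C = k * ∫ x in Ioi (0 : ℝ), soliton p x ^ 2 ∧
        (fun lam : ℝ => ρ lam ^ 2 - C * lam ^ ((5 - p) / (2 * (p - 1)))) =o[atTop]
          fun lam : ℝ => lam ^ ((5 - p) / (2 * (p - 1))) := by
  obtain ⟨κ, hκ, rfl⟩ := exists_isCutoff_comp hv hχ ⟨0, hk⟩
  have hT : ∀ x ∈ range v, G.degree x = 1 := forall_mem_range.2 hdeg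
  have hTne : (range v).Nonempty := ⟨v ⟨0, hk⟩, mem_range_self _⟩
  have hδT : ∀ s, G.halfVert s ∈ range v → δ ≤ G.len s.1 := by
    rintro ⟨e, _ | _⟩ ⟨i, hi⟩
    exacts [(hδl i e (.inl hi.symm)).le, (hδl i e (.inr hi.symm)).le]
  obtain ⟨d, hd, hdδ, hdG⟩ := G.exists_pos_lt_half hδ
  obtain ⟨K, hK⟩ := G.exists_isPeakedSolution hp hG hT hTne hd hdG
  obtain ⟨lam₀, hlam₀⟩ := eventually_atTop.1 hK
  choose! w dw hw using hlam₀
  have hw' : ∀ᶠ lam in atTop, G.IsPeakedSolution hp (range v) d K lam (w lam) (dw lam) :=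
    eventually_atTop.2 ⟨lam₀, hw⟩
  have hmass := MetricGraph.IsPeakedSolution.isLittleO_l2Norm_sq_sub hT hd hw'
  rw [ncard_range_of_injective hv, Nat.card_fin] at hmass
  refine ⟨max lam₀ 1, by positivity, fun lam => G.glue 1 (w lam),
    fun lam => G.remainder (G.halfProfile hp (range v)) (fun s => κ (G.halfVert s))
      (lam ^ (1 / (p - 1))) (Real.sqrt lam) (w lam), fun lam => G.l2Norm (G.glue 1 (w lam)),
    fun lam hlam => ?_, fun α _ => MetricGraph.IsPeakedSolution.isBigO_normLam_remainder hw'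
      (fun s => hκ _) hd hdδ hdG α, _,
    mul_pos (Nat.cast_pos.2 hk) (integral_soliton_sq_pos hp), rfl, hmass⟩
  have hwl := hw lam ((le_max_left _ _).trans hlam.le)
  refine ⟨hwl.l2Norm_glue_pos hT hTne, hwl.isClassicalSolution.isPositiveSolution hp hwl.pos,
    hwl.memH1_remainder hδ.le hδT hκ _ _, fun e x _ => ?_⟩
  rw [G.sum_peak_eq_superpose hp hv κ lam e x]
  exact (add_sub_cancel _ _).symm
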